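/- Let $k\ge 2$, let $\Gamma^k=(V,L)$ be the Cayley tree of order $k$ (the tree in which every vertex has exactly $k+1$ neighbours) with a root $x^0$, let $V_n$ and $W_n$ be the ball and the sphere of radius $n$ around $x^0$, and let $1\le m<q$ be integers and $\theta>1$. For a nearest-neighbour Hamiltonian $H$ (inverse temperature included) with a finite spin space $\Phi$, a probability measure $\mu$ on $\Phi^V$ is a splitting Gibbs measure (SGM) with vectors $\tilde h_x\in\mathbb R^{\Phi}$, $x\in V$, if for all $n\ge1$ and $\sigma_n\in\Phi^{V_n}$ $$\mu(\sigma|_{V_n}=\sigma_n)=Z_n^{-1}\exp\Big\{-H_n(\sigma_n)+\sum_{x\in W_n}\tilde h_{\sigma_n(x),x}\Big\},$$ where $H_n$ is the restriction of $H$ to $V_n$. It is a translation-invariant SGM (TISGM) if the $\tilde h_x$ can be chosen with all differences $\tilde h_{a,x}-\tilde h_{b,x}$ independent of $x$. Put $$f_m(z)=\left(\frac{(\theta+m-1)z+q-m}{mz+q-m-1+\theta}\right)^k,\qquad \theta_c=\frac{q+k-1}{k-1},\qquad \theta_m=\min_{x>0}\left(1+\frac{m x^k+q-m}{x+x^2+\dots+x^{k-1}}\right)$$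 (so $\theta_m=1+2\sqrt{m(q-m)}$ if $k=2$). For a solution $z>0$ of $f_m(z)=z$ let $\mu_z$ be the SGM of the $q$-state Potts model with reduced Hamiltonian $-\ln\theta\sum_{\langle x,y\rangle}\delta_{\sigma(x)\sigma(y)}$ and with $\tilde h_{i,x}=\ln z$ for $i\le m$ and $\tilde h_{i,x}=0$ for $i>m$, for all $x\in V$. Let $T(\mu_z)$ be its image on $\{-1,+1\}^V$ under the sitewise map sending the spins $1,\dots,m$ to $+1$ and $m+1,\dots,q$ to $-1$. Consider the effective Ising model $$H'(\phi)=-J'\sum_{\langle x,y\rangle}\phi(x)\phi(y)-h'\sum_x\phi(x),$$ $$e^{4J'}=\frac{(\theta+m-1)(\theta+q-m-1)}{(q-m)m},\qquad e^{\frac{4h'}{k+1}}=\frac{(\theta+m-1)m}{(q-m)(\theta+q-m-1)}\Big(\frac{m}{q-m}\Big)^{-\frac{2k}{k+1}} .$$ Then the following statements hold. 1. If $\theta<\theta_m$, then $z=1$ is the only positive solution of $f_m(z)=z$, and $T(\mu_1)$ (the measure for $z=1$) is the unique TISGM of $H'$. 2. If $\theta=\theta_m$ or $\theta=\theta_c$,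 and $\theta_m\ne\theta_c$, then $f_m(z)=z$ has exactly two positive solutions $z_0=1$ and $z_1$, and $H'$ has exactly two TISGMs, namely the distinct measures $T(\mu_{z_0})$ and $T(\mu_{z_1})$. 3. If $\theta_m<\theta\ne\theta_c$, then $f_m(z)=z$ has exactly three positive solutions $z_0=1$ and $z_1<z_2$, and $H'$ has exactly three TISGMs, namely the distinct measures $T(\mu_{z_0})$, $T(\mu_{z_1})$, $T(\mu_{z_2})$. Moreover, at least two of these three measures are extreme, both in the set of all Gibbs measures (probability measures satisfying the DLR equations) of $H'$ and in the set $\mathcal G(H')$ of all SGMs of $H'$. -/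

import Mathlib

namespace CayleyGibbs

/-! ### Nearest-neighbour models on a locally finite graph -/

/-- A nearest-neighbour model with spin space `E`: a (symmetric) pair energy and a one-site energy.
The inverse temperature is included in the energies, so that the formal (reduced) Hamiltonian is
`∑_{⟨x,y⟩} pair (σ x) (σ y) + ∑_x field (σ x)` and Boltzmann weights are `exp (-energy)`. -/
structure Model (E : Type*) where
  pair : E → E → ℝ
  field : E → ℝ

section Graph

variable {V : Type*} (G : SimpleGraph V) [G.LocallyFinite]

open Classical in
/-- The ball `V_n` around the root: the vertices that can be reached from `x₀` in at most `n`
steps. -/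
noncomputable def ball (x₀ : V) : ℕ → Finset V
  | 0 => {x₀}
  | n + 1 => ball x₀ n ∪ (ball x₀ n).biUnion fun x => G.neighborFinset x

/-- In a connected graph the ball is the usual metric one. -/
theorem mem_ball_iff (hG : G.Connected) (x₀ x : V) (n : ℕ) :
    x ∈ ball G x₀ n ↔ G.dist x₀ x ≤ n := by
  classical
  induction n generalizing x with
  | zero =>
    simp only [ball, Finset.mem_singleton, Nat.le_zero, hG.dist_eq_zero_iff]
    exact eq_comm
  | succ n ih =>
    simp only [ball, Finset.mem_union, Finset.mem_biUnion, SimpleGraph.mem_neighborFinset, ih]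
    constructor
    · rintro (h | ⟨y, hy, hyx⟩)
      · omega
      · have h1 := hG.dist_triangle (u := x₀) (v := y) (w := x)
        have h2 : G.dist y x = 1 := SimpleGraph.dist_eq_one_iff_adj.mpr hyx
        omega
    · intro h
      rcases Nat.lt_or_ge (G.dist x₀ x) (n + 1) with h' | h'
      · exact Or.inl (by omega)
      · right
        obtain ⟨p, hp⟩ := hG.exists_walk_length_eq_dist x x₀
        have hd : p.length = n + 1 := by rw [hp, SimpleGraph.dist_comm]; omega
        cases p with
        | nil => simp at hd
        | @cons _ y _ hxy p =>
          refine ⟨y, ?_, hxy.symm⟩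
          rw [SimpleGraph.dist_comm]
          have := SimpleGraph.dist_le p
          simp only [SimpleGraph.Walk.length_cons] at hd
          omega

variable {E : Type*}

open Classical in
/-- Energy of a configuration in the finite volume `Λ`, over the edges with both ends in `Λ`
(the double sum meets every edge twice) and the sites of `Λ`. -/
noncomputable def innerEnergy (M : Model E) (Λ : Finset V) (ζ : Λ → E) : ℝ :=
  (1 / 2) * (∑ x : Λ, ∑ y : Λ, if G.Adj x y then M.pair (ζ x) (ζ y) else 0)
    + ∑ x : Λ, M.field (ζ x)

open Classical in
/-- Energy in `Λ` with the boundary condition `η` outside `Λ`. -/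
noncomputable def energy (M : Model E) (Λ : Finset V) (η : V → E) (ζ : Λ → E) : ℝ :=
  innerEnergy G M Λ ζ + ∑ x : Λ, ∑ y ∈ G.neighborFinset x \ Λ, M.pair (ζ x) (η y)

open Classical in
/-- The configuration equal to `ζ` on `Λ` and to `η` outside. -/
noncomputable def glue (Λ : Finset V) (ζ : Λ → E) (η : V → E) : V → E :=
  fun x => if h : x ∈ Λ then ζ ⟨x, h⟩ else η x

variable [Fintype E] [MeasurableSpace E]

open Classical in
/-- The finite-volume Gibbs distribution in `Λ` with boundary condition `η`. -/
noncomputable def gibbsKernel (M : Model E) (Λ : Finset V) (η : V → E) :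
    MeasureTheory.Measure (V → E) :=
  ∑ ζ : Λ → E,
    ENNReal.ofReal (Real.exp (-energy G M Λ η ζ) / ∑ ξ : Λ → E, Real.exp (-energy G M Λ η ξ)) •
      MeasureTheory.Measure.dirac (glue Λ ζ η)

/-- The set of all Gibbs measures: probability measures satisfying the DLR equations. -/
def gibbsMeasures (M : Model E) : Set (MeasureTheory.Measure (V → E)) :=
  {μ | MeasureTheory.IsProbabilityMeasure μ ∧
    ∀ (Λ : Finset V) (A : Set (V → E)), MeasurableSet A →
      ∫⁻ η, gibbsKernel G M Λ η A ∂μ = μ A}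

open Classical in
/-- The unnormalised weight
`exp (-H_n(σ_n) + ∑_{x ∈ W_n} h̃_{σ(x),x})` of a configuration on `V_n`,
where `W_n` is the sphere of radius `n`. -/
noncomputable def splittingWeight (M : Model E) (x₀ : V) (h : V → E → ℝ) (n : ℕ)
    (ζ : ball G x₀ n → E) : ℝ :=
  Real.exp (-innerEnergy G M (ball G x₀ n) ζ
    + ∑ x : ball G x₀ n, if G.dist x₀ x = n then h x (ζ x) else 0)

open Classical in
/-- `μ` is the splitting Gibbs measure of the model `M` with the vectors `h x = h̃_x`:
its marginal on `V_n` is the normalised splitting weight, for all `n ≥ 1`. -/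
def IsSplittingGibbs (M : Model E) (x₀ : V) (h : V → E → ℝ)
    (μ : MeasureTheory.Measure (V → E)) : Prop :=
  MeasureTheory.IsProbabilityMeasure μ ∧
    ∀ n : ℕ, 1 ≤ n → ∀ ζ : ball G x₀ n → E,
      μ {ω | ∀ x : ball G x₀ n, ω x = ζ x} =
        ENNReal.ofReal (splittingWeight G M x₀ h n ζ /
          ∑ ξ : ball G x₀ n → E, splittingWeight G M x₀ h n ξ)

/-- The set of all splitting Gibbs measures. -/
def splittingGibbsMeasures (M : Model E) (x₀ : V) : Set (MeasureTheory.Measure (V → E)) :=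
  {μ | ∃ h : V → E → ℝ, IsSplittingGibbs G M x₀ h μ}

/-- The set of translation-invariant splitting Gibbs measures (TISGMs): those for which the
normalised vector, that is, the differences `h̃_{a,x} - h̃_{b,x}`, does not depend on the
vertex `x`. -/
def tisgms (M : Model E) (x₀ : V) : Set (MeasureTheory.Measure (V → E)) :=
  {μ | ∃ h : V → E → ℝ, (∀ x y a b, h x a - h x b = h y a - h y b) ∧
    IsSplittingGibbs G M x₀ h μ}

end Graph

/-! ### The Potts model -/

/-- The `q`-state Potts model, `βH(σ) = -βJ ∑_{⟨x,y⟩} δ_{σ(x)σ(y)}`, with `θ = exp (βJ)`. -/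
noncomputable def potts (q : ℕ) (θ : ℝ) : Model (Fin q) where
  pair a b := if a = b then -Real.log θ else 0
  field _ := 0

/-- `f_m(z) = (((θ+m-1)z + q-m) / (mz + q-m-1+θ))^k`. -/
noncomputable def fm (k q m : ℕ) (θ z : ℝ) : ℝ :=
  (((θ + m - 1) * z + (q - m)) / (m * z + (q - m - 1 + θ))) ^ k

/-- `μ` is the TISGM of the Potts model that belongs to the vector `(z, …, z, 1, …, 1)` with
`m` entries `z` and `q - m` entries `1`, that is `exp (h̃_i) = z` for the first `m` spin values and
`exp (h̃_i) = 1` for the others. -/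
def IsPottsTISGM {V : Type*} (G : SimpleGraph V) [G.LocallyFinite] (x₀ : V)
    (q m : ℕ) (θ z : ℝ) (μ : MeasureTheory.Measure (V → Fin q)) : Prop :=
  IsSplittingGibbs G (potts q θ) x₀ (fun _ i => if (i : ℕ) < m then Real.log z else 0) μ

/-! ### The fuzzy map and the effective Ising model -/

/-- Ising spins: `true` is the fuzzy class `1'` (spin `+1`), `false` is the class `2'`
(spin `-1`). -/
def spin (b : Bool) : ℝ := if b then 1 else -1

/-- The fuzzy map: the first `m` Potts spin values go to the class `1'`, the others to `2'`. -/
def fuzzy (q m : ℕ) (i : Fin q) : Bool := decide ((i : ℕ) < m)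

/-- The image `T(μ)` of a measure under the sitewise fuzzy map. -/
noncomputable def fuzzyMap {V : Type*} (q m : ℕ) (μ : MeasureTheory.Measure (V → Fin q)) :
    MeasureTheory.Measure (V → Bool) :=
  μ.map fun σ x => fuzzy q m (σ x)

/-- The coupling: `exp (4J') = (θ+m-1)(θ+q-m-1) / ((q-m)m)`. -/
noncomputable def isingJ (q m : ℕ) (θ : ℝ) : ℝ :=
  (1 / 4) * Real.log ((θ + m - 1) * (θ + q - m - 1) / ((q - m) * m))

/-- The magnetic field:
`exp (4h'/(k+1)) = (θ+m-1)m / ((q-m)(θ+q-m-1)) * (z/s)^2` with `s/z = (m/(q-m))^{k/(k+1)}`. -/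
noncomputable def isingH (k q m : ℕ) (θ : ℝ) : ℝ :=
  (((k : ℝ) + 1) / 4) * Real.log ((θ + m - 1) * m / ((q - m) * (θ + q - m - 1)) *
    (1 / ((m : ℝ) / (q - m)) ^ ((k : ℝ) / (k + 1))) ^ 2)

/-- The effective Ising model `H'(φ) = -J' ∑_{⟨x,y⟩} φ(x)φ(y) - h' ∑_x φ(x)`. -/
noncomputable def effectiveIsing (k q m : ℕ) (θ : ℝ) : Model Bool where
  pair a b := -(isingJ q m θ * (spin a * spin b))
  field a := -(isingH k q m θ * spin a)

/-! ### Critical values -/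

/-- `θ_m = min_{x > 0} (1 + (m x^k + q - m) / (x + x^2 + ⋯ + x^{k-1}))`. -/
noncomputable def thetaM (k q m : ℕ) : ℝ :=
  ⨅ x : Set.Ioi (0 : ℝ),
    (1 + ((m : ℝ) * (x : ℝ) ^ k + (q - m)) / ∑ i ∈ Finset.Icc 1 (k - 1), (x : ℝ) ^ i)

/-- `θ_c = (q+k-1)/(k-1)`. -/
noncomputable def thetaC (k q : ℕ) : ℝ := ((q : ℝ) + k - 1) / ((k : ℝ) - 1)

/-- For `k = 2` the critical value is `θ_m = 1 + 2 √(m(q-m))`. -/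
theorem thetaM_two (q m : ℕ) (hm : 1 ≤ m) (hmq : m < q) :
    thetaM 2 q m = 1 + 2 * Real.sqrt (m * ((q : ℝ) - m)) := by
  have hm0 : (0 : ℝ) < m := by exact_mod_cast hm
  have hd0 : (0 : ℝ) < (q : ℝ) - m := by
    have : (m : ℝ) < q := by exact_mod_cast hmq
    linarith
  set d : ℝ := (q : ℝ) - m with hd
  set a := Real.sqrt m with ha
  set b := Real.sqrt d with hb
  have ha0 : 0 < a := Real.sqrt_pos.mpr hm0
  have hb0 : 0 < b := Real.sqrt_pos.mpr hd0
  have ha2 : a ^ 2 = m := Real.sq_sqrt hm0.le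
  have hb2 : b ^ 2 = d := Real.sq_sqrt hd0.le
  have hs : Real.sqrt (m * d) = a * b := Real.sqrt_mul hm0.le d
  rw [hs]
  have hlow : ∀ x : Set.Ioi (0 : ℝ), 1 + 2 * (a * b) ≤
      1 + ((m : ℝ) * (x : ℝ) ^ 2 + d) / ∑ i ∈ Finset.Icc 1 (2 - 1), (x : ℝ) ^ i := by
    rintro ⟨x, hx⟩
    have hx0 : (0 : ℝ) < x := hx
    simp only [Nat.add_one_sub_one, Finset.Icc_self, Finset.sum_singleton, pow_one]
    have : 2 * (a * b) ≤ ((m : ℝ) * x ^ 2 + d) / x := by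
      rw [le_div_iff₀ hx0, ← ha2, ← hb2]
      nlinarith [sq_nonneg (a * x - b)]
    linarith
  have : Nonempty (Set.Ioi (0 : ℝ)) := ⟨⟨1, Set.mem_Ioi.mpr one_pos⟩⟩
  refine le_antisymm ?_ (le_ciInf hlow)
  refine (ciInf_le ⟨_, by rintro _ ⟨x, rfl⟩; exact hlow x⟩
    (⟨b / a, div_pos hb0 ha0⟩ : Set.Ioi (0 : ℝ))).trans (le_of_eq ?_)
  simp only [Nat.add_one_sub_one, Finset.Icc_self, Finset.sum_singleton, pow_one]
  rw [← hd, ← ha2, ← hb2]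
  field_simp
  ring

end CayleyGibbs

/-! Summing out the outermost sphere of a splitting measure replaces its constant boundary vector by
another one, computed by `stepField`. For two spin values only the difference of the two entries
matters, and the measure determines it. The TISGMs of H' are therefore parametrised by the fixed
points of a one-dimensional map.

The fuzzy map identifies this map with f_m. The total Potts weight from a spin to a class depends
only on the class of that spin (`sum_fuzzy_potts`), and the resulting 2×2 matrix is an Ising edge
weight times a factor of the parent and a factor of the child (`transferWeight_eq`). This
factorisation dictates J'. The field h' makes the child factor of a site and the parent factors from
its k children multiply to a constant (`childFactor_add`), with a matching balance at the root
(`sum_fuzzy_root`). So T(μ_z) is a splitting measure of H', with the boundary vector merely shifted,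
and in the coordinate log z + shift the Ising recursion is z ↦ f_m(z) (`stepField_effectiveIsing`,
`tisgms_effectiveIsing`).

For the count, put z = x^k. The equation f_m(z) = z splits into x = 1 and `levelFn` x = θ
(`fm_pow_eq_iff`). The function `levelFn` strictly decreases, then strictly increases, is unbounded
at both ends, has minimum θ_m and takes the value θ_c at 1. Its level sets have 0, 1 or 2 points,
and at θ_c one of them merges with the trivial root.

For extremality, J' ≥ 0, so Holley's inequality bounds the probability that all spins of A are +
under any Gibbs measure by the one for a strong + field on a distant sphere. Moving that field
inwards iterates f_m, and the iterates decrease to the largest fixed point. The image for the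
largest z thus maximises all these probabilities among Gibbs measures, and the one for the smallest
z minimises them. Since these probabilities determine a measure, a maximiser or a minimiser is not a
proper mixture. Splitting Gibbs measures satisfy the DLR equations, so the same bounds serve for
both notions of extremality. -/

namespace CayleyGibbs

/-! ### Parents, children and spheres in a rooted regular tree -/

section Tree

variable {V : Type*} {G : SimpleGraph V}

open Classical in
/-- The neighbour of `y` that is closer to the root `x₀` (and `y` itself if there is none). -/
noncomputable def parent (G : SimpleGraph V) (x₀ y : V) : V :=
  if h : ∃ x, G.Adj y x ∧ G.dist x₀ x < G.dist x₀ y then h.choose else y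

theorem exists_adj_dist_lt (hT : G.IsTree) {x₀ y : V} (hy : y ≠ x₀) :
    ∃ x, G.Adj y x ∧ G.dist x₀ x < G.dist x₀ y := by
  obtain ⟨p, hp⟩ := hT.connected.exists_walk_length_eq_dist y x₀
  cases p with
  | nil => exact absurd rfl hy
  | @cons _ x _ hxy p =>
    refine ⟨x, hxy, ?_⟩
    have := SimpleGraph.dist_le p
    rw [SimpleGraph.dist_comm, SimpleGraph.dist_comm (u := x₀), ← hp]
    simp only [SimpleGraph.Walk.length_cons]
    omega

theorem parent_spec (hT : G.IsTree) {x₀ y : V} (hy : y ≠ x₀) :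
    G.Adj y (parent G x₀ y) ∧ G.dist x₀ (parent G x₀ y) < G.dist x₀ y := by
  have h := exists_adj_dist_lt hT hy
  rw [parent, dif_pos h]
  exact h.choose_spec

theorem dist_parent (hT : G.IsTree) {x₀ y : V} (hy : y ≠ x₀) :
    G.dist x₀ (parent G x₀ y) + 1 = G.dist x₀ y := by
  have h := parent_spec hT hy
  rcases hT.dist_eq_dist_add_one_of_adj x₀ h.1 with h1 | h1 <;> omega

/-- A shortest path from the root to a closer neighbour of `y` cannot pass through `y`. Paths in a
tree being unique, the neighbour is the penultimate vertex of the path from the root to `y`. -/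
theorem eq_of_adj_of_dist_lt (hT : G.IsTree) {x₀ x x' y : V} (hx : G.Adj y x)
    (hx' : G.Adj y x') (hd : G.dist x₀ x < G.dist x₀ y) (hd' : G.dist x₀ x' < G.dist x₀ y) :
    x = x' := by
  classical
  obtain ⟨q, hq, -⟩ := (hT.connected x₀ y).exists_path_of_dist
  have key : ∀ w, G.Adj y w → G.dist x₀ w < G.dist x₀ y → w = q.penultimate := by
    intro w hw hwd
    obtain ⟨p, hp, hpd⟩ := (hT.connected x₀ w).exists_path_of_dist
    refine hT.isAcyclic.eq_penultimate_of_adj_end hq hw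
      (hT.isAcyclic.mem_support_of_ne_mem_support_of_adj_of_isPath hq hp hw ?_)
    intro hy
    have h1 := SimpleGraph.dist_le (p.takeUntil y hy)
    have h2 := p.length_takeUntil_le_length hy
    omega
  rw [key x hx hd, key x' hx' hd']

theorem eq_parent (hT : G.IsTree) {x₀ x y : V} (hx : G.Adj y x)
    (hd : G.dist x₀ x < G.dist x₀ y) : x = parent G x₀ y := by
  have hy : y ≠ x₀ := by
    rintro rfl
    simp at hd
  exact eq_of_adj_of_dist_lt hT hx (parent_spec hT hy).1 hd (parent_spec hT hy).2

variable [G.LocallyFinite]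

open Classical in
/-- The sphere of radius `n + 1`, as the difference of two balls. -/
noncomputable def shell (G : SimpleGraph V) [G.LocallyFinite] (x₀ : V) (n : ℕ) : Finset V :=
  ball G x₀ (n + 1) \ ball G x₀ n

open Classical in
/-- The sphere of radius `n`. -/
noncomputable def sphere (G : SimpleGraph V) [G.LocallyFinite] (x₀ : V) (n : ℕ) : Finset V :=
  (ball G x₀ n).filter fun x => G.dist x₀ x = n

theorem mem_sphere (hT : G.IsTree) {x₀ x : V} {n : ℕ} :
    x ∈ sphere G x₀ n ↔ G.dist x₀ x = n := by
  simp only [sphere, Finset.mem_filter, mem_ball_iff G hT.connected]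
  omega

theorem mem_shell (hT : G.IsTree) {x₀ x : V} {n : ℕ} :
    x ∈ shell G x₀ n ↔ G.dist x₀ x = n + 1 := by
  simp only [shell, Finset.mem_sdiff, mem_ball_iff G hT.connected]
  omega

theorem shell_eq_sphere (hT : G.IsTree) (x₀ : V) (n : ℕ) :
    shell G x₀ n = sphere G x₀ (n + 1) := by
  ext x
  rw [mem_shell hT, mem_sphere hT]

theorem ball_mono (hT : G.IsTree) (x₀ : V) : Monotone (ball G x₀) := by
  intro m n h x
  simp only [mem_ball_iff G hT.connected]
  omega

theorem ne_root_of_mem_shell (hT : G.IsTree) {x₀ x : V} {n : ℕ} (hx : x ∈ shell G x₀ n) :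
    x ≠ x₀ := by
  rintro rfl
  simp [mem_shell hT] at hx

theorem parent_mem_sphere (hT : G.IsTree) {x₀ x : V} {n : ℕ} (hx : x ∈ shell G x₀ n) :
    parent G x₀ x ∈ sphere G x₀ n := by
  have h := dist_parent hT (ne_root_of_mem_shell hT hx)
  rw [mem_shell hT] at hx
  rw [mem_sphere hT]
  omega

theorem exists_subset_ball (hT : G.IsTree) (x₀ : V) (Λ : Finset V) : ∃ n, Λ ⊆ ball G x₀ n := by
  refine ⟨Λ.sup (G.dist x₀), fun x hx => ?_⟩
  rw [mem_ball_iff G hT.connected]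
  exact Finset.le_sup (f := G.dist x₀) hx

open Classical in
theorem filter_parent_eq (hT : G.IsTree) {x₀ x : V} {n : ℕ} (hx : x ∈ sphere G x₀ n) :
    (shell G x₀ n).filter (fun y => parent G x₀ y = x) =
      (G.neighborFinset x).filter (fun y => G.dist x₀ x < G.dist x₀ y) := by
  rw [mem_sphere hT] at hx
  ext y
  simp only [Finset.mem_filter, SimpleGraph.mem_neighborFinset, mem_shell hT]
  constructor
  · rintro ⟨hy, rfl⟩
    have hy' : y ≠ x₀ := by
      rintro rfl
      simp at hy
    exact ⟨(parent_spec hT hy').1.symm, by omega⟩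
  · rintro ⟨hxy, hd⟩
    refine ⟨?_, (eq_parent hT hxy.symm hd).symm⟩
    rcases hT.dist_eq_dist_add_one_of_adj x₀ hxy with h1 | h1 <;> omega

open Classical in
-- Away from the root exactly one of the k + 1 neighbours is the parent. The root has none, hence
-- one child more; this is why the recursions below exclude radius 0.
theorem card_children (hT : G.IsTree) {k : ℕ} (hreg : G.IsRegularOfDegree (k + 1)) {x₀ x : V}
    {n : ℕ} (hn : n ≠ 0) (hx : x ∈ sphere G x₀ n) :
    ((shell G x₀ n).filter fun y => parent G x₀ y = x).card = k := by
  rw [filter_parent_eq hT hx]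
  rw [mem_sphere hT] at hx
  have hx0 : x ≠ x₀ := by
    rintro rfl
    simp at hx
    omega
  have : (G.neighborFinset x).filter (fun y => G.dist x₀ x < G.dist x₀ y) =
      (G.neighborFinset x).erase (parent G x₀ x) := by
    ext y
    simp only [Finset.mem_filter, SimpleGraph.mem_neighborFinset, Finset.mem_erase]
    constructor
    · rintro ⟨h, hd⟩
      refine ⟨?_, h⟩
      rintro rfl
      have := (parent_spec hT hx0).2
      omega
    · rintro ⟨hne, h⟩
      refine ⟨h, ?_⟩
      by_contra hlt
      refine hne (eq_parent hT h ?_)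
      have := hT.dist_ne_of_adj x₀ h
      omega
  rw [this, Finset.card_erase_of_mem
    ((SimpleGraph.mem_neighborFinset _ _ _).mpr (parent_spec hT hx0).1)]
  have : (G.neighborFinset x).card = k + 1 := hreg x
  omega

open Classical in
theorem card_children_root (hT : G.IsTree) {k : ℕ} (hreg : G.IsRegularOfDegree (k + 1)) {x₀ x : V}
    (hx : x ∈ sphere G x₀ 0) :
    ((shell G x₀ 0).filter fun y => parent G x₀ y = x).card = k + 1 := by
  rw [filter_parent_eq hT hx]
  rw [mem_sphere hT, hT.connected.dist_eq_zero_iff] at hx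
  subst hx
  rw [Finset.filter_true_of_mem]
  · exact hreg x₀
  · intro y hy
    rw [SimpleGraph.mem_neighborFinset] at hy
    rw [SimpleGraph.dist_self]
    exact hT.connected.pos_dist_of_ne hy.ne

open Classical in
theorem sphere_one_nonempty (hT : G.IsTree) {k : ℕ} (hreg : G.IsRegularOfDegree (k + 1)) (x₀ : V) :
    (sphere G x₀ 1).Nonempty := by
  have h := card_children_root hT hreg (x₀ := x₀) (x := x₀) (by simp [mem_sphere hT])
  have h2 : ((shell G x₀ 0).filter fun y => parent G x₀ y = x₀).Nonempty := by
    rw [← Finset.card_pos, h]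
    omega
  obtain ⟨y, hy⟩ := h2
  exact ⟨y, by rw [← shell_eq_sphere hT]; exact (Finset.mem_filter.mp hy).1⟩

/-- Products over the sphere of radius `n + 1` of functions of the parent. -/
theorem prod_shell_parent (hT : G.IsTree) {k : ℕ} (hreg : G.IsRegularOfDegree (k + 1)) (x₀ : V)
    {n : ℕ} (hn : n ≠ 0) (f : V → ℝ) :
    ∏ y ∈ shell G x₀ n, f (parent G x₀ y) = ∏ x ∈ sphere G x₀ n, f x ^ k := by
  classical
  rw [← Finset.prod_fiberwise_of_maps_to (t := sphere G x₀ n) (g := parent G x₀)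
    (fun y hy => parent_mem_sphere hT hy)]
  refine Finset.prod_congr rfl fun x hx => ?_
  rw [← card_children hT hreg hn hx, ← Finset.prod_const]
  exact Finset.prod_congr rfl fun y hy => by rw [(Finset.mem_filter.mp hy).2]

/-- Radius 0 is included here, because the fuzzy computation starts its induction at the root. -/
theorem sum_shell_parent (hT : G.IsTree) {k : ℕ} (hreg : G.IsRegularOfDegree (k + 1)) (x₀ : V)
    (n : ℕ) (f : V → ℝ) :
    ∑ y ∈ shell G x₀ n, f (parent G x₀ y) =
      ∑ x ∈ sphere G x₀ n, (if n = 0 then (k + 1 : ℝ) else k) * f x := by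
  classical
  rw [← Finset.sum_fiberwise_of_maps_to (t := sphere G x₀ n) (g := parent G x₀)
    (fun y hy => parent_mem_sphere hT hy)]
  refine Finset.sum_congr rfl fun x hx => ?_
  have : (((shell G x₀ n).filter fun y => parent G x₀ y = x).card : ℝ) =
      if n = 0 then (k + 1 : ℝ) else k := by
    split_ifs with h
    · subst h
      rw [card_children_root hT hreg hx]
      push_cast
      ring
    · rw [card_children hT hreg h hx]
  rw [← this, ← nsmul_eq_mul, ← Finset.sum_const]
  exact Finset.sum_congr rfl fun y hy => by rw [(Finset.mem_filter.mp hy).2]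

end Tree

/-! ### Sums over configurations in finite volumes -/

section Glue

variable {V E : Type*}

theorem glue_of_mem {Λ : Finset V} (ζ : Λ → E) (η : V → E) {x : V} (hx : x ∈ Λ) :
    glue Λ ζ η x = ζ ⟨x, hx⟩ := by
  simp [glue, hx]

theorem glue_of_notMem {Λ : Finset V} (ζ : Λ → E) (η : V → E) {x : V} (hx : x ∉ Λ) :
    glue Λ ζ η x = η x := by
  simp [glue, hx]

theorem glue_coe {Λ : Finset V} (ζ : Λ → E) (η : V → E) (x : Λ) : glue Λ ζ η x = ζ x :=
  glue_of_mem ζ η x.2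

theorem restrict_glue {Λ : Finset V} (ζ : Λ → E) (η : V → E) :
    (fun x : Λ => glue Λ ζ η x) = ζ :=
  funext fun x => glue_coe ζ η x

theorem glue_restrict {Λ : Finset V} (η : V → E) : glue Λ (fun x : Λ => η x) η = η := by
  funext x
  by_cases h : x ∈ Λ
  · rw [glue_of_mem _ _ h]
  · rw [glue_of_notMem _ _ h]

variable [Fintype E]

-- The distributive law: a weight that is a product over sites can be summed site by site. Writing
-- configurations as `glue` avoids subtypes in the integrand.
open Classical in
theorem sum_glue_prod {R : Type*} [CommSemiring R] (Λ : Finset V) (g : V → E → R) (η : V → E) :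
    ∑ ζ : Λ → E, ∏ y ∈ Λ, g y (glue Λ ζ η y) = ∏ y ∈ Λ, ∑ b, g y b := by
  rw [← Finset.prod_coe_sort Λ (fun y => ∑ b, g y b), Finset.prod_univ_sum,
    Fintype.piFinset_univ]
  refine Finset.sum_congr rfl fun ζ _ => ?_
  rw [← Finset.prod_coe_sort Λ (fun y => g y (glue Λ ζ η y))]
  exact Finset.prod_congr rfl fun y _ => by rw [glue_coe]

open Classical in
theorem sum_glue_split {R : Type*} [AddCommMonoid R] {Λ Λ' : Finset V} (h : Λ ⊆ Λ')
    (F : (V → E) → R) (η : V → E) :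
    ∑ ξ : Λ' → E, F (glue Λ' ξ η) =
      ∑ ζ : Λ → E, ∑ τ : ↥(Λ' \ Λ) → E, F (glue (Λ' \ Λ) τ (glue Λ ζ η)) := by
  rw [← Fintype.sum_prod_type']
  let e : (Λ' → E) ≃ (Λ → E) × (↥(Λ' \ Λ) → E) :=
    { toFun := fun ξ => (fun x => ξ ⟨x, h x.2⟩, fun x => ξ ⟨x, (Finset.mem_sdiff.mp x.2).1⟩)
      invFun := fun p x => if hx : (x : V) ∈ Λ then p.1 ⟨x, hx⟩ else
        p.2 ⟨x, Finset.mem_sdiff.mpr ⟨x.2, hx⟩⟩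
      left_inv := fun ξ => by
        funext x
        by_cases hx : (x : V) ∈ Λ <;> simp [hx]
      right_inv := fun p => by
        refine Prod.ext ?_ ?_
        · funext x
          simp
        · funext x
          have := (Finset.mem_sdiff.mp x.2).2
          simp [this] }
  refine Fintype.sum_equiv e _ _ fun ξ => ?_
  congr 1
  funext x
  by_cases h1 : x ∈ Λ
  · rw [glue_of_mem _ _ (h h1), glue_of_notMem _ _ (by simp [h1]), glue_of_mem _ _ h1]
    rfl
  · by_cases h2 : x ∈ Λ'
    · rw [glue_of_mem _ _ h2, glue_of_mem _ _ (Finset.mem_sdiff.mpr ⟨h2, h1⟩)]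
      rfl
    · rw [glue_of_notMem _ _ h2, glue_of_notMem _ _ (by simp [h2]), glue_of_notMem _ _ h1]

end Glue

/-! ### Additivity of the energy -/

section Energy

variable {V E : Type*} (G : SimpleGraph V) (M : Model E)

open Classical in
theorem innerEnergy_restrict (Λ : Finset V) (ω : V → E) :
    innerEnergy G M Λ (fun x => ω x) =
      (1 / 2) * (∑ x ∈ Λ, ∑ y ∈ Λ, if G.Adj x y then M.pair (ω x) (ω y) else 0)
        + ∑ x ∈ Λ, M.field (ω x) := by
  rw [innerEnergy, ← Finset.sum_coe_sort Λ (fun x => M.field (ω x)),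
    ← Finset.sum_coe_sort Λ (fun x => ∑ y ∈ Λ, if G.Adj x y then M.pair (ω x) (ω y) else 0)]
  congr 2
  refine Finset.sum_congr rfl fun x _ => ?_
  rw [← Finset.sum_coe_sort Λ]

theorem innerEnergy_congr {Λ : Finset V} {ω ω' : V → E} (h : ∀ x ∈ Λ, ω x = ω' x) :
    innerEnergy G M Λ (fun x => ω x) = innerEnergy G M Λ (fun x => ω' x) := by
  congr 1
  exact funext fun x => h x x.2

-- The two cross sums are equal by symmetry, so the factor 1/2 disappears from the interaction
-- between the two parts.
open Classical in
theorem innerEnergy_union (hM : ∀ a b, M.pair a b = M.pair b a) {Λ S : Finset V}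
    (hd : Disjoint Λ S) (ω : V → E) :
    innerEnergy G M (Λ ∪ S) (fun x => ω x) = innerEnergy G M Λ (fun x => ω x) +
      innerEnergy G M S (fun x => ω x) +
      ∑ x ∈ S, ∑ y ∈ Λ, if G.Adj x y then M.pair (ω x) (ω y) else 0 := by
  simp only [innerEnergy_restrict, Finset.sum_union hd, Finset.sum_add_distrib]
  have : ∑ x ∈ Λ, ∑ y ∈ S, (if G.Adj x y then M.pair (ω x) (ω y) else 0) =
      ∑ x ∈ S, ∑ y ∈ Λ, if G.Adj x y then M.pair (ω x) (ω y) else 0 := by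
    rw [Finset.sum_comm]
    refine Finset.sum_congr rfl fun x _ => Finset.sum_congr rfl fun y _ => ?_
    simp only [G.adj_comm x y, hM (ω x) (ω y)]
  rw [this]
  ring

variable {G} [G.LocallyFinite]

/-- A sphere contains no edge, and each of its vertices has a single neighbour in the smaller ball,
its parent. -/
theorem innerEnergy_ball_succ (hM : ∀ a b, M.pair a b = M.pair b a) (hT : G.IsTree) (x₀ : V)
    (n : ℕ) (ω : V → E) :
    innerEnergy G M (ball G x₀ (n + 1)) (fun x => ω x) =
      innerEnergy G M (ball G x₀ n) (fun x => ω x) +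
        ∑ y ∈ shell G x₀ n, (M.pair (ω (parent G x₀ y)) (ω y) + M.field (ω y)) := by
  classical
  have hu : ball G x₀ (n + 1) = ball G x₀ n ∪ shell G x₀ n := by
    rw [shell, Finset.union_sdiff_of_subset (ball_mono hT x₀ (Nat.le_succ n))]
  have hd : Disjoint (ball G x₀ n) (shell G x₀ n) := by
    rw [shell]
    exact Finset.disjoint_sdiff
  rw [hu, innerEnergy_union G M hM hd, add_assoc]
  congr 1
  have h0 : ∑ x ∈ shell G x₀ n, ∑ y ∈ shell G x₀ n,
      (if G.Adj x y then M.pair (ω x) (ω y) else 0) = 0 := by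
    refine Finset.sum_eq_zero fun x hx => Finset.sum_eq_zero fun y hy => if_neg fun hxy => ?_
    rw [mem_shell hT] at hx hy
    exact hT.dist_ne_of_adj x₀ hxy (hx.trans hy.symm)
  rw [innerEnergy_restrict, h0, mul_zero, zero_add, Finset.sum_add_distrib, add_comm]
  congr 1
  refine Finset.sum_congr rfl fun x hx => ?_
  have hx0 := ne_root_of_mem_shell hT hx
  have hp := parent_spec hT hx0
  rw [Finset.sum_eq_single (parent G x₀ x)]
  · rw [if_pos hp.1, hM]
  · intro y hy hne
    refine if_neg fun hxy => hne (eq_parent hT hxy ?_)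
    rw [mem_ball_iff G hT.connected] at hy
    rw [mem_shell hT] at hx
    omega
  · intro h
    exfalso
    apply h
    have := parent_mem_sphere hT hx
    rw [sphere, Finset.mem_filter] at this
    exact this.1

end Energy

end CayleyGibbs

namespace CayleyGibbs

open MeasureTheory

/-! ### Cylinder sets and the extension of consistent families -/

section Cylinder

variable {V E : Type*}

/-- The configurations that agree with `ω` on `Λ`. -/
def cyl (Λ : Finset V) (ω : V → E) : Set (V → E) := {η | ∀ x ∈ Λ, η x = ω x}

theorem cyl_eq_of_mem {Λ : Finset V} {ω η : V → E} (h : η ∈ cyl Λ ω) : cyl Λ ω = cyl Λ η := by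
  ext ξ
  exact forall₂_congr fun x hx => by rw [h x hx]

theorem setOf_forall_coe_eq_cyl (Λ : Finset V) (ω : V → E) :
    {η : V → E | ∀ x : Λ, η x = (fun x : Λ => ω x) x} = cyl Λ ω := by
  ext η
  simp [cyl]

theorem mem_cyl_glue_iff {Λ : Finset V} (ζ : Λ → E) (ω η : V → E) :
    η ∈ cyl Λ (glue Λ ζ ω) ↔ (fun x : Λ => η x) = ζ := by
  constructor
  · intro h
    funext x
    rw [h x x.2, glue_coe]
  · rintro rfl x hx
    rw [glue_of_mem _ _ hx]

variable [MeasurableSpace E] [MeasurableSingletonClass E]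

theorem measurableSet_cyl (Λ : Finset V) (ω : V → E) : MeasurableSet (cyl Λ ω) := by
  have : cyl Λ ω = ⋂ x ∈ Λ, (fun η : V → E => η x) ⁻¹' {ω x} := by
    ext η
    simp [cyl]
  rw [this]
  exact Finset.measurableSet_biInter _ fun x _ => measurable_pi_apply x (measurableSet_singleton _)

variable [Fintype E]

open Classical in
theorem measure_cyl_split (μ : Measure (V → E)) {Λ Λ' : Finset V} (h : Λ ⊆ Λ') (ω : V → E) :
    μ (cyl Λ ω) = ∑ τ : ↥(Λ' \ Λ) → E, μ (cyl Λ' (glue (Λ' \ Λ) τ ω)) := by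
  have hu : cyl Λ ω = ⋃ τ : ↥(Λ' \ Λ) → E, cyl Λ' (glue (Λ' \ Λ) τ ω) := by
    ext η
    rw [Set.mem_iUnion]
    constructor
    · intro hη
      refine ⟨fun x => η x, fun x hx => ?_⟩
      by_cases hx' : x ∈ Λ
      · rw [glue_of_notMem _ _ (by simp [hx']), hη x hx']
      · rw [glue_of_mem _ _ (Finset.mem_sdiff.mpr ⟨hx, hx'⟩)]
    · rintro ⟨τ, hτ⟩ x hx
      rw [hτ x (h hx), glue_of_notMem _ _ (by simp [hx])]
  rw [hu, measure_iUnion _ (fun τ => measurableSet_cyl _ _), tsum_fintype]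
  intro τ τ' hne
  refine Set.disjoint_left.mpr fun η hη hη' => hne (funext fun x => ?_)
  have hx := (Finset.mem_sdiff.mp x.2).1
  rw [← glue_coe τ ω x, ← hη x hx, hη' x hx, glue_coe]

open Classical in
theorem measure_univ_eq_sum_cyl (μ : Measure (V → E)) (Λ : Finset V) (ω : V → E) :
    μ Set.univ = ∑ ζ : Λ → E, μ (cyl Λ (glue Λ ζ ω)) := by
  have hu : (Set.univ : Set (V → E)) = ⋃ ζ : Λ → E, cyl Λ (glue Λ ζ ω) := by
    ext η
    simp only [Set.mem_univ, Set.mem_iUnion, true_iff, mem_cyl_glue_iff]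
    exact ⟨_, rfl⟩
  rw [hu, measure_iUnion _ (fun ζ => measurableSet_cyl _ _), tsum_fintype]
  intro ζ ζ' hne
  refine Set.disjoint_left.mpr fun η hη hη' => hne ?_
  rw [mem_cyl_glue_iff] at hη hη'
  rw [← hη, ← hη']

variable {G : SimpleGraph V} [G.LocallyFinite]

/-- Finite measures that agree on the cylinder sets over large balls are equal. -/
theorem ext_of_cyl_ball (hT : G.IsTree) (x₀ : V) (N : ℕ) {μ ν : Measure (V → E)}
    [IsFiniteMeasure μ] [IsFiniteMeasure ν]
    (h : ∀ n, N ≤ n → ∀ ω, μ (cyl (ball G x₀ n) ω) = ν (cyl (ball G x₀ n) ω)) : μ = ν := by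
  classical
  rcases isEmpty_or_nonempty (V → E) with hE | ⟨⟨ω₀⟩⟩
  · ext s -
    rw [Set.eq_empty_of_isEmpty s, measure_empty, measure_empty]
  have huniv : μ Set.univ = ν Set.univ := by
    rw [measure_univ_eq_sum_cyl μ (ball G x₀ N) ω₀, measure_univ_eq_sum_cyl ν (ball G x₀ N) ω₀]
    exact Finset.sum_congr rfl fun ζ _ => h N le_rfl _
  let C : Set (Set (V → E)) := {s | ∃ n, N ≤ n ∧ ∃ ω, s = cyl (ball G x₀ n) ω}
  refine ext_of_generate_finite C ?_ ?_ ?_ huniv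
  · refine le_antisymm ?_ ?_
    · refine iSup_le fun x => ?_
      rw [← measurable_iff_comap_le]
      refine @measurable_to_countable' _ _ _ _ (MeasurableSpace.generateFrom C) _ fun a => ?_
      obtain ⟨n, hn⟩ := exists_subset_ball hT x₀ {x}
      have hx : x ∈ ball G x₀ (max N n) :=
        ball_mono hT x₀ (le_max_right N n) (hn (Finset.mem_singleton_self x))
      have : (fun η : V → E => η x) ⁻¹' {a} = ⋃ ζ : ball G x₀ (max N n) → E,
          ⋃ _ : ζ ⟨x, hx⟩ = a, cyl (ball G x₀ (max N n)) (glue _ ζ ω₀) := by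
        ext η
        simp only [Set.mem_preimage, Set.mem_singleton_iff, Set.mem_iUnion, mem_cyl_glue_iff]
        constructor
        · intro h
          exact ⟨_, h, rfl⟩
        · rintro ⟨ζ, hζ, rfl⟩
          exact hζ
      rw [this]
      exact MeasurableSet.iUnion fun ζ => MeasurableSet.iUnion fun _ =>
        MeasurableSpace.measurableSet_generateFrom ⟨_, le_max_left _ _, _, rfl⟩
    · refine MeasurableSpace.generateFrom_le ?_
      rintro _ ⟨n, -, ω, rfl⟩
      exact measurableSet_cyl _ _
  -- Two cylinders over balls that share a point η intersect in the cylinder of η over the larger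
  -- ball, so they form a π-system.
  · rintro _ ⟨n, hn, ω, rfl⟩ _ ⟨m, hm, ω', rfl⟩ ⟨η, hη, hη'⟩
    refine ⟨max n m, hn.trans (le_max_left _ _), η, ?_⟩
    rw [cyl_eq_of_mem hη, cyl_eq_of_mem hη']
    ext ξ
    constructor
    · rintro ⟨h1, h2⟩ x hx
      rcases le_total n m with hnm | hnm
      · exact h2 x (by rwa [max_eq_right hnm] at hx)
      · exact h1 x (by rwa [max_eq_left hnm] at hx)
    · intro h1
      exact ⟨fun x hx => h1 x (ball_mono hT x₀ (le_max_left _ _) hx),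
        fun x hx => h1 x (ball_mono hT x₀ (le_max_right _ _) hx)⟩
  · rintro _ ⟨n, hn, ω, rfl⟩
    exact h n hn ω

/-- Countability makes the configuration space pseudometrizable with a Borel product σ-algebra, as
weak convergence of measures requires. -/
theorem countable_of_isTree (hT : G.IsTree) (x₀ : V) : Countable V := by
  rw [← Set.countable_univ_iff]
  have : (Set.univ : Set V) = ⋃ n, (ball G x₀ n : Set V) := by
    ext x
    simp only [Set.mem_univ, Set.mem_iUnion, true_iff]
    obtain ⟨n, hn⟩ := exists_subset_ball hT x₀ {x}
    exact ⟨n, hn (Finset.mem_singleton_self x)⟩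
  rw [this]
  exact Set.countable_iUnion fun n => (ball G x₀ n).countable_toSet

open Classical Filter Topology in
/-- A consistent family of probability weights on the balls comes from a probability measure. -/
theorem exists_measure_of_consistent (hT : G.IsTree) (x₀ : V) (p : ℕ → (V → E) → ENNReal)
    (ω₀ : V → E) (hp : ∀ n ω ω', (∀ x ∈ ball G x₀ n, ω x = ω' x) → p n ω = p n ω')
    (hsum : ∀ n, 1 ≤ n → ∑ ζ : ball G x₀ n → E, p n (glue _ ζ ω₀) = 1)
    (hcons : ∀ n, 1 ≤ n → ∀ ω, ∑ τ : ↥(ball G x₀ (n + 1) \ ball G x₀ n) → E,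
      p (n + 1) (glue _ τ ω) = p n ω) :
    ∃ μ : Measure (V → E), IsProbabilityMeasure μ ∧
      ∀ n, 1 ≤ n → ∀ ω, μ (cyl (ball G x₀ n) ω) = p n ω := by
  have hV := countable_of_isTree hT x₀
  let ν : ℕ → Measure (V → E) := fun n =>
    ∑ ζ : ball G x₀ n → E, p n (glue _ ζ ω₀) • Measure.dirac (glue _ ζ ω₀)
  have hν : ∀ n ω, ν n (cyl (ball G x₀ n) ω) = p n ω := by
    intro n ω
    simp only [ν, Measure.coe_finsetSum, Finset.sum_apply, Measure.smul_apply, smul_eq_mul,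
      Measure.dirac_apply' _ (measurableSet_cyl _ _)]
    rw [Finset.sum_eq_single (fun x : ball G x₀ n => ω x)]
    · rw [Set.indicator_of_mem, Pi.one_apply, mul_one]
      · exact hp n _ _ fun x hx => glue_of_mem _ _ hx
      · exact fun x hx => glue_of_mem _ _ hx
    · intro ζ _ hne
      rw [Set.indicator_of_notMem, mul_zero]
      intro hmem
      exact hne (funext fun x => by rw [← glue_coe ζ ω₀ x, hmem x x.2])
    · simp
  have hν' : ∀ j n, 1 ≤ n → ∀ ω, ν (n + j) (cyl (ball G x₀ n) ω) = p n ω := by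
    intro j
    induction j with
    | zero => exact fun n _ ω => hν n ω
    | succ j ih =>
      intro n hn ω
      -- Consistency lowers the gap between the radius of the measure and that of the cylinder by
      -- one.
      rw [measure_cyl_split _ (ball_mono hT x₀ (Nat.le_succ n)), ← hcons n hn]
      refine Finset.sum_congr rfl fun τ _ => ?_
      rw [show n + (j + 1) = (n + 1) + j by ring]
      exact ih (n + 1) (by omega) _
  have hνp : ∀ n, IsProbabilityMeasure (ν (n + 1)) := by
    intro n
    constructor
    rw [measure_univ_eq_sum_cyl _ (ball G x₀ (n + 1)) ω₀, ← hsum (n + 1) (by omega)]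
    exact Finset.sum_congr rfl fun ζ _ => hν _ _
  let : TopologicalSpace E := ⊥
  have : DiscreteTopology E := ⟨rfl⟩
  have : BorelSpace E := ⟨by
    rw [borel_eq_top_of_discrete]
    exact eq_top_iff.mpr fun s _ => s.toFinite.measurableSet⟩
  -- The index is shifted because normalisation is known only for radius at least 1.
  let u : ℕ → ProbabilityMeasure (V → E) := fun n => ⟨ν (n + 1), hνp n⟩
  -- The configuration space is compact, hence so is its space of probability measures, and a limit
  -- exists along any ultrafilter.
  let U : Ultrafilter ℕ := hyperfilter ℕ
  have hlim : Tendsto u U (𝓝 (U.map u).lim) := (U.map u).le_nhds_lim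
  refine ⟨((U.map u).lim : ProbabilityMeasure (V → E)), inferInstance, fun n hn ω => ?_⟩
  -- Clopen sets have empty frontier, so their probabilities pass to the weak limit; along the
  -- sequence they are eventually constant.
  have hclopen : IsClopen (cyl (ball G x₀ n) ω) := by
    have : cyl (ball G x₀ n) ω = ⋂ x ∈ ball G x₀ n, (fun η : V → E => η x) ⁻¹' {ω x} := by
      ext η
      simp [cyl]
    rw [this]
    exact isClopen_biInter_finset fun x _ => (isClopen_discrete _).preimage (continuous_apply x)
  have : TopologicalSpace.PseudoMetrizableSpace (V → E) := inferInstance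
  let := TopologicalSpace.pseudoMetrizableSpacePseudoMetric (V → E)
  have hfr : (((U.map u).lim : ProbabilityMeasure (V → E)) : Measure (V → E))
      (frontier (cyl (ball G x₀ n) ω)) = 0 := by
    rw [hclopen.frontier_eq, measure_empty]
  have key := ProbabilityMeasure.tendsto_measure_of_null_frontier_of_tendsto' hlim hfr
  refine tendsto_nhds_unique key (tendsto_const_nhds.congr' ?_)
  refine Eventually.filter_mono Nat.hyperfilter_le_atTop ?_
  filter_upwards [eventually_ge_atTop n] with j hj
  obtain ⟨i, rfl⟩ := Nat.exists_eq_add_of_le hj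
  exact (hν' (i + 1) n hn ω).symm

end Cylinder

end CayleyGibbs

namespace CayleyGibbs

open MeasureTheory

/-! ### The boundary recursion of splitting measures -/

section Splitting

variable {V E : Type*} {G : SimpleGraph V} [G.LocallyFinite] {M : Model E} {x₀ : V}

theorem splittingWeight_restrict (h : V → E → ℝ) (n : ℕ) (ω : V → E) :
    splittingWeight G M x₀ h n (fun x => ω x) =
      Real.exp (-innerEnergy G M (ball G x₀ n) (fun x => ω x)
        + ∑ x ∈ sphere G x₀ n, h x (ω x)) := by
  classical
  rw [splittingWeight, sphere, Finset.sum_filter,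
    ← Finset.sum_coe_sort (ball G x₀ n) fun x => if G.dist x₀ x = n then h x (ω x) else 0]

theorem splittingWeight_pos (h : V → E → ℝ) (n : ℕ) (ζ : ball G x₀ n → E) :
    0 < splittingWeight G M x₀ h n ζ :=
  Real.exp_pos _

variable [Fintype E]

open Classical in
/-- The normalising constant of the splitting weights. -/
noncomputable def partitionFn (G : SimpleGraph V) [G.LocallyFinite] (M : Model E) (x₀ : V)
    (h : V → E → ℝ) (n : ℕ) : ℝ :=
  ∑ ξ : ball G x₀ n → E, splittingWeight G M x₀ h n ξ

variable (G M x₀) in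
/-- The probability that the splitting measure gives to the restriction of `ω` to `V_n`. -/
noncomputable def splitProb (h : V → E → ℝ) (n : ℕ) (ω : V → E) : ℝ :=
  splittingWeight G M x₀ h n (fun x => ω x) / partitionFn G M x₀ h n

open Classical in
theorem partitionFn_pos [Nonempty E] (h : V → E → ℝ) (n : ℕ) : 0 < partitionFn G M x₀ h n :=
  Finset.sum_pos (fun ζ _ => splittingWeight_pos h n ζ) Finset.univ_nonempty

open Classical in
theorem partitionFn_eq (h : V → E → ℝ) (n : ℕ) (ω₀ : V → E) :
    partitionFn G M x₀ h n =
      ∑ ζ : ball G x₀ n → E, splittingWeight G M x₀ h n (fun x => glue _ ζ ω₀ x) :=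
  Finset.sum_congr rfl fun ζ _ => by rw [restrict_glue]

theorem splitProb_pos [Nonempty E] (h : V → E → ℝ) (n : ℕ) (ω : V → E) :
    0 < splitProb G M x₀ h n ω :=
  div_pos (splittingWeight_pos _ _ _) (partitionFn_pos _ _)

open Classical in
theorem sum_splitProb_glue [Nonempty E] (h : V → E → ℝ) (n : ℕ) (ω₀ : V → E) :
    ∑ ζ : ball G x₀ n → E, splitProb G M x₀ h n (glue _ ζ ω₀) = 1 := by
  simp only [splitProb]
  rw [← Finset.sum_div, ← partitionFn_eq h n ω₀, div_self (partitionFn_pos h n).ne']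

theorem splitProb_congr (h : V → E → ℝ) (n : ℕ) {ω ω' : V → E}
    (hω : ∀ x ∈ ball G x₀ n, ω x = ω' x) :
    splitProb G M x₀ h n ω = splitProb G M x₀ h n ω' := by
  have : (fun x : ball G x₀ n => ω x) = fun x : ball G x₀ n => ω' x :=
    funext fun x => hω x x.2
  rw [splitProb, splitProb, this]

/-- A term of the boundary vector that does not depend on the spin cancels against the normalising
constant. -/
theorem splitProb_add_const {h h' : V → E → ℝ} {c : V → ℝ} (hh : ∀ x a, h' x a = h x a + c x)
    (n : ℕ) (ω : V → E) : splitProb G M x₀ h' n ω = splitProb G M x₀ h n ω := by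
  classical
  have key : ∀ ω : V → E, splittingWeight G M x₀ h' n (fun x => ω x) =
      Real.exp (∑ x ∈ sphere G x₀ n, c x) * splittingWeight G M x₀ h n (fun x => ω x) := by
    intro ω
    rw [splittingWeight_restrict, splittingWeight_restrict, ← Real.exp_add]
    simp only [hh, Finset.sum_add_distrib]
    congr 1
    ring
  rw [splitProb, splitProb, partitionFn_eq h' n ω, partitionFn_eq h n ω]
  simp only [key]
  rw [← Finset.mul_sum, mul_div_mul_left _ _ (Real.exp_pos _).ne']

variable (M) in
/-- The recursion for the boundary vectors of a splitting measure with `k` children at each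
vertex. -/
noncomputable def stepField (k : ℕ) (h : E → ℝ) (a : E) : ℝ :=
  k * Real.log (∑ b, Real.exp (-M.pair a b - M.field b + h b))

-- Given the configuration in the ball, the spins of the next sphere are independent. Each sums to a
-- factor depending on its parent, and a parent collects k of them.
open Classical in
theorem sum_splittingWeight_succ [Nonempty E] (hM : ∀ a b, M.pair a b = M.pair b a)
    (hT : G.IsTree) {k : ℕ} (hreg : G.IsRegularOfDegree (k + 1)) (h : E → ℝ) {n : ℕ}
    (hn : n ≠ 0) (ω : V → E) :
    ∑ τ : ↥(ball G x₀ (n + 1) \ ball G x₀ n) → E,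
      splittingWeight G M x₀ (fun _ => h) (n + 1) (fun x => glue _ τ ω x) =
      splittingWeight G M x₀ (fun _ => stepField M k h) n (fun x => ω x) := by
  have key : ∀ τ : shell G x₀ n → E,
      splittingWeight G M x₀ (fun _ => h) (n + 1) (fun x => glue (shell G x₀ n) τ ω x) =
      Real.exp (-innerEnergy G M (ball G x₀ n) (fun x => ω x)) * ∏ y ∈ shell G x₀ n,
        (fun y b => Real.exp (-M.pair (ω (parent G x₀ y)) b - M.field b + h b)) y
          (glue (shell G x₀ n) τ ω y) := by
    intro τ
    have hball : ∀ x ∈ ball G x₀ n, glue (shell G x₀ n) τ ω x = ω x := by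
      intro x hx
      exact glue_of_notMem _ _ (by simp [shell, hx])
    rw [splittingWeight_restrict, innerEnergy_ball_succ M hM hT, innerEnergy_congr G M hball,
      ← shell_eq_sphere hT, ← Real.exp_sum, ← Real.exp_add]
    congr 1
    have : ∀ y ∈ shell G x₀ n, M.pair (glue (shell G x₀ n) τ ω (parent G x₀ y))
          (glue (shell G x₀ n) τ ω y) + M.field (glue (shell G x₀ n) τ ω y) =
        M.pair (ω (parent G x₀ y)) (glue (shell G x₀ n) τ ω y) +
          M.field (glue (shell G x₀ n) τ ω y) := by
      intro y hy
      rw [hball]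
      exact (Finset.mem_filter.mp (parent_mem_sphere hT hy)).1
    rw [Finset.sum_congr rfl this]
    simp only [Finset.sum_add_distrib, Finset.sum_sub_distrib, Finset.sum_neg_distrib]
    ring
  change ∑ τ : shell G x₀ n → E,
      splittingWeight G M x₀ (fun _ => h) (n + 1) (fun x => glue (shell G x₀ n) τ ω x) = _
  rw [Finset.sum_congr rfl fun τ _ => key τ, ← Finset.mul_sum,
    sum_glue_prod (shell G x₀ n)
      (fun y b => Real.exp (-M.pair (ω (parent G x₀ y)) b - M.field b + h b)) ω,
    splittingWeight_restrict, Real.exp_add]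
  congr 1
  rw [prod_shell_parent hT hreg x₀ hn
    (fun x => ∑ b, Real.exp (-M.pair (ω x) b - M.field b + h b)), Real.exp_sum]
  refine Finset.prod_congr rfl fun x _ => ?_
  rw [stepField, mul_comm, Real.exp_mul, Real.exp_log, Real.rpow_natCast]
  exact Finset.sum_pos (fun b _ => Real.exp_pos _) Finset.univ_nonempty

theorem partitionFn_succ [Nonempty E] (hM : ∀ a b, M.pair a b = M.pair b a)
    (hT : G.IsTree) {k : ℕ} (hreg : G.IsRegularOfDegree (k + 1)) (h : E → ℝ) {n : ℕ}
    (hn : n ≠ 0) :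
    partitionFn G M x₀ (fun _ => h) (n + 1) =
      partitionFn G M x₀ (fun _ => stepField M k h) n := by
  classical
  obtain ⟨ω₀⟩ : Nonempty (V → E) := inferInstance
  rw [partitionFn_eq _ _ ω₀, partitionFn_eq _ _ ω₀, sum_glue_split (ball_mono hT x₀ (Nat.le_succ n))
    (fun ω => splittingWeight G M x₀ (fun _ => h) (n + 1) (fun x => ω x))]
  exact Finset.sum_congr rfl fun ζ _ => sum_splittingWeight_succ hM hT hreg h hn _

open Classical in
theorem sum_splitProb_succ [Nonempty E] (hM : ∀ a b, M.pair a b = M.pair b a)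
    (hT : G.IsTree) {k : ℕ} (hreg : G.IsRegularOfDegree (k + 1)) (h : E → ℝ) {n : ℕ}
    (hn : n ≠ 0) (ω : V → E) :
    ∑ τ : ↥(ball G x₀ (n + 1) \ ball G x₀ n) → E,
      splitProb G M x₀ (fun _ => h) (n + 1) (glue _ τ ω) =
      splitProb G M x₀ (fun _ => stepField M k h) n ω := by
  simp only [splitProb]
  rw [← Finset.sum_div, sum_splittingWeight_succ hM hT hreg h hn,
    partitionFn_succ hM hT hreg h hn]

variable [MeasurableSpace E]

theorem isSplittingGibbs_iff [Nonempty E] {h : V → E → ℝ} {μ : Measure (V → E)} :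
    IsSplittingGibbs G M x₀ h μ ↔ IsProbabilityMeasure μ ∧ ∀ n, 1 ≤ n → ∀ ω,
      μ (cyl (ball G x₀ n) ω) = ENNReal.ofReal (splitProb G M x₀ h n ω) := by
  refine and_congr_right fun _ => forall₂_congr fun n _ => ⟨fun H ω => ?_, fun H ζ => ?_⟩
  · rw [← setOf_forall_coe_eq_cyl]
    exact H _
  · obtain ⟨ω₀⟩ : Nonempty (V → E) := inferInstance
    have := H (glue _ ζ ω₀)
    rw [← setOf_forall_coe_eq_cyl] at this
    simp only [glue_coe] at this
    rw [this, splitProb, restrict_glue]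
    rfl

theorem IsSplittingGibbs.congr_add_const [Nonempty E] {h h' : V → E → ℝ} {c : V → ℝ}
    (hh : ∀ x a, h' x a = h x a + c x) {μ : Measure (V → E)} (hμ : IsSplittingGibbs G M x₀ h μ) :
    IsSplittingGibbs G M x₀ h' μ := by
  rw [isSplittingGibbs_iff] at hμ ⊢
  refine ⟨hμ.1, fun n hn ω => ?_⟩
  rw [hμ.2 n hn, splitProb_add_const hh]

variable [MeasurableSingletonClass E]

theorem IsSplittingGibbs.unique [Nonempty E] (hT : G.IsTree) {h : V → E → ℝ}
    {μ ν : Measure (V → E)} (hμ : IsSplittingGibbs G M x₀ h μ)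
    (hν : IsSplittingGibbs G M x₀ h ν) : μ = ν := by
  rw [isSplittingGibbs_iff] at hμ hν
  have := hμ.1
  have := hν.1
  exact ext_of_cyl_ball hT x₀ 1 fun n hn ω => by rw [hμ.2 n hn, hν.2 n hn]

/-- The measure carries both `h` and its image under the recursion. Together with
`IsSplittingGibbs.sub_eq_sub` this forces the fixed point equation. -/
theorem IsSplittingGibbs.stepField [Nonempty E] (hM : ∀ a b, M.pair a b = M.pair b a)
    (hT : G.IsTree) {k : ℕ} (hreg : G.IsRegularOfDegree (k + 1)) {h : E → ℝ} {μ : Measure (V → E)}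
    (hμ : IsSplittingGibbs G M x₀ (fun _ => h) μ) :
    IsSplittingGibbs G M x₀ (fun _ => stepField M k h) μ := by
  classical
  rw [isSplittingGibbs_iff] at hμ ⊢
  refine ⟨hμ.1, fun n hn ω => ?_⟩
  rw [measure_cyl_split μ (ball_mono hT x₀ (Nat.le_succ n)),
    ← sum_splitProb_succ hM hT hreg h (by omega),
    ENNReal.ofReal_sum_of_nonneg fun τ _ => (splitProb_pos _ _ _).le]
  exact Finset.sum_congr rfl fun τ _ => hμ.2 (n + 1) (by omega) _

/-- A fixed point up to the constant `c` makes the marginals consistent, since `c` cancels in the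
normalisation. -/
theorem exists_isSplittingGibbs [Nonempty E] (hM : ∀ a b, M.pair a b = M.pair b a)
    (hT : G.IsTree) {k : ℕ} (hreg : G.IsRegularOfDegree (k + 1)) {h : E → ℝ} {c : ℝ}
    (hc : ∀ a, CayleyGibbs.stepField M k h a = h a + c) :
    ∃ μ, IsSplittingGibbs G M x₀ (fun _ => h) μ := by
  classical
  obtain ⟨ω₀⟩ : Nonempty (V → E) := inferInstance
  obtain ⟨μ, h1, h2⟩ := exists_measure_of_consistent hT x₀
    (fun n ω => ENNReal.ofReal (splitProb G M x₀ (fun _ => h) n ω)) ω₀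
    (fun n ω ω' hω => by rw [splitProb_congr _ _ hω])
    (fun n _ => by
      rw [← ENNReal.ofReal_sum_of_nonneg fun τ _ => (splitProb_pos _ _ _).le,
        sum_splitProb_glue, ENNReal.ofReal_one])
    (fun n hn ω => by
      rw [← ENNReal.ofReal_sum_of_nonneg fun τ _ => (splitProb_pos _ _ _).le,
        sum_splitProb_succ hM hT hreg h (by omega),
        splitProb_add_const (c := fun _ => c) fun x a => hc a])
  exact ⟨μ, isSplittingGibbs_iff.mpr ⟨h1, h2⟩⟩

/-- For two spin values a splitting measure determines the difference of its constant boundary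
vector. -/
theorem IsSplittingGibbs.sub_eq_sub {M : Model Bool} (hT : G.IsTree) {k : ℕ}
    (hreg : G.IsRegularOfDegree (k + 1)) {h h' : Bool → ℝ} {μ : Measure (V → Bool)}
    (hμ : IsSplittingGibbs G M x₀ (fun _ => h) μ) (hμ' : IsSplittingGibbs G M x₀ (fun _ => h') μ) :
    h true - h false = h' true - h' false := by
  rw [isSplittingGibbs_iff] at hμ hμ'
  have key : ∀ ω, splitProb G M x₀ (fun _ => h) 1 ω = splitProb G M x₀ (fun _ => h') 1 ω := by
    intro ω
    have := (hμ.2 1 le_rfl ω).symm.trans (hμ'.2 1 le_rfl ω)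
    rwa [ENNReal.ofReal_eq_ofReal_iff (splitProb_pos _ _ _).le (splitProb_pos _ _ _).le] at this
  -- On the constant configuration `b` in the ball of radius 1 both weights contain the same energy.
  -- It cancels, and what remains does not depend on `b`.
  have hlog : ∀ b, h b * (sphere G x₀ 1).card - h' b * (sphere G x₀ 1).card =
      Real.log (partitionFn G M x₀ (fun _ => h) 1) -
      Real.log (partitionFn G M x₀ (fun _ => h') 1) := by
    intro b
    have hb := congrArg Real.log (key fun _ => b)
    rw [splitProb, splitProb, Real.log_div (splittingWeight_pos _ _ _).ne'
      (partitionFn_pos _ _).ne', Real.log_div (splittingWeight_pos _ _ _).ne'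
      (partitionFn_pos _ _).ne', splittingWeight_restrict _ _ fun _ => b,
      splittingWeight_restrict _ _ fun _ => b, Real.log_exp, Real.log_exp] at hb
    simp only [Finset.sum_const, nsmul_eq_mul] at hb
    linarith
  have hcard : ((sphere G x₀ 1).card : ℝ) ≠ 0 := by
    exact_mod_cast (Finset.card_pos.mpr (sphere_one_nonempty hT hreg x₀)).ne'
  have h1 := (hlog true).trans (hlog false).symm
  have h2 : ((sphere G x₀ 1).card : ℝ) * (h true - h false) =
      (sphere G x₀ 1).card * (h' true - h' false) := by linarith
  exact mul_left_cancel₀ hcard h2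

end Splitting

end CayleyGibbs

namespace CayleyGibbs

open MeasureTheory

/-! ### Splitting Gibbs measures satisfy the DLR equations -/

section DLR

variable {V E : Type*} {G : SimpleGraph V} [G.LocallyFinite] {M : Model E} {x₀ : V}

open Classical in
theorem energy_eq (Λ : Finset V) (η : V → E) (ζ : Λ → E) :
    energy G M Λ η ζ = innerEnergy G M Λ ζ +
      ∑ x ∈ Λ, ∑ y ∈ G.neighborFinset x \ Λ, M.pair (glue Λ ζ η x) (η y) := by
  rw [energy, ← Finset.sum_coe_sort Λ]
  simp only [glue_coe]

open Classical in
theorem energy_congr {Λ : Finset V} {η η' : V → E}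
    (h : ∀ x ∈ Λ, ∀ y, G.Adj x y → y ∉ Λ → η y = η' y) (ζ : Λ → E) :
    energy G M Λ η ζ = energy G M Λ η' ζ := by
  rw [energy, energy]
  congr 1
  refine Finset.sum_congr rfl fun x _ => Finset.sum_congr rfl fun y hy => ?_
  rw [Finset.mem_sdiff, SimpleGraph.mem_neighborFinset] at hy
  rw [h x x.2 y hy.1 hy.2]

theorem mem_ball_of_adj (hT : G.IsTree) {x y : V} {m n : ℕ} (hmn : m < n)
    (hx : x ∈ ball G x₀ m) (hxy : G.Adj x y) : y ∈ ball G x₀ n := by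
  rw [mem_ball_iff G hT.connected] at hx ⊢
  rcases hT.dist_eq_dist_add_one_of_adj x₀ hxy with h | h <;> omega

-- All neighbours of `Λ` lie in the ball and `Λ` misses its boundary sphere, so the spins in `Λ`
-- enter only through their Gibbs weight with boundary condition `ω`.
open Classical in
theorem splittingWeight_glue (hM : ∀ a b, M.pair a b = M.pair b a) (hT : G.IsTree)
    (h : V → E → ℝ) {Λ : Finset V} {m n : ℕ} (hΛ : Λ ⊆ ball G x₀ m) (hmn : m < n)
    (ξ : Λ → E) (ω : V → E) :
    splittingWeight G M x₀ h n (fun x => glue Λ ξ ω x) =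
      Real.exp (-energy G M Λ ω ξ) *
        Real.exp (-innerEnergy G M (ball G x₀ n \ Λ) (fun x => ω x)
          + ∑ x ∈ sphere G x₀ n, h x (ω x)) := by
  have hΛn : Λ ⊆ ball G x₀ n := hΛ.trans (ball_mono hT x₀ hmn.le)
  have hu := innerEnergy_union G M hM (Finset.sdiff_disjoint (s := Λ) (t := ball G x₀ n))
    (glue Λ ξ ω)
  rw [Finset.sdiff_union_of_subset hΛn, restrict_glue] at hu
  rw [splittingWeight_restrict, hu, energy_eq, ← Real.exp_add]
  congr 1
  have h1 : ∑ x ∈ sphere G x₀ n, h x (glue Λ ξ ω x) = ∑ x ∈ sphere G x₀ n, h x (ω x) := by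
    refine Finset.sum_congr rfl fun x hx => ?_
    rw [glue_of_notMem]
    intro hxΛ
    have := hΛ hxΛ
    rw [mem_ball_iff G hT.connected] at this
    rw [mem_sphere hT] at hx
    omega
  have h2 : innerEnergy G M (ball G x₀ n \ Λ) (fun x => glue Λ ξ ω x) =
      innerEnergy G M (ball G x₀ n \ Λ) (fun x => ω x) :=
    innerEnergy_congr G M fun x hx => glue_of_notMem _ _ (Finset.mem_sdiff.mp hx).2
  have h3 : ∑ x ∈ Λ, ∑ y ∈ ball G x₀ n \ Λ,
        (if G.Adj x y then M.pair (glue Λ ξ ω x) (glue Λ ξ ω y) else 0) =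
      ∑ x ∈ Λ, ∑ y ∈ G.neighborFinset x \ Λ, M.pair (glue Λ ξ ω x) (ω y) := by
    refine Finset.sum_congr rfl fun x hx => ?_
    rw [← Finset.sum_filter]
    have : (ball G x₀ n \ Λ).filter (fun y => G.Adj x y) = G.neighborFinset x \ Λ := by
      ext y
      simp only [Finset.mem_filter, Finset.mem_sdiff, SimpleGraph.mem_neighborFinset]
      constructor
      · rintro ⟨⟨-, h⟩, hxy⟩
        exact ⟨hxy, h⟩
      · rintro ⟨hxy, h⟩
        exact ⟨⟨mem_ball_of_adj hT hmn (hΛ hx) hxy, h⟩, hxy⟩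
    rw [this]
    refine Finset.sum_congr rfl fun y hy => ?_
    rw [glue_of_notMem ξ ω (Finset.mem_sdiff.mp hy).2]
  rw [h1, h2, h3]
  ring

theorem measurable_glue [MeasurableSpace E] (Λ : Finset V) (ζ : Λ → E) : Measurable (glue Λ ζ) := by
  refine measurable_pi_iff.mpr fun x => ?_
  by_cases hx : x ∈ Λ
  · simp only [glue_of_mem _ _ hx]
    exact measurable_const
  · simp only [glue_of_notMem _ _ hx]
    exact measurable_pi_apply x

variable [Fintype E]

open Classical in
/-- The Boltzmann probabilities of the finite-volume Gibbs distribution. -/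
noncomputable def gibbsProb (G : SimpleGraph V) [G.LocallyFinite] (M : Model E) (Λ : Finset V)
    (η : V → E) (ζ : Λ → E) : ℝ :=
  Real.exp (-energy G M Λ η ζ) / ∑ ξ : Λ → E, Real.exp (-energy G M Λ η ξ)

theorem gibbsProb_nonneg (Λ : Finset V) (η : V → E) (ζ : Λ → E) : 0 ≤ gibbsProb G M Λ η ζ :=
  div_nonneg (Real.exp_pos _).le (Finset.sum_nonneg fun _ _ => (Real.exp_pos _).le)

open Classical in
theorem sum_gibbsProb [Nonempty E] (Λ : Finset V) (η : V → E) :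
    ∑ ζ : Λ → E, gibbsProb G M Λ η ζ = 1 := by
  simp only [gibbsProb]
  rw [← Finset.sum_div, div_self]
  exact (Finset.sum_pos (fun _ _ => Real.exp_pos _) Finset.univ_nonempty).ne'

variable [MeasurableSpace E]

open Classical in
theorem gibbsKernel_apply (Λ : Finset V) (η : V → E) {A : Set (V → E)} (hA : MeasurableSet A) :
    gibbsKernel G M Λ η A =
      ∑ ζ : Λ → E, ENNReal.ofReal (gibbsProb G M Λ η ζ) * A.indicator 1 (glue Λ ζ η) := by
  simp only [gibbsKernel, Measure.coe_finsetSum, Finset.sum_apply, Measure.smul_apply, smul_eq_mul,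
      Measure.dirac_apply' _ hA]
  rfl

open Classical in
/-- The measure `μ` averaged by the finite-volume Gibbs distribution in `Λ`. -/
noncomputable def gibbsAverage (G : SimpleGraph V) [G.LocallyFinite] (M : Model E) (Λ : Finset V)
    (μ : Measure (V → E)) : Measure (V → E) :=
  ∑ ζ : Λ → E,
    (μ.withDensity fun η => ENNReal.ofReal (gibbsProb G M Λ η ζ)).map (glue Λ ζ)

open Classical in
theorem gibbsAverage_apply (Λ : Finset V) (μ : Measure (V → E)) {A : Set (V → E)}
    (hA : MeasurableSet A) :
    gibbsAverage G M Λ μ A = ∑ ζ : Λ → E, ∫⁻ η,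
      ENNReal.ofReal (gibbsProb G M Λ η ζ) * A.indicator 1 (glue Λ ζ η) ∂μ := by
  simp only [gibbsAverage, Measure.coe_finsetSum, Finset.sum_apply]
  refine Finset.sum_congr rfl fun ζ _ => ?_
  have hpre := measurable_glue Λ ζ hA
  rw [Measure.map_apply (measurable_glue Λ ζ) hA, withDensity_apply _ hpre,
    ← lintegral_indicator hpre]
  refine lintegral_congr fun η => ?_
  by_cases h : glue Λ ζ η ∈ A
  · rw [Set.indicator_of_mem (show η ∈ glue Λ ζ ⁻¹' A from h), Set.indicator_of_mem h,
      Pi.one_apply, mul_one]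
  · rw [Set.indicator_of_notMem (show η ∉ glue Λ ζ ⁻¹' A from h), Set.indicator_of_notMem h,
      mul_zero]

variable [MeasurableSingletonClass E]

theorem measurable_energy (Λ : Finset V) (ζ : Λ → E) :
    Measurable fun η => energy G M Λ η ζ := by
  classical
  simp only [energy]
  refine measurable_const.add (Finset.measurable_sum _ fun x _ =>
    Finset.measurable_sum _ fun y _ => ?_)
  exact (Measurable.of_discrete (f := M.pair (ζ x))).comp (measurable_pi_apply y)

theorem measurable_gibbsProb (Λ : Finset V) (ζ : Λ → E) :
    Measurable fun η => gibbsProb G M Λ η ζ := by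
  classical
  exact ((measurable_energy Λ ζ).neg.exp).div
    (Finset.measurable_sum _ fun ξ _ => (measurable_energy Λ ξ).neg.exp)

open Classical in
theorem measure_cyl_sdiff (μ : Measure (V → E)) {Λ Λ' : Finset V} (h : Λ ⊆ Λ') (ω : V → E) :
    μ (cyl (Λ' \ Λ) ω) = ∑ ζ : Λ → E, μ (cyl Λ' (glue Λ ζ ω)) := by
  have := measure_cyl_split μ (Finset.sdiff_subset (s := Λ') (t := Λ)) ω
  rwa [Finset.sdiff_sdiff_eq_self h] at this

/-- The DLR integral becomes the value of a measure, so that it can be compared with `μ` on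
cylinders only. -/
theorem lintegral_gibbsKernel (Λ : Finset V) (μ : Measure (V → E)) {A : Set (V → E)}
    (hA : MeasurableSet A) :
    ∫⁻ η, gibbsKernel G M Λ η A ∂μ = gibbsAverage G M Λ μ A := by
  classical
  simp only [gibbsKernel_apply Λ _ hA]
  rw [gibbsAverage_apply Λ μ hA, lintegral_finsetSum]
  intro ζ _
  exact ((measurable_gibbsProb Λ ζ).ennreal_ofReal).mul
    ((measurable_one.indicator hA).comp (measurable_glue Λ ζ))

theorem gibbsAverage_univ [Nonempty E] (Λ : Finset V) (μ : Measure (V → E)) :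
    gibbsAverage G M Λ μ Set.univ = μ Set.univ := by
  rw [← lintegral_gibbsKernel Λ μ MeasurableSet.univ]
  simp only [gibbsKernel_apply Λ _ MeasurableSet.univ, Set.indicator_univ, Pi.one_apply, mul_one]
  simp only [← ENNReal.ofReal_sum_of_nonneg fun ζ _ => gibbsProb_nonneg Λ _ ζ, sum_gibbsProb,
    ENNReal.ofReal_one, lintegral_one]

-- Only the restriction of `ω` to `Λ` contributes. Its Gibbs probability is constant on the outer
-- cylinder, because `B` contains every neighbour of `Λ`.
open Classical in
theorem gibbsAverage_cyl {Λ B : Finset V} (hΛB : Λ ⊆ B)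
    (hB : ∀ x ∈ Λ, ∀ y, G.Adj x y → y ∈ B) (μ : Measure (V → E)) (ω : V → E) :
    gibbsAverage G M Λ μ (cyl B ω) =
      ENNReal.ofReal (gibbsProb G M Λ ω fun x => ω x) * μ (cyl (B \ Λ) ω) := by
  classical
  rw [gibbsAverage_apply Λ μ (measurableSet_cyl _ _),
    Finset.sum_eq_single (fun x : Λ => ω x)]
  · rw [← lintegral_indicator_one (measurableSet_cyl _ _), ← lintegral_const_mul _
      (measurable_one.indicator (measurableSet_cyl _ _))]
    refine lintegral_congr fun η => ?_
    by_cases hη : η ∈ cyl (B \ Λ) ω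
    · rw [Set.indicator_of_mem hη, Set.indicator_of_mem]
      · have : ∀ ζ, energy G M Λ η ζ = energy G M Λ ω ζ := energy_congr fun x hx y hxy hy =>
          hη y (Finset.mem_sdiff.mpr ⟨hB x hx y hxy, hy⟩)
        simp only [gibbsProb, this]
        rfl
      · intro x hx
        by_cases hxΛ : x ∈ Λ
        · rw [glue_of_mem _ _ hxΛ]
        · rw [glue_of_notMem _ _ hxΛ, hη x (Finset.mem_sdiff.mpr ⟨hx, hxΛ⟩)]
    · rw [Set.indicator_of_notMem hη, Set.indicator_of_notMem, mul_zero, mul_zero]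
      intro h
      refine hη fun x hx => ?_
      rw [Finset.mem_sdiff] at hx
      rw [← h x hx.1, glue_of_notMem _ _ hx.2]
  · intro ζ _ hne
    refine (lintegral_congr fun η => ?_).trans lintegral_zero
    rw [Set.indicator_of_notMem, mul_zero]
    intro h
    refine hne (funext fun x => ?_)
    rw [← h x (hΛB x.2), glue_coe]
  · simp

/-- Splitting Gibbs measures satisfy the DLR equations. -/
theorem IsSplittingGibbs.mem_gibbsMeasures [Nonempty E] (hM : ∀ a b, M.pair a b = M.pair b a)
    (hT : G.IsTree) {h : V → E → ℝ} {μ : Measure (V → E)} (hμ : IsSplittingGibbs G M x₀ h μ) :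
    μ ∈ gibbsMeasures G M := by
  classical
  rw [isSplittingGibbs_iff] at hμ
  have := hμ.1
  refine ⟨hμ.1, fun Λ A hA => ?_⟩
  rw [lintegral_gibbsKernel Λ μ hA]
  obtain ⟨m, hm⟩ := exists_subset_ball hT x₀ Λ
  have : IsFiniteMeasure (gibbsAverage G M Λ μ) := ⟨by
    rw [gibbsAverage_univ]
    exact measure_lt_top _ _⟩
  refine congrArg (fun ν : Measure (V → E) => ν A) ?_
  refine ext_of_cyl_ball hT x₀ (m + 1) fun n hn ω => ?_
  have hΛn : Λ ⊆ ball G x₀ n := hm.trans (ball_mono hT x₀ (by omega))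
  rw [gibbsAverage_cyl hΛn fun x hx y hxy => mem_ball_of_adj hT (by omega) (hm hx) hxy,
    measure_cyl_sdiff μ hΛn]
  simp only [hμ.2 n (by omega)]
  rw [← ENNReal.ofReal_sum_of_nonneg fun ζ _ => (splitProb_pos _ _ _).le,
    ← ENNReal.ofReal_mul (gibbsProb_nonneg _ _ _)]
  congr 1
  simp only [splitProb]
  have hω := splittingWeight_glue (M := M) hM hT h hm (show m < n by omega) (fun x => ω x) ω
  rw [glue_restrict] at hω
  have hpos : 0 < ∑ ξ : Λ → E, Real.exp (-energy G M Λ ω ξ) :=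
    Finset.sum_pos (fun _ _ => Real.exp_pos _) Finset.univ_nonempty
  rw [hω]
  -- The factor from outside `Λ` is common to all terms of the sum over `Λ`, which leaves the Gibbs
  -- normalisation to cancel.
  simp only [splittingWeight_glue (M := M) hM hT h hm (show m < n by omega) _ ω]
  rw [← Finset.sum_div, ← Finset.sum_mul, gibbsProb, ← mul_div_assoc, ← mul_assoc,
    div_mul_cancel₀ _ hpos.ne']

end DLR

end CayleyGibbs

namespace CayleyGibbs

open MeasureTheory

/-! ### Images of splitting measures under sitewise maps -/

section Image

variable {V E E' : Type*} {G : SimpleGraph V} [G.LocallyFinite] {M : Model E} {M' : Model E'}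
  {x₀ : V}

/-- Total mass one fixes the factor `r`, so the normalising constant of the image never has to be
computed. -/
theorem isSplittingGibbs_of_proportional [Fintype E] [Nonempty E] [MeasurableSpace E]
    [MeasurableSingletonClass E] {h : V → E → ℝ} {μ : Measure (V → E)}
    (hμ : IsProbabilityMeasure μ)
    (H : ∀ n, 1 ≤ n → ∃ r : ℝ, 0 ≤ r ∧ ∀ ω, μ (cyl (ball G x₀ n) ω) =
      ENNReal.ofReal (r * splittingWeight G M x₀ h n fun x => ω x)) :
    IsSplittingGibbs G M x₀ h μ := by
  classical
  rw [isSplittingGibbs_iff]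
  refine ⟨hμ, fun n hn ω => ?_⟩
  obtain ⟨r, hr, hrω⟩ := H n hn
  have h1 := measure_univ_eq_sum_cyl μ (ball G x₀ n) ω
  simp only [hrω] at h1
  rw [measure_univ, ← ENNReal.ofReal_sum_of_nonneg
    fun ζ _ => mul_nonneg hr (splittingWeight_pos _ _ _).le, ← Finset.mul_sum,
    ← partitionFn_eq, ← ENNReal.ofReal_one, ENNReal.ofReal_eq_ofReal_iff zero_le_one
    (mul_nonneg hr (partitionFn_pos _ _).le)] at h1
  have hZ := partitionFn_pos (G := G) (M := M) (x₀ := x₀) h n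
  rw [hrω, splitProb, eq_div_of_mul_eq hZ.ne' h1.symm, one_div_mul_eq_div]

/-- The configurations whose image under `π` agrees with `φ` on `Λ`. -/
def fibre (π : E → E') (Λ : Finset V) (φ : V → E') : Set (V → E) :=
  {σ | ∀ x ∈ Λ, π (σ x) = φ x}

open Classical in
/-- The probability of an event that depends on the spins in `Λ` only. -/
theorem measure_eq_sum_cyl [Fintype E] [MeasurableSpace E] [MeasurableSingletonClass E]
    (μ : Measure (V → E)) {Λ : Finset V} {S : Set (V → E)}
    (hS : ∀ σ σ' : V → E, (∀ x ∈ Λ, σ x = σ' x) → σ ∈ S → σ' ∈ S) (ω₀ : V → E) :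
    μ S = ∑ ζ : Λ → E, S.indicator (fun σ => μ (cyl Λ σ)) (glue Λ ζ ω₀) := by
  simp only [Set.indicator_apply]
  rw [← Finset.sum_filter, ← measure_biUnion_finset _ fun ζ _ => measurableSet_cyl _ _]
  · congr 1
    ext σ
    simp only [Finset.mem_filter, Finset.mem_univ, true_and, Set.mem_iUnion, exists_prop,
      mem_cyl_glue_iff]
    constructor
    · intro hσ
      exact ⟨fun x => σ x, hS σ _ (fun x hx => by rw [glue_of_mem _ _ hx]) hσ, rfl⟩
    · rintro ⟨ζ, hζ, rfl⟩
      exact hS _ σ (fun x hx => glue_of_mem _ _ hx) hζ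
  · intro ζ _ ζ' _ hne
    refine Set.disjoint_left.mpr fun η hη hη' => hne ?_
    rw [mem_cyl_glue_iff] at hη hη'
    rw [← hη, ← hη']

open Classical in
theorem measure_map_cyl [Fintype E] [MeasurableSpace E] [MeasurableSingletonClass E]
    [MeasurableSpace E'] [MeasurableSingletonClass E'] (π : E → E')
    (μ : Measure (V → E)) (Λ : Finset V) (φ : V → E') (ω₀ : V → E) :
    μ.map (fun σ x => π (σ x)) (cyl Λ φ) =
      ∑ ζ : Λ → E, (fibre π Λ φ).indicator (fun σ => μ (cyl Λ σ)) (glue Λ ζ ω₀) := by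
  have hπ : Measurable fun (σ : V → E) x => π (σ x) :=
    measurable_pi_iff.mpr fun x => Measurable.of_discrete.comp (measurable_pi_apply x)
  rw [Measure.map_apply hπ (measurableSet_cyl _ _)]
  exact measure_eq_sum_cyl μ (S := fibre π Λ φ)
    (fun σ σ' h hσ x hx => by rw [← h x hx]; exact hσ x hx) ω₀

theorem innerEnergy_ball_zero (M : Model E) (x₀ : V) (ω : V → E) :
    innerEnergy G M (ball G x₀ 0) (fun x => ω x) = M.field (ω x₀) := by
  rw [innerEnergy_restrict, show ball G x₀ 0 = {x₀} from rfl]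
  simp

variable [Fintype E] [DecidableEq E'] (π : E → E') {A B : E' → ℝ} {c d D : ℝ} {k : ℕ}

open Classical in
/-- Summing the Boltzmann weights in a ball over a fibre of a sitewise map `π` gives Boltzmann
weights of `M'`, up to a product of factors on the sphere, if the one-step transfer sums do. -/
theorem sum_fibre_weight [Nonempty E] (hM : ∀ a b, M.pair a b = M.pair b a)
    (hM' : ∀ a b, M'.pair a b = M'.pair b a)
    (hT : G.IsTree) (hreg : G.IsRegularOfDegree (k + 1))
    (hK : ∀ a b', (∑ b, if π b = b' then Real.exp (-M.pair a b - M.field b) else 0) =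
      Real.exp (c - M'.pair (π a) b' - M'.field b' + A (π a) + B b'))
    (hAB : ∀ a', B a' + k * A a' = D)
    (hroot : ∀ a', (∑ a, if π a = a' then Real.exp (-M.field a) else 0) =
      Real.exp (d - M'.field a' - (k + 1) * A a')) (n : ℕ) (ω₀ : V → E) :
    ∃ C : ℝ, ∀ φ : V → E', (∑ ζ : ball G x₀ n → E,
        (fibre π (ball G x₀ n) φ).indicator (fun σ => Real.exp
          (-innerEnergy G M (ball G x₀ n) fun x => σ x)) (glue _ ζ ω₀)) =
      Real.exp (C - innerEnergy G M' (ball G x₀ n) (fun x => φ x) +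
        ∑ x ∈ sphere G x₀ n, if n = 0 then -((k + 1) * A (φ x)) else B (φ x)) := by
  induction n with
  | zero =>
    -- The root is nobody's child, so it has no factor `B`. Its sphere term is set to cancel the k +
    -- 1 parent factors of the next step.
    refine ⟨d, fun φ => ?_⟩
    simp only [Set.indicator_apply]
    have hb : ball G x₀ 0 = {x₀} := rfl
    have hs : sphere G x₀ 0 = {x₀} := by
      ext x
      rw [mem_sphere hT, hT.connected.dist_eq_zero_iff, Finset.mem_singleton, eq_comm]
    have hin : ∀ ζ : ball G x₀ 0 → E, innerEnergy G M (ball G x₀ 0) (fun x => glue _ ζ ω₀ x) =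
        M.field (glue _ ζ ω₀ x₀) := fun ζ => innerEnergy_ball_zero M x₀ _
    simp only [hin, innerEnergy_ball_zero M' x₀ φ, if_true, hs, Finset.sum_singleton]
    rw [show d - M'.field (φ x₀) + -((k + 1) * A (φ x₀)) =
      d - M'.field (φ x₀) - (k + 1) * A (φ x₀) by ring, ← hroot (φ x₀)]
    have := sum_glue_prod (ball G x₀ 0)
      (fun x a => if π a = φ x then Real.exp (-M.field a) else 0) ω₀
    simp only [hb, Finset.prod_singleton] at this
    rw [← this]
    simp [hb, fibre]
  | succ n ih =>
    obtain ⟨C, hC⟩ := ih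
    -- Each new edge brings `c`. Each vertex of the old sphere brings `B` plus k times `A`, which is
    -- `D`; at the root the k + 1 parent factors cancel and leave 0.
    refine ⟨C + c * (shell G x₀ n).card +
      (if n = 0 then 0 else D) * (sphere G x₀ n).card, fun φ => ?_⟩
    rw [sum_glue_split (Λ' := ball G x₀ (n + 1)) (ball_mono hT x₀ (Nat.le_succ n))
        ((fibre π (ball G x₀ (n + 1)) φ).indicator fun σ =>
          Real.exp (-innerEnergy G M (ball G x₀ (n + 1)) fun x => σ x))]
    have hsub : ∀ x ∈ sphere G x₀ n, x ∈ ball G x₀ n := fun x hx => (Finset.mem_filter.mp hx).1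
    have key : ∀ ω : V → E, (∑ τ : shell G x₀ n → E,
        (fibre π (ball G x₀ (n + 1)) φ).indicator (fun σ =>
          Real.exp (-innerEnergy G M (ball G x₀ (n + 1)) fun x => σ x))
          (glue (shell G x₀ n) τ ω)) =
        (fibre π (ball G x₀ n) φ).indicator (fun σ =>
          Real.exp (-innerEnergy G M (ball G x₀ n) fun x => σ x)) ω *
        ∏ y ∈ shell G x₀ n, Real.exp (c - M'.pair (φ (parent G x₀ y)) (φ y) - M'.field (φ y)
          + A (φ (parent G x₀ y)) + B (φ y)) := by
      intro ω
      have hball : ∀ τ, ∀ x ∈ ball G x₀ n, glue (shell G x₀ n) τ ω x = ω x := by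
        intro τ x hx
        exact glue_of_notMem _ _ (by simp [shell, hx])
      by_cases hω : ω ∈ fibre π (ball G x₀ n) φ
      · rw [Set.indicator_of_mem hω]
        have h1 : ∀ τ : shell G x₀ n → E,
            (fibre π (ball G x₀ (n + 1)) φ).indicator (fun σ =>
              Real.exp (-innerEnergy G M (ball G x₀ (n + 1)) fun x => σ x))
              (glue (shell G x₀ n) τ ω) = Real.exp (-innerEnergy G M (ball G x₀ n) fun x => ω x) *
              ∏ y ∈ shell G x₀ n, (fun y b => if π b = φ y then
                Real.exp (-M.pair (ω (parent G x₀ y)) b - M.field b) else 0) y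
                (glue (shell G x₀ n) τ ω y) := by
          intro τ
          have hiff : glue (shell G x₀ n) τ ω ∈ fibre π (ball G x₀ (n + 1)) φ ↔
              ∀ x ∈ shell G x₀ n, π (glue (shell G x₀ n) τ ω x) = φ x := by
            constructor
            · intro h x hx
              exact h x (Finset.mem_sdiff.mp hx).1
            · intro h x hx
              by_cases hx' : x ∈ ball G x₀ n
              · rw [hball τ x hx', hω x hx']
              · exact h x (Finset.mem_sdiff.mpr ⟨hx, hx'⟩)
          -- The fibre condition on the shell is a product of sitewise indicators, so the
          -- constrained sum still factorises.
          rw [Finset.prod_ite_zero, mul_ite, mul_zero, Set.indicator_apply]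
          refine if_congr hiff ?_ rfl
          rw [innerEnergy_ball_succ M hM hT, innerEnergy_congr G M (hball τ), ← Real.exp_sum,
            ← Real.exp_add, neg_add, ← Finset.sum_neg_distrib]
          congr 2
          refine Finset.sum_congr rfl fun y hy => ?_
          rw [hball τ _ (hsub _ (parent_mem_sphere hT hy))]
          ring
        rw [Finset.sum_congr rfl fun τ _ => h1 τ, ← Finset.mul_sum, sum_glue_prod (shell G x₀ n)
          (fun y b => if π b = φ y then
                Real.exp (-M.pair (ω (parent G x₀ y)) b - M.field b) else 0) ω]
        congr 1
        refine Finset.prod_congr rfl fun y hy => ?_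
        rw [hK, hω _ (hsub _ (parent_mem_sphere hT hy))]
      · rw [Set.indicator_of_notMem hω, zero_mul]
        refine Finset.sum_eq_zero fun τ _ => Set.indicator_of_notMem (fun h => hω fun x hx => ?_) _
        rw [← hball τ x hx]
        exact h x (ball_mono hT x₀ (Nat.le_succ n) hx)
    refine (Finset.sum_congr rfl fun ζ _ => key (glue _ ζ ω₀)).trans ?_
    rw [← Finset.sum_mul, hC φ, ← Real.exp_sum, ← Real.exp_add, innerEnergy_ball_succ M' hM' hT,
      ← shell_eq_sphere hT]
    congr 1
    have hA := sum_shell_parent hT hreg x₀ n (fun x => A (φ x))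
    have hD : ∑ x ∈ sphere G x₀ n, (if n = 0 then -((k + 1) * A (φ x)) else B (φ x)) +
        ∑ y ∈ shell G x₀ n, A (φ (parent G x₀ y)) =
        (if n = 0 then 0 else D) * (sphere G x₀ n).card := by
      rw [hA, ← Finset.sum_add_distrib, mul_comm, ← nsmul_eq_mul, ← Finset.sum_const]
      refine Finset.sum_congr rfl fun x _ => ?_
      split_ifs with h
      · ring
      · exact hAB _
    rw [← hD]
    simp only [Finset.sum_add_distrib, Finset.sum_sub_distrib, Finset.sum_const, nsmul_eq_mul,
      Nat.add_eq_zero_iff, one_ne_zero, and_false, if_false]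
    ring

variable [MeasurableSpace E] [MeasurableSingletonClass E] [Fintype E'] [Nonempty E']
  [MeasurableSpace E'] [MeasurableSingletonClass E']

open Classical in
/-- The image of a splitting measure under a sitewise map is again a splitting measure. -/
theorem IsSplittingGibbs.map [Nonempty E] (hM : ∀ a b, M.pair a b = M.pair b a)
    (hM' : ∀ a b, M'.pair a b = M'.pair b a)
    (hT : G.IsTree) (hreg : G.IsRegularOfDegree (k + 1))
    (hK : ∀ a b', (∑ b, if π b = b' then Real.exp (-M.pair a b - M.field b) else 0) =
      Real.exp (c - M'.pair (π a) b' - M'.field b' + A (π a) + B b'))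
    (hAB : ∀ a', B a' + k * A a' = D)
    (hroot : ∀ a', (∑ a, if π a = a' then Real.exp (-M.field a) else 0) =
      Real.exp (d - M'.field a' - (k + 1) * A a')) {g : E' → ℝ} {μ : Measure (V → E)}
    (hμ : IsSplittingGibbs G M x₀ (fun _ a => g (π a)) μ) :
    IsSplittingGibbs G M' x₀ (fun _ a => g a + B a) (μ.map fun σ x => π (σ x)) := by
  rw [isSplittingGibbs_iff] at hμ
  have := hμ.1
  have hπ : Measurable fun (σ : V → E) x => π (σ x) :=
    measurable_pi_iff.mpr fun x => Measurable.of_discrete.comp (measurable_pi_apply x)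
  refine isSplittingGibbs_of_proportional (Measure.isProbabilityMeasure_map hπ.aemeasurable)
    fun n hn => ?_
  obtain ⟨ω₀⟩ : Nonempty (V → E) := inferInstance
  obtain ⟨C, hC⟩ := sum_fibre_weight (x₀ := x₀) π hM hM' hT hreg hK hAB hroot n ω₀
  have hZ := partitionFn_pos (G := G) (M := M) (x₀ := x₀) (fun _ a => g (π a)) n
  refine ⟨Real.exp C / partitionFn G M x₀ (fun _ a => g (π a)) n, by positivity, fun φ => ?_⟩
  rw [measure_map_cyl π μ _ φ ω₀]
  simp only [hμ.2 n hn]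
  have h1 : ∀ ζ : ball G x₀ n → E,
      (fibre π (ball G x₀ n) φ).indicator (fun σ => ENNReal.ofReal
        (splitProb G M x₀ (fun _ a => g (π a)) n σ)) (glue _ ζ ω₀) =
      ENNReal.ofReal ((fibre π (ball G x₀ n) φ).indicator (fun σ =>
          Real.exp (-innerEnergy G M (ball G x₀ n) fun x => σ x)) (glue _ ζ ω₀) *
        (Real.exp (∑ x ∈ sphere G x₀ n, g (φ x)) /
          partitionFn G M x₀ (fun _ a => g (π a)) n)) := by
    intro ζ
    by_cases h : glue (ball G x₀ n) ζ ω₀ ∈ fibre π (ball G x₀ n) φ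
    · rw [Set.indicator_of_mem h, Set.indicator_of_mem h, splitProb,
        splittingWeight_restrict, Real.exp_add, mul_div_assoc]
      congr 4
      exact Finset.sum_congr rfl fun x hx => by rw [h x (Finset.mem_filter.mp hx).1]
    · rw [Set.indicator_of_notMem h, Set.indicator_of_notMem h, zero_mul, ENNReal.ofReal_zero]
  rw [Finset.sum_congr rfl fun ζ _ => h1 ζ, ← ENNReal.ofReal_sum_of_nonneg, ← Finset.sum_mul, hC,
    splittingWeight_restrict, ← mul_div_assoc, div_mul_eq_mul_div, ← Real.exp_add, ← Real.exp_add]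
  · congr 3
    simp only [show n ≠ 0 by omega, if_false, Finset.sum_add_distrib]
    ring
  · intro ζ _
    refine mul_nonneg ?_ (by positivity)
    exact Set.indicator_nonneg (fun _ _ => (Real.exp_pos _).le) _

end Image

end CayleyGibbs

namespace CayleyGibbs

open MeasureTheory

/-! ### Stochastic domination for the Ising ferromagnet -/

section Ferromagnet

variable {V : Type*} {G : SimpleGraph V} {M : Model Bool} {J : ℝ} {x₀ : V}

theorem spin_mul_add_le (a b c d : Bool) :
    spin a * spin b + spin c * spin d ≤
      spin (a ⊓ c) * spin (b ⊓ d) + spin (a ⊔ c) * spin (b ⊔ d) := by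
  cases a <;> cases b <;> cases c <;> cases d <;> norm_num [spin]

theorem apply_inf_add_apply_sup (f : Bool → ℝ) (a b : Bool) :
    f (a ⊓ b) + f (a ⊔ b) = f a + f b := by
  cases a <;> cases b <;> simp [add_comm]

theorem add_le_apply_inf_add_apply_sup {u u' : Bool → ℝ}
    (h : u true - u false ≤ u' true - u' false) (a b : Bool) :
    u a + u' b ≤ u (a ⊓ b) + u' (a ⊔ b) := by
  cases a <;> cases b <;> (simp; try linarith)

/-- The field part is modular at each site, whatever its sign, and each ferromagnetic bond is
submodular by `spin_mul_add_le`. This is the lattice condition for Holley's inequality. -/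
theorem innerEnergy_inf_add_sup_le (hJ : 0 ≤ J)
    (hM : ∀ a b, M.pair a b = -(J * (spin a * spin b))) (Λ : Finset V) (a b : Λ → Bool) :
    innerEnergy G M Λ (a ⊓ b) + innerEnergy G M Λ (a ⊔ b) ≤
      innerEnergy G M Λ a + innerEnergy G M Λ b := by
  classical
  have hfield : ∑ x, M.field ((a ⊓ b) x) + ∑ x, M.field ((a ⊔ b) x) =
      ∑ x, M.field (a x) + ∑ x, M.field (b x) := by
    rw [← Finset.sum_add_distrib, ← Finset.sum_add_distrib]
    exact Finset.sum_congr rfl fun x _ => apply_inf_add_apply_sup _ _ _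
  have hpair : (∑ x : Λ, ∑ y : Λ, if G.Adj x y then M.pair ((a ⊓ b) x) ((a ⊓ b) y) else 0) +
      (∑ x : Λ, ∑ y : Λ, if G.Adj x y then M.pair ((a ⊔ b) x) ((a ⊔ b) y) else 0) ≤
      (∑ x : Λ, ∑ y : Λ, if G.Adj x y then M.pair (a x) (a y) else 0) +
      (∑ x : Λ, ∑ y : Λ, if G.Adj x y then M.pair (b x) (b y) else 0) := by
    simp only [← Finset.sum_add_distrib]
    refine Finset.sum_le_sum fun x _ => Finset.sum_le_sum fun y _ => ?_
    split_ifs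
    · have := mul_le_mul_of_nonneg_left (spin_mul_add_le (a x) (a y) (b x) (b y)) hJ
      simp only [hM, Pi.inf_apply, Pi.sup_apply]
      linarith
    · simp
  simp only [innerEnergy]
  linarith

open Classical in
/-- Raising the boundary fields of a ferromagnet raises the expectations of increasing functions. -/
theorem sum_mul_weight_div_le (hJ : 0 ≤ J)
    (hM : ∀ a b, M.pair a b = -(J * (spin a * spin b))) (Λ : Finset V) {u u' : Λ → Bool → ℝ}
    (hu : ∀ x, u x true - u x false ≤ u' x true - u' x false) {f : (Λ → Bool) → ℝ} (hf : 0 ≤ f)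
    (hmono : Monotone f) :
    ∑ ζ, f ζ * (Real.exp (-innerEnergy G M Λ ζ + ∑ x, u x (ζ x)) /
        ∑ ξ, Real.exp (-innerEnergy G M Λ ξ + ∑ x, u x (ξ x))) ≤
      ∑ ζ, f ζ * (Real.exp (-innerEnergy G M Λ ζ + ∑ x, u' x (ζ x)) /
        ∑ ξ, Real.exp (-innerEnergy G M Λ ξ + ∑ x, u' x (ξ x))) := by
  have hpos : ∀ v : Λ → Bool → ℝ,
      0 < ∑ ξ, Real.exp (-innerEnergy G M Λ ξ + ∑ x, v x (ξ x)) := fun v =>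
    Finset.sum_pos (fun _ _ => Real.exp_pos _) Finset.univ_nonempty
  refine holley _ _ f hf (fun ζ => (div_pos (Real.exp_pos _) (hpos u)).le)
    (fun ζ => (div_pos (Real.exp_pos _) (hpos u')).le) hmono ?_ fun a b => ?_
  · rw [← Finset.sum_div, ← Finset.sum_div, div_self (hpos u).ne', div_self (hpos u').ne']
  · rw [div_mul_div_comm, div_mul_div_comm]
    refine div_le_div_of_nonneg_right ?_ (mul_pos (hpos u) (hpos u')).le
    rw [← Real.exp_add, ← Real.exp_add, Real.exp_le_exp]
    have h1 := innerEnergy_inf_add_sup_le (G := G) hJ hM Λ a b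
    have h2 : ∑ x, u x (a x) + ∑ x, u' x (b x) ≤
        ∑ x, u x ((a ⊓ b) x) + ∑ x, u' x ((a ⊔ b) x) := by
      rw [← Finset.sum_add_distrib, ← Finset.sum_add_distrib]
      exact Finset.sum_le_sum fun x _ => add_le_apply_inf_add_apply_sup (hu x) _ _
    linarith

variable [G.LocallyFinite]

theorem abs_sum_spin_le (s : Finset V) (η : V → Bool) : |∑ y ∈ s, spin (η y)| ≤ s.card := by
  refine (Finset.abs_sum_le_sum_abs _ _).trans ?_
  rw [Finset.card_eq_sum_ones, Nat.cast_sum]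
  refine Finset.sum_le_sum fun y _ => ?_
  cases η y <;> simp [spin]

/-- A constant boundary vector for two spin values, normalised to vanish at `false`. -/
def boolField (d : ℝ) (b : Bool) : ℝ := if b then d else 0

variable (G M x₀) in
open Classical in
/-- The probability that all spins in `A` are `+`, in the finite-volume splitting measure with
boundary vector `boolField d`. -/
noncomputable def upProb (A : Finset V) (n : ℕ) (d : ℝ) : ℝ :=
  ∑ ζ : ball G x₀ n → Bool, (cyl A fun _ => true).indicator
    (splitProb G M x₀ (fun _ => boolField d) n) (glue _ ζ fun _ => true)

theorem continuous_upProb (A : Finset V) (n : ℕ) : Continuous (upProb G M x₀ A n) := by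
  classical
  have h1 : ∀ ζ, Continuous fun d => splittingWeight G M x₀ (fun _ => boolField d) n ζ := by
    intro ζ
    simp only [splittingWeight]
    refine Real.continuous_exp.comp (continuous_const.add (continuous_finsetSum _ fun x _ => ?_))
    by_cases h : G.dist x₀ x = n
    · simp only [h, if_true, boolField]
      cases ζ x
      · simp only [Bool.false_eq_true, if_false]
        exact continuous_const
      · simp only [if_true]
        exact continuous_id
    · simp only [h, if_false]
      exact continuous_const
  refine continuous_finsetSum _ fun ζ _ => ?_
  simp only [Set.indicator_apply]
  split_ifs
  · exact (h1 _).div (continuous_finsetSum _ fun ξ _ => h1 ξ) fun d => (partitionFn_pos _ _).ne'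
  · exact continuous_const

/-- Summing out the last sphere does not touch the event, which lives in the smaller ball, and only
the difference of the new boundary vector survives normalisation. -/
theorem upProb_succ (hM : ∀ a b, M.pair a b = M.pair b a) (hT : G.IsTree) {k : ℕ}
    (hreg : G.IsRegularOfDegree (k + 1)) {A : Finset V} {n : ℕ} (hn : n ≠ 0)
    (hA : A ⊆ ball G x₀ n) (d : ℝ) :
    upProb G M x₀ A (n + 1) d = upProb G M x₀ A n
      (stepField M k (boolField d) true - stepField M k (boolField d) false) := by
  classical
  rw [upProb, sum_glue_split (Λ' := ball G x₀ (n + 1)) (ball_mono hT x₀ (Nat.le_succ n))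
    ((cyl A fun _ => true).indicator (splitProb G M x₀ (fun _ => boolField d) (n + 1)))]
  refine Finset.sum_congr rfl fun ζ _ => ?_
  set ω := glue (ball G x₀ n) ζ fun _ => true with hω
  have hmem : ∀ τ, glue (ball G x₀ (n + 1) \ ball G x₀ n) τ ω ∈ cyl A (fun _ => true) ↔
      ω ∈ cyl A fun _ => true := by
    intro τ
    refine forall₂_congr fun x hx => ?_
    rw [glue_of_notMem _ _ (by simp [hA hx])]
  by_cases h : ω ∈ cyl A fun _ => true
  · rw [Set.indicator_of_mem h, Finset.sum_congr rfl fun τ _ =>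
      Set.indicator_of_mem ((hmem τ).mpr h) _, sum_splitProb_succ hM hT hreg _ hn]
    refine splitProb_add_const (c := fun _ => stepField M k (boolField d) false) ?_ n ω
    intro _ a
    cases a <;> simp [boolField]
  · rw [Set.indicator_of_notMem h]
    exact Finset.sum_eq_zero fun τ _ => Set.indicator_of_notMem (fun h' => h ((hmem τ).mp h')) _

theorem IsSplittingGibbs.cyl_true {d : ℝ} {μ : Measure (V → Bool)}
    (hμ : IsSplittingGibbs G M x₀ (fun _ => boolField d) μ) {A : Finset V} {n : ℕ} (hn : 1 ≤ n)
    (hA : A ⊆ ball G x₀ n) :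
    μ (cyl A fun _ => true) = ENNReal.ofReal (upProb G M x₀ A n d) := by
  classical
  rw [isSplittingGibbs_iff] at hμ
  rw [measure_eq_sum_cyl μ (Λ := ball G x₀ n)
    (S := cyl A fun _ => true)
    (fun σ σ' h hσ x hx => by rw [← h x (hA hx)]; exact hσ x hx) fun _ => true, upProb,
    ENNReal.ofReal_sum_of_nonneg
      fun _ _ => Set.indicator_nonneg (fun _ _ => (splitProb_pos _ _ _).le) _]
  refine Finset.sum_congr rfl fun ζ _ => ?_
  simp only [Set.indicator_apply]
  split_ifs
  · exact hμ.2 n hn _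
  · rw [ENNReal.ofReal_zero]

variable (G) in
open Classical in
/-- The boundary field that the configuration `η` outside `Λ` exerts on the site `x`. -/
noncomputable def outerField (J : ℝ) (Λ : Finset V) (η : V → Bool) (x : V) (b : Bool) : ℝ :=
  ∑ y ∈ G.neighborFinset x \ Λ, J * (spin b * spin (η y))

theorem neg_energy_eq (hM : ∀ a b, M.pair a b = -(J * (spin a * spin b))) (Λ : Finset V)
    (η : V → Bool) (ζ : Λ → Bool) :
    -energy G M Λ η ζ = -innerEnergy G M Λ ζ + ∑ x : Λ, outerField G J Λ η x (ζ x) := by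
  simp only [energy, outerField, hM, Finset.sum_neg_distrib]
  ring

/-- At most k + 1 outer neighbours contribute, each ±2J. A boundary field of size 2(k + 1)J thus
beats every boundary condition. -/
theorem abs_outerField_sub_le (hJ : 0 ≤ J) {k : ℕ} (hreg : G.IsRegularOfDegree (k + 1))
    (Λ : Finset V) (η : V → Bool) (x : V) :
    |outerField G J Λ η x true - outerField G J Λ η x false| ≤ 2 * (k + 1) * J := by
  classical
  have h1 : outerField G J Λ η x true - outerField G J Λ η x false =
      2 * J * ∑ y ∈ G.neighborFinset x \ Λ, spin (η y) := by
    rw [outerField, outerField, ← Finset.sum_sub_distrib, Finset.mul_sum]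
    refine Finset.sum_congr rfl fun y _ => ?_
    simp only [spin, Bool.false_eq_true, if_true, if_false]
    ring
  have h2 : ((G.neighborFinset x \ Λ).card : ℝ) ≤ k + 1 := by
    have h3 : (G.neighborFinset x).card = k + 1 := hreg x
    exact_mod_cast (Finset.card_le_card Finset.sdiff_subset).trans h3.le
  rw [h1, abs_mul, abs_of_nonneg (by positivity)]
  have := (abs_sum_spin_le (G.neighborFinset x \ Λ) η).trans h2
  nlinarith

open Classical in
theorem outerField_eq_zero (hT : G.IsTree) {n : ℕ} {x : V} (hx : G.dist x₀ x < n)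
    (η : V → Bool) (b : Bool) : outerField G J (ball G x₀ n) η x b = 0 := by
  refine Finset.sum_eq_zero fun y hy => ?_
  rw [Finset.mem_sdiff, SimpleGraph.mem_neighborFinset, mem_ball_iff G hT.connected] at hy
  rcases hT.dist_eq_dist_add_one_of_adj x₀ hy.1 with h | h <;> omega

open Classical in
/-- The probability that all spins in `A` are `+`, in the finite-volume Gibbs distribution. -/
theorem gibbsKernel_cyl_true (hM : ∀ a b, M.pair a b = -(J * (spin a * spin b)))
    {A Λ : Finset V} (hA : A ⊆ Λ) (η : V → Bool) :
    gibbsKernel G M Λ η (cyl A fun _ => true) =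
      ENNReal.ofReal (∑ ζ : Λ → Bool,
        (cyl A fun _ => true).indicator (fun _ => (1 : ℝ)) (glue Λ ζ fun _ => true) *
        (Real.exp (-innerEnergy G M Λ ζ + ∑ x : Λ, outerField G J Λ η x (ζ x)) /
        ∑ ξ : Λ → Bool,
          Real.exp (-innerEnergy G M Λ ξ + ∑ x : Λ, outerField G J Λ η x (ξ x)))) := by
  simp only [← neg_energy_eq hM]
  rw [gibbsKernel_apply Λ η (measurableSet_cyl _ _), ENNReal.ofReal_sum_of_nonneg]
  · refine Finset.sum_congr rfl fun ζ _ => ?_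
    have hmem : glue Λ ζ η ∈ cyl A (fun _ => true) ↔
        (glue Λ ζ fun _ => true) ∈ cyl A fun _ => true := by
      refine forall₂_congr fun x hx => ?_
      rw [glue_of_mem _ _ (hA hx), glue_of_mem _ _ (hA hx)]
    simp only [Set.indicator_apply, hmem]
    split_ifs
    · rw [Pi.one_apply, mul_one, one_mul]
      rfl
    · rw [mul_zero, zero_mul, ENNReal.ofReal_zero]
  · intro ζ _
    exact mul_nonneg (Set.indicator_nonneg (fun _ _ => zero_le_one) _)
      (gibbsProb_nonneg Λ η ζ)

/-- The boundary vector `boolField d` on the sphere of radius `n`. -/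
noncomputable def sphereField (G : SimpleGraph V) (x₀ : V) (n : ℕ) (d : ℝ) (x : V) (b : Bool) : ℝ :=
  if G.dist x₀ x = n then boolField d b else 0

open Classical in
theorem upProb_eq (A : Finset V) (n : ℕ) (d : ℝ) :
    upProb G M x₀ A n d = ∑ ζ : ball G x₀ n → Bool,
      (cyl A fun _ => true).indicator (fun _ => (1 : ℝ)) (glue _ ζ fun _ => true) *
      (Real.exp (-innerEnergy G M (ball G x₀ n) ζ + ∑ x : ball G x₀ n,
          sphereField G x₀ n d x (ζ x)) /
        ∑ ξ : ball G x₀ n → Bool, Real.exp (-innerEnergy G M (ball G x₀ n) ξ +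
          ∑ x : ball G x₀ n,
          sphereField G x₀ n d x (ξ x))) := by
  refine Finset.sum_congr rfl fun ζ _ => ?_
  simp only [Set.indicator_apply]
  split_ifs
  · rw [one_mul, splitProb, restrict_glue]
    rfl
  · rw [zero_mul]

theorem monotone_indicator_cyl_true (A Λ : Finset V) :
    Monotone fun ζ : Λ → Bool =>
      (cyl A fun _ => true).indicator (fun _ => (1 : ℝ)) (glue Λ ζ fun _ => true) := by
  intro ζ ζ' h
  by_cases hζ : glue Λ ζ (fun _ => true) ∈ cyl A fun _ => true
  · have hζ' : glue Λ ζ' (fun _ => true) ∈ cyl A fun _ => true := by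
      intro x hx
      have h1 := hζ x hx
      by_cases hxΛ : x ∈ Λ
      · rw [glue_of_mem _ _ hxΛ] at h1 ⊢
        have h2 := h ⟨x, hxΛ⟩
        rw [h1] at h2
        exact top_le_iff.mp h2
      · rw [glue_of_notMem _ _ hxΛ]
    simp only [Set.indicator_of_mem hζ, Set.indicator_of_mem hζ', le_refl]
  · simp only [Set.indicator_of_notMem hζ]
    exact Set.indicator_nonneg (fun _ _ => zero_le_one) _

/-- The outside configuration acts only on the boundary sphere, where `d` is at least as strong;
monotonicity in the boundary field does the rest. -/
theorem gibbsKernel_cyl_true_le (hJ : 0 ≤ J) (hM : ∀ a b, M.pair a b = -(J * (spin a * spin b)))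
    (hT : G.IsTree) {k : ℕ} (hreg : G.IsRegularOfDegree (k + 1)) {A : Finset V} {n : ℕ}
    (hA : A ⊆ ball G x₀ n) {d : ℝ} (hd : 2 * (k + 1) * J ≤ d) (η : V → Bool) :
    gibbsKernel G M (ball G x₀ n) η (cyl A fun _ => true) ≤
      ENNReal.ofReal (upProb G M x₀ A n d) := by
  classical
  rw [gibbsKernel_cyl_true hM hA, upProb_eq]
  refine ENNReal.ofReal_le_ofReal ?_
  convert sum_mul_weight_div_le (G := G) hJ hM (ball G x₀ n) (f := fun ζ =>
    (cyl A fun _ => true).indicator (fun _ => (1 : ℝ)) (glue _ ζ fun _ => true))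
    (u := fun x b => outerField G J (ball G x₀ n) η x b)
    (u' := fun x b => sphereField G x₀ n d x b) (fun x => ?_)
    (fun ζ => Set.indicator_nonneg (fun _ _ => zero_le_one) _) (monotone_indicator_cyl_true A _)
  by_cases h : G.dist x₀ x = n
  · have := (abs_le.mp (abs_outerField_sub_le hJ hreg (ball G x₀ n) η x)).2
    simp only [sphereField, h, boolField, if_true, Bool.false_eq_true, if_false]
    linarith
  · have hx := (mem_ball_iff G hT.connected x₀ x n).mp x.2
    simp only [outerField_eq_zero hT (lt_of_le_of_ne hx h), sphereField, h, if_false, le_refl]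

theorem le_gibbsKernel_cyl_true (hJ : 0 ≤ J) (hM : ∀ a b, M.pair a b = -(J * (spin a * spin b)))
    (hT : G.IsTree) {k : ℕ} (hreg : G.IsRegularOfDegree (k + 1)) {A : Finset V} {n : ℕ}
    (hA : A ⊆ ball G x₀ n) {d : ℝ} (hd : d ≤ -(2 * (k + 1) * J)) (η : V → Bool) :
    ENNReal.ofReal (upProb G M x₀ A n d) ≤
      gibbsKernel G M (ball G x₀ n) η (cyl A fun _ => true) := by
  classical
  rw [gibbsKernel_cyl_true hM hA, upProb_eq]
  refine ENNReal.ofReal_le_ofReal ?_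
  convert sum_mul_weight_div_le (G := G) hJ hM (ball G x₀ n) (f := fun ζ =>
    (cyl A fun _ => true).indicator (fun _ => (1 : ℝ)) (glue _ ζ fun _ => true))
    (u := fun x b => sphereField G x₀ n d x b)
    (u' := fun x b => outerField G J (ball G x₀ n) η x b) (fun x => ?_)
    (fun ζ => Set.indicator_nonneg (fun _ _ => zero_le_one) _) (monotone_indicator_cyl_true A _)
  by_cases h : G.dist x₀ x = n
  · have := (abs_le.mp (abs_outerField_sub_le hJ hreg (ball G x₀ n) η x)).1
    simp only [sphereField, h, boolField, if_true, Bool.false_eq_true, if_false]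
    linarith
  · have hx := (mem_ball_iff G hT.connected x₀ x n).mp x.2
    simp only [outerField_eq_zero hT (lt_of_le_of_ne hx h), sphereField, h, if_false, le_refl]

/-- Moving the boundary inwards by `j` spheres amounts to applying the recursion `j` times. -/
theorem upProb_add (hM : ∀ a b, M.pair a b = M.pair b a) (hT : G.IsTree) {k : ℕ}
    (hreg : G.IsRegularOfDegree (k + 1)) {A : Finset V} {N : ℕ} (hN : N ≠ 0)
    (hA : A ⊆ ball G x₀ N) {d : ℕ → ℝ}
    (hd : ∀ j, stepField M k (boolField (d j)) true - stepField M k (boolField (d j)) false =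
      d (j + 1)) (j i : ℕ) :
    upProb G M x₀ A (N + j) (d i) = upProb G M x₀ A N (d (i + j)) := by
  induction j generalizing i with
  | zero => rfl
  | succ j ih =>
    rw [← add_assoc, upProb_succ hM hT hreg (by omega)
      (hA.trans (ball_mono hT x₀ (Nat.le_add_right N j))), hd, ih]
    congr 2
    ring

-- By the DLR equation in a ball of radius m + 1 + j, ν is bounded by the strong field `d 0` at that
-- distance, that is, by the field `d j` at the fixed radius m + 1. Letting j tend to infinity
-- replaces it by `e`.
open Filter Topology in
theorem IsSplittingGibbs.le_cyl_true (hJ : 0 ≤ J)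
    (hM : ∀ a b, M.pair a b = -(J * (spin a * spin b))) (hT : G.IsTree) {k : ℕ}
    (hreg : G.IsRegularOfDegree (k + 1)) {d : ℕ → ℝ} {e : ℝ}
    (hd : ∀ j, CayleyGibbs.stepField M k (boolField (d j)) true -
      CayleyGibbs.stepField M k (boolField (d j)) false = d (j + 1))
    (hd0 : 2 * (k + 1) * J ≤ d 0) (hde : Tendsto d atTop (𝓝 e))
    {μ : Measure (V → Bool)} (hμ : IsSplittingGibbs G M x₀ (fun _ => boolField e) μ)
    {ν : Measure (V → Bool)} (hν : ν ∈ gibbsMeasures G M) (A : Finset V) :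
    ν (cyl A fun _ => true) ≤ μ (cyl A fun _ => true) := by
  have hM' : ∀ a b, M.pair a b = M.pair b a := fun a b => by rw [hM, hM, mul_comm (spin a)]
  obtain ⟨m, hm⟩ := exists_subset_ball hT x₀ A
  have hA : A ⊆ ball G x₀ (m + 1) := hm.trans (ball_mono hT x₀ (Nat.le_succ m))
  have := hν.1
  rw [hμ.cyl_true (Nat.le_add_left 1 m) hA]
  have hlim : Tendsto (fun j => ENNReal.ofReal (upProb G M x₀ A (m + 1) (d j))) atTop
      (𝓝 (ENNReal.ofReal (upProb G M x₀ A (m + 1) e))) :=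
    (ENNReal.continuous_ofReal.tendsto _).comp
      (((continuous_upProb A (m + 1)).tendsto e).comp hde)
  refine ge_of_tendsto' hlim fun j => ?_
  have hj := upProb_add hM' hT hreg (Nat.succ_ne_zero m) hA hd j 0
  rw [zero_add] at hj
  rw [← hj, ← hν.2 (ball G x₀ (m + 1 + j)) _ (measurableSet_cyl _ _)]
  refine (lintegral_mono fun η => gibbsKernel_cyl_true_le hJ hM hT hreg
    (hA.trans (ball_mono hT x₀ (Nat.le_add_right _ j))) hd0 η).trans ?_
  rw [lintegral_const, measure_univ, mul_one]

open Filter Topology in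
theorem IsSplittingGibbs.cyl_true_le (hJ : 0 ≤ J)
    (hM : ∀ a b, M.pair a b = -(J * (spin a * spin b))) (hT : G.IsTree) {k : ℕ}
    (hreg : G.IsRegularOfDegree (k + 1)) {d : ℕ → ℝ} {e : ℝ}
    (hd : ∀ j, CayleyGibbs.stepField M k (boolField (d j)) true -
      CayleyGibbs.stepField M k (boolField (d j)) false = d (j + 1))
    (hd0 : d 0 ≤ -(2 * (k + 1) * J)) (hde : Tendsto d atTop (𝓝 e))
    {μ : Measure (V → Bool)} (hμ : IsSplittingGibbs G M x₀ (fun _ => boolField e) μ)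
    {ν : Measure (V → Bool)} (hν : ν ∈ gibbsMeasures G M) (A : Finset V) :
    μ (cyl A fun _ => true) ≤ ν (cyl A fun _ => true) := by
  have hM' : ∀ a b, M.pair a b = M.pair b a := fun a b => by rw [hM, hM, mul_comm (spin a)]
  obtain ⟨m, hm⟩ := exists_subset_ball hT x₀ A
  have hA : A ⊆ ball G x₀ (m + 1) := hm.trans (ball_mono hT x₀ (Nat.le_succ m))
  have := hν.1
  rw [hμ.cyl_true (Nat.le_add_left 1 m) hA]
  have hlim : Tendsto (fun j => ENNReal.ofReal (upProb G M x₀ A (m + 1) (d j))) atTop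
      (𝓝 (ENNReal.ofReal (upProb G M x₀ A (m + 1) e))) :=
    (ENNReal.continuous_ofReal.tendsto _).comp
      (((continuous_upProb A (m + 1)).tendsto e).comp hde)
  refine le_of_tendsto' hlim fun j => ?_
  have hj := upProb_add hM' hT hreg (Nat.succ_ne_zero m) hA hd j 0
  rw [zero_add] at hj
  rw [← hj, ← hν.2 (ball G x₀ (m + 1 + j)) _ (measurableSet_cyl _ _)]
  refine le_trans ?_ (lintegral_mono fun η => le_gibbsKernel_cyl_true hJ hM hT hreg
    (hA.trans (ball_mono hT x₀ (Nat.le_add_right _ j))) hd0 η)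
  rw [lintegral_const, measure_univ, mul_one]

end Ferromagnet

/-! ### Extremality from maximal or minimal + probabilities -/

section Extreme

variable {V : Type*}

/-- Intersections of these events correspond to unions of the sets `A`, so they form a π-system, and
a two-valued σ-algebra is generated by the events of a spin being +. -/
theorem ext_of_cyl_true {μ ν : Measure (V → Bool)} [IsFiniteMeasure μ] [IsFiniteMeasure ν]
    (h : ∀ A : Finset V, μ (cyl A fun _ => true) = ν (cyl A fun _ => true)) : μ = ν := by
  classical
  have huniv : (Set.univ : Set (V → Bool)) = cyl ∅ fun _ => true := by
    ext η
    simp [cyl]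
  let C : Set (Set (V → Bool)) := Set.range fun A : Finset V => cyl A fun _ => true
  refine ext_of_generate_finite C ?_ ?_ ?_ (by rw [huniv, h])
  · refine le_antisymm (iSup_le fun x => ?_) (MeasurableSpace.generateFrom_le ?_)
    · rw [← measurable_iff_comap_le]
      refine @measurable_to_bool _ (MeasurableSpace.generateFrom C) _ ?_
      have : (fun η : V → Bool => η x) ⁻¹' {true} = cyl {x} fun _ => true := by
        ext η
        simp [cyl]
      rw [this]
      exact MeasurableSpace.measurableSet_generateFrom ⟨{x}, rfl⟩
    · rintro _ ⟨A, rfl⟩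
      exact measurableSet_cyl _ _
  · rintro _ ⟨A, rfl⟩ _ ⟨B, rfl⟩ -
    refine ⟨A ∪ B, ?_⟩
    ext η
    simp only [cyl, Finset.mem_union, Set.mem_ofPred_eq, Set.mem_inter_iff, or_imp, forall_and]
  · rintro _ ⟨A, rfl⟩
    exact h A

/-- If a weighted mean with positive weights equals a common bound of its terms, every term equals
the bound. Applied to each `A`, this gives equality of the measures. -/
theorem mem_extremePoints_of_cyl_true {S : Set (Measure (V → Bool))} {μ : Measure (V → Bool)}
    (hS : ∀ ν ∈ S, IsProbabilityMeasure ν) (hμ : μ ∈ S)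
    (h : (∀ ν ∈ S, ∀ A : Finset V, ν (cyl A fun _ => true) ≤ μ (cyl A fun _ => true)) ∨
      ∀ ν ∈ S, ∀ A : Finset V, μ (cyl A fun _ => true) ≤ ν (cyl A fun _ => true)) :
    μ ∈ Set.extremePoints NNReal S := by
  refine ⟨hμ, ?_⟩
  rintro ν₁ h₁ ν₂ h₂ ⟨a, b, ha, hb, hab, hμab⟩
  have := hS μ hμ
  have := hS ν₁ h₁
  have := hS ν₂ h₂
  refine ext_of_cyl_true fun A => ?_
  have e1 := congrArg (fun ν : Measure (V → Bool) => (ν (cyl A fun _ => true)).toReal) hμab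
  simp only [Measure.add_apply, Measure.smul_apply, ENNReal.smul_def, smul_eq_mul] at e1
  rw [ENNReal.toReal_add (by finiteness) (by finiteness), ENNReal.toReal_mul,
    ENNReal.toReal_mul, ENNReal.coe_toReal, ENNReal.coe_toReal] at e1
  have ha' : (0 : ℝ) < a := ha
  have hb' : (0 : ℝ) < b := hb
  have hab' : (a : ℝ) + b = 1 := by exact_mod_cast congrArg NNReal.toReal hab
  rw [← ENNReal.toReal_eq_toReal_iff' (measure_ne_top _ _) (measure_ne_top _ _)]
  have hba : (b : ℝ) = 1 - a := by linarith
  set p := (μ (cyl A fun _ => true)).toReal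
  have hbp : (b : ℝ) * p = p - a * p := by
    rw [hba]
    ring
  rcases h with h | h
  · have l1 := ENNReal.toReal_mono (measure_ne_top _ _) (h ν₁ h₁ A)
    have l2 := mul_le_mul_of_nonneg_left
      (ENNReal.toReal_mono (measure_ne_top _ _) (h ν₂ h₂ A)) hb'.le
    exact le_antisymm l1 (le_of_mul_le_mul_left (by linarith) ha')
  · have l1 := ENNReal.toReal_mono (measure_ne_top _ _) (h ν₁ h₁ A)
    have l2 := mul_le_mul_of_nonneg_left
      (ENNReal.toReal_mono (measure_ne_top _ _) (h ν₂ h₂ A)) hb'.le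
    exact le_antisymm (le_of_mul_le_mul_left (by linarith) ha') l1

end Extreme

end CayleyGibbs

namespace CayleyGibbs

open Filter Topology Set

/-! ### Counting the fixed points of f_m -/

section FixedPoints

/-- The sum `x + x² + ⋯ + x^{k-1}`. -/
noncomputable def geomSum (k : ℕ) (x : ℝ) : ℝ := ∑ i ∈ Finset.Icc 1 (k - 1), x ^ i

/-- The function whose level sets are the roots `x ≠ 1`, `x ^ k = z`, of `f_m(z) = z`. -/
noncomputable def levelFn (k : ℕ) (m r x : ℝ) : ℝ := 1 + (m * x ^ k + r) / geomSum k x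

/-- The derivative of `levelFn` up to a positive factor. -/
noncomputable def slopeFn (k : ℕ) (m r x : ℝ) : ℝ :=
  ∑ i ∈ Finset.Icc 1 (k - 1), (m * (k - i) * x ^ i - r * i * (x⁻¹) ^ (k - i))

variable {k : ℕ} {m r : ℝ}

theorem geomSum_pos (hk : 2 ≤ k) {x : ℝ} (hx : 0 < x) : 0 < geomSum k x :=
  Finset.sum_pos (fun i _ => pow_pos hx i) ⟨1, by simp; omega⟩

theorem geomSum_le (hk : 2 ≤ k) {x y : ℝ} (h : ∀ i ∈ Finset.Icc 1 (k - 1), x ^ i ≤ y)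
    (hy : 0 ≤ y) : geomSum k x ≤ k * y := by
  refine (Finset.sum_le_card_nsmul _ _ _ h).trans ?_
  rw [nsmul_eq_mul]
  refine mul_le_mul_of_nonneg_right ?_ hy
  rw [Nat.card_Icc]
  exact_mod_cast (by omega : k - 1 + 1 - 1 ≤ k)

theorem sub_one_mul_geomSum (hk : 2 ≤ k) (x : ℝ) : (x - 1) * geomSum k x = x ^ k - x := by
  obtain ⟨j, rfl⟩ : ∃ j, k = j + 2 := ⟨k - 2, by omega⟩
  have : ∀ n : ℕ, (x - 1) * ∑ i ∈ Finset.Icc 1 n, x ^ i = x ^ (n + 1) - x := by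
    intro n
    induction n with
    | zero => simp
    | succ n ih =>
      rw [Finset.sum_Icc_succ_top (by omega), mul_add, ih]
      ring
  exact this (j + 1)

/-- The factor x^k is taken out of the numerator of the quotient rule so that the remaining
`slopeFn` is increasing term by term. -/
theorem hasDerivAt_levelFn (hk : 2 ≤ k) {x : ℝ} (hx : 0 < x) :
    HasDerivAt (levelFn k m r) (x ^ k * slopeFn k m r x / x / geomSum k x ^ 2) x := by
  have hS : HasDerivAt (geomSum k) (∑ i ∈ Finset.Icc 1 (k - 1), (i : ℝ) * x ^ (i - 1)) x := by
    have := HasDerivAt.fun_sum (u := Finset.Icc 1 (k - 1)) (A := fun i (x : ℝ) => x ^ i)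
      (A' := fun i => (i : ℝ) * x ^ (i - 1)) (x := x) fun i _ => hasDerivAt_pow i x
    exact this
  have hN : HasDerivAt (fun x : ℝ => m * x ^ k + r) (m * (k * x ^ (k - 1))) x :=
    ((hasDerivAt_pow k x).const_mul m).add_const r
  have hS0 := (geomSum_pos hk hx).ne'
  have := (hN.div hS hS0).const_add 1
  refine this.congr_deriv ?_
  congr 1
  rw [eq_div_iff hx.ne']
  have h1 : (∑ i ∈ Finset.Icc 1 (k - 1), (i : ℝ) * x ^ (i - 1)) * x =
      ∑ i ∈ Finset.Icc 1 (k - 1), (i : ℝ) * x ^ i := by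
    rw [Finset.sum_mul]
    refine Finset.sum_congr rfl fun i hi => ?_
    rw [mul_assoc, ← pow_succ, Nat.sub_add_cancel (Finset.mem_Icc.mp hi).1]
  have h2 : x ^ (k - 1) * x = x ^ k := by
    rw [← pow_succ, Nat.sub_add_cancel (by omega)]
  have h3 : x ^ k * slopeFn k m r x = m * k * x ^ k * geomSum k x -
      (m * x ^ k + r) * ∑ i ∈ Finset.Icc 1 (k - 1), (i : ℝ) * x ^ i := by
    rw [slopeFn, geomSum, Finset.mul_sum, Finset.mul_sum, Finset.mul_sum,
      ← Finset.sum_sub_distrib]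
    refine Finset.sum_congr rfl fun i hi => ?_
    have hik : i ≤ k := by
      have := (Finset.mem_Icc.mp hi).2
      omega
    have h4 : x ^ k * (x⁻¹) ^ (k - i) = x ^ i := by
      rw [← Nat.sub_add_cancel hik, pow_add, Nat.add_sub_cancel, mul_right_comm, ← mul_pow,
        mul_inv_cancel₀ hx.ne', one_pow, one_mul]
    linear_combination (-(r * i)) * h4
  rw [h3]
  linear_combination (m * k * geomSum k x) * h2 - (m * x ^ k + r) * h1

theorem slopeFn_strictMonoOn (hk : 2 ≤ k) (hm : 0 < m) (hr : 0 < r) :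
    StrictMonoOn (slopeFn k m r) (Ioi 0) := by
  intro x hx y hy hxy
  have hx : 0 < x := hx
  have hy : 0 < y := hy
  refine Finset.sum_lt_sum_of_nonempty ⟨1, by simp; omega⟩ fun i hi => ?_
  rw [Finset.mem_Icc] at hi
  have hi0 : (0 : ℝ) < i := by exact_mod_cast hi.1
  have hki : (0 : ℝ) < (k : ℝ) - i := by
    have : (i : ℝ) < k := by exact_mod_cast (by omega : i < k)
    linarith
  have h1 : m * (k - i) * x ^ i < m * (k - i) * y ^ i :=
    mul_lt_mul_of_pos_left (pow_lt_pow_left₀ hxy hx.le (by omega)) (mul_pos hm hki)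
  have h2 : r * i * (y⁻¹) ^ (k - i) ≤ r * i * (x⁻¹) ^ (k - i) :=
    mul_le_mul_of_nonneg_left
      (pow_le_pow_left₀ (inv_pos.mpr hy).le (inv_anti₀ hx hxy.le) _) (mul_pos hr hi0).le
  linarith

theorem continuousOn_slopeFn : ContinuousOn (slopeFn k m r) (Ioi 0) := by
  refine continuousOn_finsetSum _ fun i _ => ?_
  refine (by fun_prop : ContinuousOn (fun x : ℝ => m * (k - i) * x ^ i) _).sub
    (continuousOn_const.mul (ContinuousOn.pow (ContinuousOn.inv₀ continuousOn_id ?_) _))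
  intro x hx
  exact (ne_of_gt hx)

theorem continuousOn_levelFn (hk : 2 ≤ k) : ContinuousOn (levelFn k m r) (Ioi 0) :=
  fun _ hx => (hasDerivAt_levelFn hk hx).continuousAt.continuousWithinAt

theorem exists_lt_levelFn_left (hk : 2 ≤ k) (hm : 0 < m) (hr : 0 < r) {a : ℝ} (ha : 0 < a)
    (t : ℝ) : ∃ x, 0 < x ∧ x < a ∧ t < levelFn k m r x := by
  have hk0 : (0 : ℝ) < k := by positivity
  set T := max t 1
  have hT : 0 < T := lt_of_lt_of_le one_pos (le_max_right _ _)
  -- For x ≤ 1 the denominator is at most k x and the numerator at least r, so the quotient is at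
  -- least r / (k x).
  refine ⟨min (a / 2) (min 1 (r / (k * T))), by positivity, ?_, ?_⟩
  · exact (min_le_left _ _).trans_lt (by linarith)
  · set x := min (a / 2) (min 1 (r / (k * T))) with hxdef
    have hx : 0 < x := by positivity
    have hx1 : x ≤ 1 := (min_le_right _ _).trans (min_le_left _ _)
    have hx2 : x ≤ r / (k * T) := (min_le_right _ _).trans (min_le_right _ _)
    have hS : geomSum k x ≤ k * x := geomSum_le hk (fun i hi =>
      pow_le_of_le_one hx.le hx1 (by have := (Finset.mem_Icc.mp hi).1; omega)) hx.le
    rw [le_div_iff₀ (by positivity)] at hx2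
    have h3 : T ≤ (m * x ^ k + r) / geomSum k x := by
      rw [le_div_iff₀ (geomSum_pos hk hx)]
      have h4 : T * geomSum k x ≤ T * (k * x) := mul_le_mul_of_nonneg_left hS hT.le
      have h5 : 0 < m * x ^ k := by positivity
      nlinarith
    have := le_max_left t 1
    rw [levelFn]
    linarith

theorem exists_lt_levelFn_right (hk : 2 ≤ k) (hm : 0 < m) (hr : 0 < r) (a t : ℝ) :
    ∃ x, a < x ∧ t < levelFn k m r x := by
  have hk0 : (0 : ℝ) < k := by positivity
  set T := max t 1
  have hT : 0 < T := lt_of_lt_of_le one_pos (le_max_right _ _)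
  set x := max (a + 1) (max 1 (k * T / m)) with hxdef
  have hx1 : 1 ≤ x := (le_max_left _ _).trans (le_max_right _ _)
  have hx : 0 < x := by linarith
  have hx2 : k * T / m ≤ x := (le_max_right _ _).trans (le_max_right _ _)
  refine ⟨x, by have := le_max_left (a + 1) (max 1 (k * T / m)); linarith, ?_⟩
  -- For x ≥ 1 the top power dominates the denominator, so the quotient is at least m x / k.
  have hS : geomSum k x ≤ k * x ^ (k - 1) := geomSum_le hk (fun i hi =>
    pow_le_pow_right₀ hx1 (Finset.mem_Icc.mp hi).2) (by positivity)
  rw [div_le_iff₀ hm] at hx2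
  have h3 : T ≤ (m * x ^ k + r) / geomSum k x := by
    rw [le_div_iff₀ (geomSum_pos hk hx)]
    have h4 : T * geomSum k x ≤ T * (k * x ^ (k - 1)) := mul_le_mul_of_nonneg_left hS hT.le
    have h5 : T * (k * x ^ (k - 1)) ≤ m * x ^ k := by
      have h6 : x ^ k = x * x ^ (k - 1) := by
        rw [← pow_succ', Nat.sub_add_cancel (by omega)]
      rw [h6]
      have := mul_le_mul_of_nonneg_right hx2 (by positivity : 0 ≤ x ^ (k - 1))
      linarith
    linarith
  have := le_max_left t 1
  rw [levelFn]
  linarith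

/-- `levelFn` is strictly decreasing up to some point and strictly increasing from there. -/
theorem exists_strictAntiOn_strictMonoOn (hk : 2 ≤ k) (hm : 0 < m) (hr : 0 < r) :
    ∃ a, 0 < a ∧ StrictAntiOn (levelFn k m r) (Ioc 0 a) ∧ StrictMonoOn (levelFn k m r) (Ici a) := by
  have hS := slopeFn_strictMonoOn hk hm hr
  have hderiv : ∀ x, 0 < x → (0 < slopeFn k m r x → 0 < deriv (levelFn k m r) x) ∧
      (slopeFn k m r x < 0 → deriv (levelFn k m r) x < 0) := by
    intro x hx
    rw [(hasDerivAt_levelFn hk hx).deriv]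
    have := geomSum_pos hk hx
    have hxk : 0 < x ^ k := by positivity
    exact ⟨fun h => by positivity, fun h => div_neg_of_neg_of_pos
      (div_neg_of_neg_of_pos (mul_neg_of_pos_of_neg hxk h) hx) (by positivity)⟩
  -- Without a sign change `levelFn` would be monotone, against its being unbounded near 0 (here)
  -- and at infinity (`hpos`).
  have hneg : ∃ x, 0 < x ∧ slopeFn k m r x < 0 := by
    by_contra! hcon
    have hanti : StrictMonoOn (levelFn k m r) (Ioc 0 1) := by
      refine strictMonoOn_of_deriv_pos (convex_Ioc 0 1)
        ((continuousOn_levelFn hk).mono fun x hx => hx.1) fun x hx => ?_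
      rw [interior_Ioc] at hx
      -- Nonnegativity at x / 2 gives strict positivity at x, by strict monotonicity.
      refine (hderiv x hx.1).1 ((hcon (x / 2) (by linarith [hx.1])).trans_lt ?_)
      exact hS (show (0 : ℝ) < x / 2 by linarith [hx.1]) hx.1 (by linarith [hx.1])
    obtain ⟨x, hx0, hx1, hx⟩ := exists_lt_levelFn_left hk hm hr one_pos (levelFn k m r 1)
    exact lt_asymm hx (hanti ⟨hx0, hx1.le⟩ ⟨one_pos, le_rfl⟩ hx1)
  have hpos : ∃ x, 0 < x ∧ 0 < slopeFn k m r x := by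
    by_contra! hcon
    have hanti : StrictAntiOn (levelFn k m r) (Ici 1) := by
      refine strictAntiOn_of_deriv_neg (convex_Ici 1)
        ((continuousOn_levelFn hk).mono (Ici_subset_Ioi.mpr one_pos)) fun x hx => ?_
      rw [interior_Ici] at hx
      have hx : 1 < x := hx
      refine (hderiv x (by linarith)).2 (lt_of_lt_of_le ?_ (hcon (x + 1) (by linarith)))
      exact hS (show (0 : ℝ) < x by linarith) (show (0 : ℝ) < x + 1 by linarith) (by linarith)
    obtain ⟨x, hx1, hx⟩ := exists_lt_levelFn_right hk hm hr 1 (levelFn k m r 1)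
    exact lt_asymm hx (hanti (le_refl (1 : ℝ)) hx1.le hx1)
  obtain ⟨x, hx, hxs⟩ := hneg
  obtain ⟨y, hy, hys⟩ := hpos
  have hxy : x < y := by
    by_contra! h
    exact absurd (hS.monotoneOn hy hx h) (by linarith)
  obtain ⟨a, ha, ha0⟩ := intermediate_value_Icc hxy.le
    (continuousOn_slopeFn.mono fun t ht => lt_of_lt_of_le hx ht.1) ⟨hxs.le, hys.le⟩
  have ha' : 0 < a := hx.trans_le ha.1
  refine ⟨a, ha', ?_, ?_⟩
  · refine strictAntiOn_of_deriv_neg (convex_Ioc 0 a)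
      ((continuousOn_levelFn hk).mono fun x hx => hx.1) fun t ht => ?_
    rw [interior_Ioc] at ht
    exact (hderiv t ht.1).2 (ha0 ▸ hS ht.1 ha' ht.2)
  · refine strictMonoOn_of_deriv_pos (convex_Ici a)
      ((continuousOn_levelFn hk).mono fun x hx => lt_of_lt_of_le ha' hx) fun t ht => ?_
    rw [interior_Ici] at ht
    exact (hderiv t (ha'.trans ht)).1 (ha0 ▸ hS ha' (ha'.trans ht) ht)

variable {q m : ℕ}

theorem thetaM_eq_iInf (k q m : ℕ) :
    thetaM k q m = ⨅ x : Ioi (0 : ℝ), levelFn k m ((q : ℝ) - m) x := rfl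

/-- This is the origin of θ_c: the parameter at which a root of the level equation coincides with
the trivial root. -/
theorem levelFn_one (hk : 2 ≤ k) : levelFn k m ((q : ℝ) - m) 1 = thetaC k q := by
  have hk1 : (0 : ℝ) < (k : ℝ) - 1 := by
    have : (2 : ℝ) ≤ k := by exact_mod_cast hk
    linarith
  have hS : geomSum k 1 = (k : ℝ) - 1 := by
    simp only [geomSum, one_pow, Finset.sum_const, Nat.card_Icc, nsmul_eq_mul, mul_one]
    rw [Nat.add_sub_cancel, Nat.cast_sub (by omega), Nat.cast_one]
  rw [levelFn, hS, thetaC]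
  field_simp
  ring

/-- The level sets of `levelFn`. -/
theorem levelFn_level_sets (hk : 2 ≤ k) (hm : 1 ≤ m) (hmq : m < q) (θ : ℝ) :
    (θ < thetaM k q m → {x : ℝ | 0 < x ∧ levelFn k m ((q : ℝ) - m) x = θ} = ∅) ∧
    (θ = thetaM k q m → ∃ a, {x : ℝ | 0 < x ∧ levelFn k m ((q : ℝ) - m) x = θ} = {a}) ∧
    (thetaM k q m < θ →
      ∃ a b, a < b ∧ {x : ℝ | 0 < x ∧ levelFn k m ((q : ℝ) - m) x = θ} = {a, b}) := by
  have hm' : (0 : ℝ) < m := by exact_mod_cast hm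
  have hr' : (0 : ℝ) < (q : ℝ) - m := by
    have : (m : ℝ) < q := by exact_mod_cast hmq
    linarith
  set g := levelFn k m ((q : ℝ) - m) with hg
  obtain ⟨a, ha, hanti, hmono⟩ := exists_strictAntiOn_strictMonoOn hk hm' hr'
  rw [← hg] at hanti hmono
  have hcont : ContinuousOn g (Ioi 0) := continuousOn_levelFn hk
  have hmin : ∀ x, 0 < x → g a ≤ g x := by
    intro x hx
    rcases le_total x a with h | h
    · exact hanti.antitoneOn ⟨hx, h⟩ ⟨ha, le_rfl⟩ h
    · exact hmono.monotoneOn (le_refl a) h h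
  have hmin' : ∀ x, 0 < x → x ≠ a → g a < g x := by
    intro x hx hne
    rcases lt_or_gt_of_ne hne with h | h
    · exact hanti ⟨hx, h.le⟩ ⟨ha, le_rfl⟩ h
    · exact hmono (le_refl a) h.le h
  have hθ : thetaM k q m = g a := by
    rw [thetaM_eq_iInf]
    have : Nonempty (Ioi (0 : ℝ)) := ⟨⟨a, ha⟩⟩
    exact le_antisymm
      (ciInf_le ⟨g a, by rintro _ ⟨x, rfl⟩; exact hmin x x.2⟩ (⟨a, ha⟩ : Ioi (0 : ℝ)))
      (le_ciInf fun x => hmin x x.2)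
  rw [hθ]
  refine ⟨fun h => ?_, fun h => ⟨a, ?_⟩, fun h => ?_⟩
  · refine eq_empty_of_forall_notMem fun x hx => ?_
    have := hmin x hx.1
    rw [hx.2] at this
    linarith
  · ext x
    constructor
    · intro hx
      by_contra hne
      have := hmin' x hx.1 hne
      rw [hx.2] at this
      linarith
    · rintro rfl
      exact ⟨ha, h.symm⟩
  · obtain ⟨l, hl0, hla, hl⟩ := exists_lt_levelFn_left hk hm' hr' ha θ
    obtain ⟨u, hau, hu⟩ := exists_lt_levelFn_right hk hm' hr' a θ
    obtain ⟨b, hb, hbθ⟩ := intermediate_value_Icc' hla.le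
      (hcont.mono fun t ht => lt_of_lt_of_le hl0 ht.1) ⟨h.le, hl.le⟩
    obtain ⟨c, hc, hcθ⟩ := intermediate_value_Icc hau.le
      (hcont.mono fun t ht => lt_of_lt_of_le ha ht.1) ⟨h.le, hu.le⟩
    have hb0 : 0 < b := hl0.trans_le hb.1
    have hba : b < a := lt_of_le_of_ne hb.2 (by rintro rfl; exact h.ne hbθ)
    have hac : a < c := lt_of_le_of_ne hc.1 (by rintro rfl; exact h.ne hcθ)
    refine ⟨b, c, hba.trans hac, ?_⟩
    ext x
    constructor
    · rintro ⟨hx, hxθ⟩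
      rcases le_total x a with h' | h'
      · exact Or.inl (hanti.injOn ⟨hx, h'⟩ ⟨hb0, hba.le⟩ (hxθ.trans hbθ.symm))
      · exact Or.inr (hmono.injOn h' hac.le (hxθ.trans hcθ.symm))
    · rintro (rfl | rfl)
      · exact ⟨hb0, hbθ⟩
      · exact ⟨ha.trans hac, hcθ⟩

variable {θ : ℝ}

/-- Taking k-th roots and clearing denominators leaves a polynomial that factors as (x -
1)(`levelFn` x - θ)`geomSum` x, because (x - 1)`geomSum` x = x^k - x. -/
theorem fm_pow_eq_iff (hk : 2 ≤ k) (hm : 1 ≤ m) (hmq : m < q) (hθ : 1 < θ) {x : ℝ} (hx : 0 < x) :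
    fm k q m θ (x ^ k) = x ^ k ↔ x = 1 ∨ levelFn k m ((q : ℝ) - m) x = θ := by
  have hm' : (0 : ℝ) < m := by exact_mod_cast hm
  have hr' : (0 : ℝ) < (q : ℝ) - m := by
    have : (m : ℝ) < q := by exact_mod_cast hmq
    linarith
  have hS := geomSum_pos hk hx
  have hxk : 0 < x ^ k := by positivity
  have hden : 0 < m * x ^ k + (q - m - 1 + θ) := by nlinarith [mul_pos hm' hxk]
  have hnum : 0 < (θ + m - 1) * x ^ k + (q - m) := by
    nlinarith [mul_pos (by linarith : 0 < θ + m - 1) hxk]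
  rw [fm, pow_left_inj₀ (div_pos hnum hden).le hx.le (by omega), div_eq_iff hden.ne', levelFn,
    ← sub_eq_zero (a := x), ← sub_eq_zero (b := θ), ← mul_eq_zero]
  have key : (x - 1) * (1 + (m * x ^ k + ((q : ℝ) - m)) / geomSum k x - θ) * geomSum k x =
      x * (m * x ^ k + (q - m - 1 + θ)) - ((θ + m - 1) * x ^ k + (q - m)) := by
    have h1 : (1 + (m * x ^ k + ((q : ℝ) - m)) / geomSum k x - θ) * geomSum k x =
        (1 - θ) * geomSum k x + (m * x ^ k + ((q : ℝ) - m)) := by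
      field_simp
      ring
    rw [mul_assoc, h1]
    linear_combination (1 - θ) * sub_one_mul_geomSum hk x
  constructor
  · intro h
    refine (mul_eq_zero.mp (key.trans ?_)).resolve_right hS.ne'
    linarith
  · intro h
    rw [h, zero_mul] at key
    linarith

theorem setOf_fm_eq (hk : 2 ≤ k) (hm : 1 ≤ m) (hmq : m < q) (hθ : 1 < θ) :
    {z : ℝ | 0 < z ∧ fm k q m θ z = z} =
      insert 1 ((fun x => x ^ k) '' {x : ℝ | 0 < x ∧ levelFn k m ((q : ℝ) - m) x = θ}) := by
  ext z
  constructor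
  · rintro ⟨hz, hfz⟩
    have hx : 0 < z ^ ((k : ℝ)⁻¹) := Real.rpow_pos_of_pos hz _
    have hxz : (z ^ ((k : ℝ)⁻¹)) ^ k = z := Real.rpow_inv_natCast_pow hz.le (by omega)
    rw [← hxz] at hfz
    rcases (fm_pow_eq_iff hk hm hmq hθ hx).mp hfz with h | h
    · left
      rw [← hxz, h, one_pow]
    · exact Or.inr ⟨_, ⟨hx, h⟩, hxz⟩
  · rintro (rfl | ⟨x, ⟨hx, h⟩, rfl⟩)
    · refine ⟨one_pos, ?_⟩
      have := (fm_pow_eq_iff hk hm hmq hθ one_pos).mpr (Or.inl rfl)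
      rwa [one_pow] at this
    · exact ⟨pow_pos hx k, (fm_pow_eq_iff hk hm hmq hθ hx).mpr (Or.inr h)⟩

/-- The number of positive solutions of `f_m(z) = z`. -/
theorem fm_solutions (hk : 2 ≤ k) (hm : 1 ≤ m) (hmq : m < q) (hθ : 1 < θ) :
    (θ < thetaM k q m → {z : ℝ | 0 < z ∧ fm k q m θ z = z} = {1}) ∧
    (thetaM k q m ≠ thetaC k q → (θ = thetaM k q m ∨ θ = thetaC k q) →
      ∃ z₁ : ℝ, z₁ ≠ 1 ∧ {z : ℝ | 0 < z ∧ fm k q m θ z = z} = {1, z₁}) ∧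
    (thetaM k q m < θ → θ ≠ thetaC k q →
      ∃ z₁ z₂ : ℝ, z₁ ≠ 1 ∧ z₂ ≠ 1 ∧ z₁ < z₂ ∧
        {z : ℝ | 0 < z ∧ fm k q m θ z = z} = {1, z₁, z₂}) := by
  have hk0 : k ≠ 0 := by omega
  obtain ⟨hlt, heq, hgt⟩ := levelFn_level_sets hk hm hmq θ
  have hC := levelFn_one (q := q) (m := m) hk
  rw [setOf_fm_eq hk hm hmq hθ]
  set X := {x : ℝ | 0 < x ∧ levelFn k m ((q : ℝ) - m) x = θ} with hX
  have hone : ∀ x ∈ X, x ≠ 1 → x ^ k ≠ 1 := fun x hx hne h =>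
    hne ((pow_eq_one_iff_of_nonneg hx.1.le hk0).mp h)
  have hθC : θ ≠ thetaC k q → ∀ x ∈ X, x ≠ 1 := by
    rintro hne x ⟨-, hx⟩ rfl
    exact hne (hx.symm.trans hC)
  refine ⟨fun h => by rw [hlt h, image_empty, insert_empty_eq], fun hne h => ?_, fun h hne => ?_⟩
  · by_cases hθM : θ = thetaM k q m
    · obtain ⟨a, ha⟩ := heq hθM
      have haX : a ∈ X := ha ▸ mem_singleton a
      refine ⟨a ^ k, hone a haX (hθC (hθM ▸ hne) a haX), ?_⟩
      rw [ha, image_singleton]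
    · have hθC' := h.resolve_left hθM
      -- At θ_c the level set has two points, one of which is 1 and adds nothing to the trivial
      -- root.
      have h1 : (1 : ℝ) ∈ X := ⟨one_pos, hC.trans hθC'.symm⟩
      have hlt' : thetaM k q m < θ := by
        rcases lt_trichotomy θ (thetaM k q m) with h' | h' | h'
        · rw [hlt h'] at h1
          exact absurd h1 (notMem_empty 1)
        · exact absurd h' hθM
        · exact h'
      obtain ⟨a, b, hab, habX⟩ := hgt hlt'
      have haX : a ∈ X := habX ▸ mem_insert a _
      have hbX : b ∈ X := habX ▸ mem_insert_of_mem a rfl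
      rw [habX] at h1
      rcases h1 with rfl | h1
      · refine ⟨b ^ k, hone b hbX hab.ne', ?_⟩
        rw [habX, image_pair, one_pow, insert_eq_of_mem (mem_insert _ _)]
      · rw [mem_singleton_iff] at h1
        subst h1
        refine ⟨a ^ k, hone a haX hab.ne, ?_⟩
        rw [habX, image_pair, one_pow, pair_comm, insert_eq_of_mem (mem_insert _ _)]
  · obtain ⟨a, b, hab, habX⟩ := hgt h
    have haX : a ∈ X := habX ▸ mem_insert a _
    have hbX : b ∈ X := habX ▸ mem_insert_of_mem a rfl
    refine ⟨a ^ k, b ^ k, hone a haX (hθC hne a haX), hone b hbX (hθC hne b hbX),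
      pow_lt_pow_left₀ hab haX.1.le hk0, ?_⟩
    rw [habX, image_pair]

end FixedPoints

end CayleyGibbs

namespace CayleyGibbs

open Filter Topology MeasureTheory

/-! ### Monotone iteration of f_m -/

section Iteration

variable {k q m : ℕ} {θ : ℝ}

theorem fm_coeff_pos (hm : 1 ≤ m) (hmq : m < q) (hθ : 1 < θ) :
    (0 : ℝ) < m ∧ (0 : ℝ) < q - m ∧ 0 < θ + m - 1 ∧ 0 < (q : ℝ) - m - 1 + θ := by
  have hm' : (0 : ℝ) < m := by exact_mod_cast hm
  have hr' : (0 : ℝ) < (q : ℝ) - m := by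
    have : (m : ℝ) < q := by exact_mod_cast hmq
    linarith
  exact ⟨hm', hr', by linarith, by linarith⟩

/-- This is the sign of the determinant of the Möbius map inside f_m, which equals (θ - 1)(θ - 1 +
q). It makes f_m increasing and also gives J' ≥ 0. -/
theorem fm_det_nonneg (hm : 1 ≤ m) (hmq : m < q) (hθ : 1 < θ) :
    ((q : ℝ) - m) * m ≤ (θ + m - 1) * (q - m - 1 + θ) := by
  obtain ⟨h1, h2, -, -⟩ := fm_coeff_pos hm hmq hθ
  nlinarith

theorem fm_base_pos (hm : 1 ≤ m) (hmq : m < q) (hθ : 1 < θ) {z : ℝ} (hz : 0 < z) :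
    0 < (θ + m - 1) * z + (q - m) ∧ 0 < m * z + (q - m - 1 + θ) := by
  obtain ⟨h1, h2, h3, h4⟩ := fm_coeff_pos hm hmq hθ
  constructor <;> positivity

theorem fm_pos (hm : 1 ≤ m) (hmq : m < q) (hθ : 1 < θ) {z : ℝ} (hz : 0 < z) :
    0 < fm k q m θ z := by
  obtain ⟨h1, h2⟩ := fm_base_pos hm hmq hθ hz
  exact pow_pos (div_pos h1 h2) k

theorem fm_mono (hm : 1 ≤ m) (hmq : m < q) (hθ : 1 < θ) {z w : ℝ} (hz : 0 < z) (hzw : z ≤ w) :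
    fm k q m θ z ≤ fm k q m θ w := by
  obtain ⟨h1, h2⟩ := fm_base_pos hm hmq hθ hz
  obtain ⟨h3, h4⟩ := fm_base_pos hm hmq hθ (hz.trans_le hzw)
  refine pow_le_pow_left₀ (div_pos h1 h2).le ?_ k
  rw [div_le_div_iff₀ h2 h4]
  have := mul_nonneg (sub_nonneg.mpr (fm_det_nonneg hm hmq hθ)) (sub_nonneg.mpr hzw)
  linarith

/-- The bound is the limit of f_m at infinity; the one in `le_fm` is the value at 0. -/
theorem fm_le (hm : 1 ≤ m) (hmq : m < q) (hθ : 1 < θ) {z : ℝ} (hz : 0 < z) :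
    fm k q m θ z ≤ ((θ + m - 1) / m) ^ k := by
  obtain ⟨h1, h2⟩ := fm_base_pos hm hmq hθ hz
  refine pow_le_pow_left₀ (div_pos h1 h2).le ?_ k
  rw [div_le_div_iff₀ h2 (fm_coeff_pos hm hmq hθ).1]
  have := fm_det_nonneg hm hmq hθ
  linarith

theorem le_fm (hm : 1 ≤ m) (hmq : m < q) (hθ : 1 < θ) {z : ℝ} (hz : 0 < z) :
    (((q : ℝ) - m) / (q - m - 1 + θ)) ^ k ≤ fm k q m θ z := by
  obtain ⟨h1, h2⟩ := fm_base_pos hm hmq hθ hz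
  obtain ⟨-, hr, -, hs⟩ := fm_coeff_pos hm hmq hθ
  refine pow_le_pow_left₀ (div_pos hr hs).le ?_ k
  rw [div_le_div_iff₀ hs h2]
  have := mul_nonneg (sub_nonneg.mpr (fm_det_nonneg hm hmq hθ)) hz.le
  linarith

theorem continuousAt_fm (hm : 1 ≤ m) (hmq : m < q) (hθ : 1 < θ) {z : ℝ} (hz : 0 < z) :
    ContinuousAt (fm k q m θ) z := by
  obtain ⟨-, h2⟩ := fm_base_pos hm hmq hθ hz
  have h : ContinuousAt
      (fun z : ℝ => ((θ + m - 1) * z + (q - m)) / (m * z + (q - m - 1 + θ))) z :=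
    ContinuousAt.div (by fun_prop) (by fun_prop) h2.ne'
  exact h.pow k

theorem fm_eq_of_tendsto (hm : 1 ≤ m) (hmq : m < q) (hθ : 1 < θ) {z : ℕ → ℝ} {l : ℝ} (hl : 0 < l)
    (hz : ∀ j, fm k q m θ (z j) = z (j + 1)) (hlim : Tendsto z atTop (𝓝 l)) :
    fm k q m θ l = l := by
  have h1 := (continuousAt_fm (k := k) hm hmq hθ hl).tendsto.comp hlim
  have h2 := hlim.comp (tendsto_add_atTop_nat 1)
  refine tendsto_nhds_unique h1 (h2.congr fun j => ?_)
  exact (hz j).symm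

/-- The iterates of `f_m` from a large starting value converge to the largest fixed point. -/
theorem exists_iterate_tendsto_max (hm : 1 ≤ m) (hmq : m < q) (hθ : 1 < θ) {w : ℝ} (hw : 0 < w)
    (hfw : fm k q m θ w = w) (hmax : ∀ z, 0 < z → fm k q m θ z = z → z ≤ w) (K : ℝ) :
    ∃ z : ℕ → ℝ, (∀ j, 0 < z j) ∧ (∀ j, fm k q m θ (z j) = z (j + 1)) ∧ K ≤ Real.log (z 0) ∧
      Tendsto z atTop (𝓝 w) := by
  -- Being above the bound of `fm_le`, `a` satisfies f_m(a) ≤ a and w = f_m(w) ≤ a. The orbit then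
  -- decreases and stays above w.
  set a := max (Real.exp K) (((θ + m - 1) / m) ^ k) with ha
  have ha0 : 0 < a := lt_of_lt_of_le (Real.exp_pos K) (le_max_left _ _)
  let z : ℕ → ℝ := fun j => (fm k q m θ)^[j] a
  have hz : ∀ j, fm k q m θ (z j) = z (j + 1) := fun j =>
    (Function.iterate_succ_apply' _ _ _).symm
  have hwz : ∀ j, w ≤ z j := by
    intro j
    induction j with
    | zero => exact hfw ▸ (fm_le hm hmq hθ hw).trans (le_max_right _ _)
    | succ j ih =>
      rw [← hz, ← hfw]
      exact fm_mono hm hmq hθ hw ih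
  have hpos : ∀ j, 0 < z j := fun j => hw.trans_le (hwz j)
  have hanti : Antitone z := by
    refine antitone_nat_of_succ_le fun j => ?_
    induction j with
    | zero =>
      rw [← hz]
      exact (fm_le hm hmq hθ (hpos 0)).trans (le_max_right _ _)
    | succ j ih =>
      have h := fm_mono (k := k) hm hmq hθ (hpos _) ih
      rwa [hz, hz] at h
  have hlim := tendsto_atTop_ciInf hanti ⟨w, by rintro _ ⟨j, rfl⟩; exact hwz j⟩
  have hwl : w ≤ ⨅ j, z j := le_ciInf hwz
  have hl := hw.trans_le hwl
  refine ⟨z, hpos, hz, ?_, ?_⟩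
  · rw [Real.le_log_iff_exp_le (hpos 0)]
    exact le_max_left _ _
  · rwa [le_antisymm (hmax _ hl (fm_eq_of_tendsto hm hmq hθ hl hz hlim)) hwl] at hlim

/-- The iterates of `f_m` from a small starting value converge to the smallest fixed point. -/
theorem exists_iterate_tendsto_min (hm : 1 ≤ m) (hmq : m < q) (hθ : 1 < θ) {w : ℝ} (hw : 0 < w)
    (hfw : fm k q m θ w = w) (hmin : ∀ z, 0 < z → fm k q m θ z = z → w ≤ z) (K : ℝ) :
    ∃ z : ℕ → ℝ, (∀ j, 0 < z j) ∧ (∀ j, fm k q m θ (z j) = z (j + 1)) ∧ Real.log (z 0) ≤ K ∧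
      Tendsto z atTop (𝓝 w) := by
  obtain ⟨-, hr, -, hs⟩ := fm_coeff_pos hm hmq hθ
  set a := min (Real.exp K) (((((q : ℝ) - m) / (q - m - 1 + θ))) ^ k) with ha
  have ha0 : 0 < a := lt_min (Real.exp_pos K) (pow_pos (div_pos hr hs) k)
  let z : ℕ → ℝ := fun j => (fm k q m θ)^[j] a
  have hz : ∀ j, fm k q m θ (z j) = z (j + 1) := fun j =>
    (Function.iterate_succ_apply' _ _ _).symm
  have hpos : ∀ j, 0 < z j := by
    intro j
    induction j with
    | zero => exact ha0
    | succ j ih =>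
      rw [← hz]
      exact fm_pos hm hmq hθ ih
  have hwz : ∀ j, z j ≤ w := by
    intro j
    induction j with
    | zero =>
      rw [← hfw]
      exact (min_le_right _ _).trans (le_fm hm hmq hθ hw)
    | succ j ih =>
      rw [← hz, ← hfw]
      exact fm_mono hm hmq hθ (hpos j) ih
  have hmono : Monotone z := by
    refine monotone_nat_of_le_succ fun j => ?_
    induction j with
    | zero =>
      rw [← hz]
      exact (min_le_right _ _).trans (le_fm hm hmq hθ (hpos 0))
    | succ j ih =>
      have h := fm_mono (k := k) hm hmq hθ (hpos _) ih
      rwa [hz, hz] at h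
  have hbdd : BddAbove (Set.range z) := ⟨w, by rintro _ ⟨j, rfl⟩; exact hwz j⟩
  have hlim := tendsto_atTop_ciSup hmono hbdd
  have hwl : ⨆ j, z j ≤ w := ciSup_le hwz
  have hl : 0 < ⨆ j, z j := (hpos 0).trans_le (le_ciSup hbdd 0)
  refine ⟨z, hpos, hz, ?_, ?_⟩
  · rw [Real.log_le_iff_le_exp (hpos 0)]
    exact min_le_left _ _
  · rwa [le_antisymm hwl (hmin _ hl (fm_eq_of_tendsto hm hmq hθ hl hz hlim))] at hlim

end Iteration

/-! ### From Potts weights to effective Ising weights -/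

section Transfer

variable {k q m : ℕ} {θ : ℝ}

/-- The number of Potts spin values in a fuzzy class. -/
def classCard (q m : ℕ) (b : Bool) : ℝ := if b then m else q - m

/-- The sum of the Potts edge weights over the spin values of the class `b'` at one end, for a spin
value of the class `a'` at the other end. -/
def transferWeight (q m : ℕ) (θ : ℝ) (a' b' : Bool) : ℝ :=
  classCard q m b' + if a' = b' then θ - 1 else 0

/-- A quarter of the logarithm of the ratio of the symmetrised transfer weights. -/
noncomputable def edgeField (q m : ℕ) (θ : ℝ) : ℝ :=
  (1 / 4) * Real.log ((θ + m - 1) * m / ((q - m) * (θ + q - m - 1)))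

/-- The parent factor of the transfer weights relative to the Ising weights. -/
noncomputable def parentFactor (q m : ℕ) (θ : ℝ) (a : Bool) : ℝ :=
  edgeField q m θ * spin a - Real.log (classCard q m a)

/-- The child factor of the transfer weights relative to the Ising weights. -/
noncomputable def childFactor (k q m : ℕ) (θ : ℝ) (b : Bool) : ℝ :=
  (edgeField q m θ - isingH k q m θ) * spin b

theorem classCard_pos (hm : 1 ≤ m) (hmq : m < q) (b : Bool) : 0 < classCard q m b := by
  have hm' : (0 : ℝ) < m := by exact_mod_cast hm
  have hr' : (0 : ℝ) < (q : ℝ) - m := by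
    have : (m : ℝ) < q := by exact_mod_cast hmq
    linarith
  cases b <;> simpa [classCard]

theorem sum_fuzzy_one (hmq : m < q) (b' : Bool) :
    (∑ b : Fin q, if fuzzy q m b = b' then (1 : ℝ) else 0) = classCard q m b' := by
  have htrue : (∑ b : Fin q, if (b : ℕ) < m then (1 : ℝ) else 0) = m := by
    rw [Fin.sum_univ_eq_sum_range (fun i => if i < m then (1 : ℝ) else 0), Finset.sum_boole]
    congr 1
    have : (Finset.range q).filter (fun i => i < m) = Finset.range m := by
      ext i
      simp only [Finset.mem_filter, Finset.mem_range]
      omega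
    rw [this, Finset.card_range]
  cases b'
  · have : ∀ b : Fin q, (if fuzzy q m b = false then (1 : ℝ) else 0) =
        1 - if (b : ℕ) < m then (1 : ℝ) else 0 := by
      intro b
      by_cases h : (b : ℕ) < m <;> simp [fuzzy, h]
    simp only [this, Finset.sum_sub_distrib, htrue, classCard]
    simp
  · simpa [fuzzy, classCard] using htrue

theorem exp_potts (hθ : 1 < θ) (a b : Fin q) :
    Real.exp (-(potts q θ).pair a b - (potts q θ).field b) = 1 + if a = b then θ - 1 else 0 := by
  simp only [potts]
  split_ifs
  · rw [neg_neg, sub_zero, Real.exp_log (by linarith)]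
    ring
  · simp

/-- Every spin of the class `b'` contributes 1, with an extra θ - 1 from `a` itself if it lies in
that class. Only the class of `a` matters, which makes the model lumpable. -/
theorem sum_fuzzy_potts (hmq : m < q) (hθ : 1 < θ) (a : Fin q) (b' : Bool) :
    (∑ b, if fuzzy q m b = b' then
      Real.exp (-(potts q θ).pair a b - (potts q θ).field b) else 0) =
      transferWeight q m θ (fuzzy q m a) b' := by
  have h1 : ∀ b, (if fuzzy q m b = b' then
      Real.exp (-(potts q θ).pair a b - (potts q θ).field b) else 0) =
      (if fuzzy q m b = b' then (1 : ℝ) else 0) +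
        if a = b then (if fuzzy q m a = b' then θ - 1 else 0) else 0 := by
    intro b
    rw [exp_potts hθ]
    by_cases hab : a = b
    · subst hab
      split_ifs <;> ring
    · simp only [hab, if_false, add_zero]
  simp only [h1, Finset.sum_add_distrib, sum_fuzzy_one hmq, Finset.sum_ite_eq, Finset.mem_univ,
    if_true, transferWeight]

theorem edgeField_eq (hm : 1 ≤ m) (hmq : m < q) (hθ : 1 < θ) :
    edgeField q m θ = (1 / 4) * (Real.log (θ + m - 1) + Real.log m - Real.log (q - m) -
      Real.log (θ + q - m - 1)) := by
  obtain ⟨h1, h2, h3, h4⟩ := fm_coeff_pos hm hmq hθ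
  have h4' : 0 < θ + q - m - 1 := by linarith
  rw [edgeField, Real.log_div (by positivity) (by positivity), Real.log_mul h3.ne' h1.ne',
    Real.log_mul h2.ne' h4'.ne']
  ring

theorem isingJ_eq (hm : 1 ≤ m) (hmq : m < q) (hθ : 1 < θ) :
    isingJ q m θ = (1 / 4) * (Real.log (θ + m - 1) + Real.log (θ + q - m - 1) -
      Real.log (q - m) - Real.log m) := by
  obtain ⟨h1, h2, h3, h4⟩ := fm_coeff_pos hm hmq hθ
  have h4' : 0 < θ + q - m - 1 := by linarith
  rw [isingJ, Real.log_div (by positivity) (by positivity), Real.log_mul h3.ne' h4'.ne',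
    Real.log_mul h2.ne' h1.ne']
  ring

theorem isingJ_nonneg (hm : 1 ≤ m) (hmq : m < q) (hθ : 1 < θ) : 0 ≤ isingJ q m θ := by
  obtain ⟨h1, h2, -, -⟩ := fm_coeff_pos hm hmq hθ
  refine mul_nonneg (by norm_num) (Real.log_nonneg ?_)
  rw [le_div_iff₀ (by positivity), one_mul]
  have := fm_det_nonneg hm hmq hθ
  linarith

theorem isingH_eq (hm : 1 ≤ m) (hmq : m < q) (hθ : 1 < θ) :
    isingH k q m θ = (k + 1) * edgeField q m θ - k / 2 * (Real.log m - Real.log (q - m)) := by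
  obtain ⟨h1, h2, h3, h4⟩ := fm_coeff_pos hm hmq hθ
  have h4' : 0 < θ + q - m - 1 := by linarith
  have hmr : (0 : ℝ) < m / (q - m) := div_pos h1 h2
  have hk : (0 : ℝ) < (k : ℝ) + 1 := by positivity
  rw [isingH, edgeField, Real.log_mul (by positivity) (by positivity), Real.log_pow, one_div,
    Real.log_inv, Real.log_rpow hmr, Real.log_div h1.ne' h2.ne']
  field_simp
  push_cast
  ring

theorem transferWeight_pos (hm : 1 ≤ m) (hmq : m < q) (hθ : 1 < θ) (a' b' : Bool) :
    0 < transferWeight q m θ a' b' := by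
  refine add_pos_of_pos_of_nonneg (classCard_pos hm hmq b') ?_
  split_ifs <;> linarith

/-- Multiplied by the size of the parent class the matrix becomes symmetric, so its logarithm is a
constant plus J' times the product of the spins plus `edgeField` times their sum. The child factor
compensates for h' already counted as site field. -/
theorem transferWeight_eq (hm : 1 ≤ m) (hmq : m < q) (hθ : 1 < θ) (a' b' : Bool) :
    transferWeight q m θ a' b' = Real.exp ((isingJ q m θ + Real.log m + Real.log (q - m)) -
      (effectiveIsing k q m θ).pair a' b' - (effectiveIsing k q m θ).field b' +
      parentFactor q m θ a' + childFactor k q m θ b') := by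
  rw [← Real.exp_log (transferWeight_pos hm hmq hθ a' b')]
  congr 1
  have e1 : (m : ℝ) + (θ - 1) = θ + m - 1 := by ring
  have e2 : (q : ℝ) - m + (θ - 1) = θ + q - m - 1 := by ring
  cases a' <;> cases b' <;>
  simp only [transferWeight, classCard, effectiveIsing, parentFactor, childFactor, spin,
    edgeField_eq hm hmq hθ, isingJ_eq hm hmq hθ, if_true, if_false, Bool.false_eq_true, add_zero,
    e1, e2, reduceCtorEq] <;> ring

/-- This balance determines h': a site acts once as child and k times as parent, and the dependence
on its spin must cancel. -/
theorem childFactor_add (hm : 1 ≤ m) (hmq : m < q) (hθ : 1 < θ) (a : Bool) :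
    childFactor k q m θ a + k * parentFactor q m θ a =
      -(k / 2 * (Real.log m + Real.log (q - m))) := by
  cases a <;>
  simp only [parentFactor, childFactor, isingH_eq hm hmq hθ, classCard, spin, if_true, if_false,
    Bool.false_eq_true] <;> ring

/-- The root acts k + 1 times as parent and never as child. The same h' balances its class sizes, so
the effective field is uniform. -/
theorem sum_fuzzy_root (hm : 1 ≤ m) (hmq : m < q) (hθ : 1 < θ) (a' : Bool) :
    (∑ a, if fuzzy q m a = a' then Real.exp (-(potts q θ).field a) else 0) =
      Real.exp (-(k / 2 * (Real.log m + Real.log (q - m))) -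
        (effectiveIsing k q m θ).field a' - (k + 1) * parentFactor q m θ a') := by
  simp only [potts, neg_zero, Real.exp_zero, sum_fuzzy_one hmq]
  rw [← Real.exp_log (classCard_pos hm hmq a')]
  congr 1
  cases a' <;>
  simp only [parentFactor, effectiveIsing, isingH_eq hm hmq hθ, classCard, spin, if_true, if_false,
    Bool.false_eq_true] <;> ring

/-- The difference between the Ising boundary field and `log z`. -/
noncomputable def fieldShift (k q m : ℕ) (θ : ℝ) : ℝ :=
  childFactor k q m θ true - childFactor k q m θ false

theorem transfer_sum (a' : Bool) (z : ℝ) :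
    transferWeight q m θ a' true * z + transferWeight q m θ a' false =
      if a' then (θ + m - 1) * z + (q - m) else m * z + (q - m - 1 + θ) := by
  cases a' <;>
  simp only [transferWeight, classCard, if_true, if_false, Bool.false_eq_true, reduceCtorEq,
    add_zero] <;> ring

theorem log_fm (hm : 1 ≤ m) (hmq : m < q) (hθ : 1 < θ) {z : ℝ} (hz : 0 < z) :
    Real.log (fm k q m θ z) = k * Real.log ((θ + m - 1) * z + (q - m)) -
      k * Real.log (m * z + (q - m - 1 + θ)) := by
  obtain ⟨h1, h2⟩ := fm_base_pos hm hmq hθ hz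
  rw [fm, Real.log_pow, Real.log_div h1.ne' h2.ne']
  ring

/-- The shift absorbs the child factors and turns the one-step sums into those of f_m. The parent
factors, multiplied by k, restore the same shift by `childFactor_add`. -/
theorem stepField_effectiveIsing (hm : 1 ≤ m) (hmq : m < q) (hθ : 1 < θ) {z : ℝ} (hz : 0 < z) :
    stepField (effectiveIsing k q m θ) k (boolField (Real.log z + fieldShift k q m θ)) true -
      stepField (effectiveIsing k q m θ) k (boolField (Real.log z + fieldShift k q m θ)) false =
      Real.log (fm k q m θ z) + fieldShift k q m θ := by
  set M := effectiveIsing k q m θ with hM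
  set c := isingJ q m θ + Real.log m + Real.log (q - m)
  have hw : ∀ a' b', Real.exp (-M.pair a' b' - M.field b' +
      boolField (Real.log z + fieldShift k q m θ) b') =
      Real.exp (-c - parentFactor q m θ a' - childFactor k q m θ false) *
        (transferWeight q m θ a' b' * if b' then z else 1) := by
    intro a' b'
    rw [transferWeight_eq (k := k) hm hmq hθ, ← mul_assoc, ← Real.exp_add]
    have : (if b' then z else 1) = Real.exp (if b' then Real.log z else 0) := by
      cases b' <;> simp [Real.exp_log hz]
    rw [this, ← Real.exp_add]
    congr 1
    cases b' <;>
    simp only [boolField, fieldShift, if_true, if_false, Bool.false_eq_true, ← hM] <;> ring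
  have hstep : ∀ a', stepField M k (boolField (Real.log z + fieldShift k q m θ)) a' =
      k * (-c - parentFactor q m θ a' - childFactor k q m θ false) + k * Real.log
        (transferWeight q m θ a' true * z + transferWeight q m θ a' false) := by
    intro a'
    have h1 := transferWeight_pos hm hmq hθ a' true
    have h2 := transferWeight_pos hm hmq hθ a' false
    rw [stepField, Fintype.sum_bool, hw, hw, ← mul_add, Real.log_mul (Real.exp_pos _).ne',
      Real.log_exp, mul_add]
    · simp
    · simp only [if_true, Bool.false_eq_true, if_false, mul_one]
      positivity
  have h1 := childFactor_add (k := k) hm hmq hθ true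
  have h2 := childFactor_add (k := k) hm hmq hθ false
  rw [hstep, hstep, transfer_sum, transfer_sum, log_fm hm hmq hθ hz, fieldShift]
  simp only [if_true, Bool.false_eq_true, if_false]
  linarith

theorem sum_eq_sum_fuzzy (F : Fin q → ℝ) :
    ∑ b, F b = (∑ b, if fuzzy q m b = true then F b else 0) +
      ∑ b, if fuzzy q m b = false then F b else 0 := by
  rw [← Finset.sum_add_distrib]
  refine Finset.sum_congr rfl fun b _ => ?_
  cases fuzzy q m b <;> simp

theorem stepField_potts (hmq : m < q) (hθ : 1 < θ) {z : ℝ} (hz : 0 < z) (a : Fin q) :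
    stepField (potts q θ) k (fun i => if (i : ℕ) < m then Real.log z else 0) a =
      k * Real.log (if fuzzy q m a then (θ + m - 1) * z + (q - m)
        else m * z + (q - m - 1 + θ)) := by
  rw [stepField, ← transfer_sum, sum_eq_sum_fuzzy (m := m), ← sum_fuzzy_potts hmq hθ,
    ← sum_fuzzy_potts hmq hθ, Finset.sum_mul]
  congr 3
  · refine Finset.sum_congr rfl fun b _ => ?_
    by_cases h : (b : ℕ) < m
    · simp [fuzzy, h, Real.exp_add, Real.exp_log hz]
    · simp [fuzzy, h]
  · refine Finset.sum_congr rfl fun b _ => ?_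
    by_cases h : (b : ℕ) < m <;> simp [fuzzy, h]

end Transfer

end CayleyGibbs

namespace CayleyGibbs

open Filter Topology MeasureTheory

/-! ### Classification and extremality of the TISGMs of H' -/

section Main

variable {V : Type*} {G : SimpleGraph V} [G.LocallyFinite] {x₀ : V} {k q m : ℕ} {θ : ℝ}

theorem effectiveIsing_pair_comm (a b : Bool) :
    (effectiveIsing k q m θ).pair a b = (effectiveIsing k q m θ).pair b a := by
  simp only [effectiveIsing, mul_comm (spin a)]

theorem potts_pair_comm (a b : Fin q) : (potts q θ).pair a b = (potts q θ).pair b a := by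
  simp only [potts, eq_comm (a := a)]

theorem exists_isPottsTISGM (hT : G.IsTree) (hreg : G.IsRegularOfDegree (k + 1)) (hm : 1 ≤ m)
    (hmq : m < q) (hθ : 1 < θ) {z : ℝ} (hz : 0 < z) (hfz : fm k q m θ z = z) :
    ∃ μ, IsPottsTISGM G x₀ q m θ z μ := by
  have : Nonempty (Fin q) := ⟨⟨0, by omega⟩⟩
  refine exists_isSplittingGibbs potts_pair_comm hT hreg
    (c := k * Real.log (m * z + (q - m - 1 + θ))) fun a => ?_
  have hlog := log_fm (k := k) hm hmq hθ hz
  rw [hfz] at hlog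
  rw [stepField_potts hmq hθ hz]
  by_cases h : (a : ℕ) < m
  · simp only [fuzzy, h, decide_true, if_true, hlog]
    ring
  · simp only [fuzzy, h, decide_false, Bool.false_eq_true, if_false, zero_add]

/-- The fuzzy image of a translation-invariant Potts measure is an Ising splitting measure. -/
theorem IsPottsTISGM.fuzzyMap (hT : G.IsTree) (hreg : G.IsRegularOfDegree (k + 1)) (hm : 1 ≤ m)
    (hmq : m < q) (hθ : 1 < θ) {z : ℝ} {μ : Measure (V → Fin q)}
    (hμ : IsPottsTISGM G x₀ q m θ z μ) :
    IsSplittingGibbs G (effectiveIsing k q m θ) x₀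
      (fun _ => boolField (Real.log z + fieldShift k q m θ)) (CayleyGibbs.fuzzyMap q m μ) := by
  have : Nonempty (Fin q) := ⟨⟨0, by omega⟩⟩
  have hμ' : IsSplittingGibbs G (potts q θ) x₀
      (fun _ i => boolField (Real.log z) (fuzzy q m i)) μ := by
    simpa only [IsPottsTISGM, boolField, fuzzy, decide_eq_true_eq] using hμ
  refine (hμ'.map (M' := effectiveIsing k q m θ) (fuzzy q m) potts_pair_comm
    effectiveIsing_pair_comm hT hreg
    (fun a b' => (sum_fuzzy_potts hmq hθ a b').trans
      (transferWeight_eq (k := k) hm hmq hθ _ b')) (childFactor_add hm hmq hθ)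
    (sum_fuzzy_root hm hmq hθ)).congr_add_const (c := fun _ => -childFactor k q m θ false)
    fun x a => ?_
  cases a <;> simp only [boolField, fieldShift, if_true, Bool.false_eq_true, if_false] <;> ring

/-- A TISGM is normalised to a single difference d, which must be fixed by the recursion. Then exp(d
- shift) is a fixed point of f_m, and uniqueness for a given vector identifies the measure with a
fuzzy image. -/
theorem tisgms_effectiveIsing (hT : G.IsTree) (hreg : G.IsRegularOfDegree (k + 1)) (hm : 1 ≤ m)
    (hmq : m < q) (hθ : 1 < θ) {μ : ℝ → Measure (V → Fin q)}
    (hμ : ∀ z, 0 < z → fm k q m θ z = z → IsPottsTISGM G x₀ q m θ z (μ z)) :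
    tisgms G (effectiveIsing k q m θ) x₀ =
      (fun z => fuzzyMap q m (μ z)) '' {z : ℝ | 0 < z ∧ fm k q m θ z = z} := by
  refine Set.Subset.antisymm ?_ ?_
  · rintro ν ⟨h, hh, hν⟩
    set d := h x₀ true - h x₀ false with hd
    have hν' : IsSplittingGibbs G (effectiveIsing k q m θ) x₀ (fun _ => boolField d) ν := by
      refine hν.congr_add_const (c := fun x => -h x false) fun x a => ?_
      have := hh x x₀ true false
      cases a
      · simp [boolField]
      · simp only [boolField, if_true]
        linarith
    have key := (hν'.stepField effectiveIsing_pair_comm hT hreg).sub_eq_sub hT hreg hν'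
    set z := Real.exp (d - fieldShift k q m θ) with hz
    have hz0 : 0 < z := Real.exp_pos _
    have hdz : d = Real.log z + fieldShift k q m θ := by
      rw [hz, Real.log_exp]
      ring
    rw [hdz, stepField_effectiveIsing hm hmq hθ hz0] at key
    simp only [boolField, if_true, Bool.false_eq_true, if_false, sub_zero] at key
    have hfz : fm k q m θ z = z :=
      Real.log_injOn_pos (fm_pos hm hmq hθ hz0) hz0 (add_right_cancel key)
    refine ⟨z, ⟨hz0, hfz⟩, ?_⟩
    rw [hdz] at hν'
    exact ((hμ z hz0 hfz).fuzzyMap hT hreg hm hmq hθ).unique hT hν'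
  · rintro _ ⟨z, ⟨hz0, hfz⟩, rfl⟩
    exact ⟨_, fun _ _ _ _ => rfl, (hμ z hz0 hfz).fuzzyMap hT hreg hm hmq hθ⟩

theorem IsPottsTISGM.fuzzyMap_ne (hT : G.IsTree) (hreg : G.IsRegularOfDegree (k + 1)) (hm : 1 ≤ m)
    (hmq : m < q) (hθ : 1 < θ) {z w : ℝ} {μ ν : Measure (V → Fin q)}
    (hμ : IsPottsTISGM G x₀ q m θ z μ) (hν : IsPottsTISGM G x₀ q m θ w ν)
    (hz : 0 < z) (hw : 0 < w) (hzw : z ≠ w) :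
    CayleyGibbs.fuzzyMap q m μ ≠ CayleyGibbs.fuzzyMap q m ν := by
  intro h
  have h1 := hμ.fuzzyMap hT hreg hm hmq hθ
  have h2 := hν.fuzzyMap hT hreg hm hmq hθ
  rw [h] at h1
  have key := h1.sub_eq_sub hT hreg h2
  simp only [boolField, if_true, Bool.false_eq_true, if_false, sub_zero] at key
  exact hzw (Real.log_injOn_pos hz hw (add_right_cancel key))

theorem splittingGibbsMeasures_subset_gibbsMeasures (hT : G.IsTree) :
    splittingGibbsMeasures G (effectiveIsing k q m θ) x₀ ⊆
      gibbsMeasures G (effectiveIsing k q m θ) := by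
  rintro μ ⟨h, hμ⟩
  exact hμ.mem_gibbsMeasures effectiveIsing_pair_comm hT

/-- The fuzzy images for the largest and for the smallest fixed point are extreme. -/
theorem IsPottsTISGM.fuzzyMap_mem_extremePoints (hT : G.IsTree)
    (hreg : G.IsRegularOfDegree (k + 1)) (hm : 1 ≤ m) (hmq : m < q) (hθ : 1 < θ) {w : ℝ}
    {μ : Measure (V → Fin q)} (hμ : IsPottsTISGM G x₀ q m θ w μ) (hw : 0 < w)
    (hfw : fm k q m θ w = w)
    (h : (∀ z, 0 < z → fm k q m θ z = z → z ≤ w) ∨ ∀ z, 0 < z → fm k q m θ z = z → w ≤ z) :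
    CayleyGibbs.fuzzyMap q m μ ∈
        Set.extremePoints NNReal (gibbsMeasures G (effectiveIsing k q m θ)) ∧
      CayleyGibbs.fuzzyMap q m μ ∈
        Set.extremePoints NNReal (splittingGibbsMeasures G (effectiveIsing k q m θ) x₀) := by
  have hμ' := hμ.fuzzyMap hT hreg hm hmq hθ
  have hsub := splittingGibbsMeasures_subset_gibbsMeasures (x₀ := x₀) (k := k) (q := q) (m := m)
    (θ := θ) hT
  have hmem : CayleyGibbs.fuzzyMap q m μ ∈
      splittingGibbsMeasures G (effectiveIsing k q m θ) x₀ := ⟨_, hμ'⟩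
  have hJ := isingJ_nonneg hm hmq hθ
  have hlim : ∀ {z : ℕ → ℝ}, Tendsto z atTop (𝓝 w) →
      Tendsto (fun j => Real.log (z j) + fieldShift k q m θ) atTop
        (𝓝 (Real.log w + fieldShift k q m θ)) := fun hz =>
    (((Real.continuousAt_log hw.ne').tendsto.comp hz).add_const _)
  have hdom : (∀ ν ∈ gibbsMeasures G (effectiveIsing k q m θ), ∀ A : Finset V,
      ν (cyl A fun _ => true) ≤ CayleyGibbs.fuzzyMap q m μ (cyl A fun _ => true)) ∨
      ∀ ν ∈ gibbsMeasures G (effectiveIsing k q m θ), ∀ A : Finset V,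
        CayleyGibbs.fuzzyMap q m μ (cyl A fun _ => true) ≤ ν (cyl A fun _ => true) := by
    rcases h with h | h
    -- This threshold puts the initial Ising field log z + shift above 2(k + 1)J', the strongest
    -- field that a boundary condition can exert.
    · obtain ⟨z, hz0, hz, hzK, hzw⟩ := exists_iterate_tendsto_max hm hmq hθ hw hfw h
        (2 * (k + 1) * isingJ q m θ - fieldShift k q m θ)
      refine Or.inl fun ν hν A => hμ'.le_cyl_true hJ (fun _ _ => rfl) hT hreg (fun j => ?_) ?_
        (hlim hzw) hν A
      · rw [stepField_effectiveIsing hm hmq hθ (hz0 j), hz]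
      · linarith
    · obtain ⟨z, hz0, hz, hzK, hzw⟩ := exists_iterate_tendsto_min hm hmq hθ hw hfw h
        (-(2 * (k + 1) * isingJ q m θ) - fieldShift k q m θ)
      refine Or.inr fun ν hν A => hμ'.cyl_true_le hJ (fun _ _ => rfl) hT hreg (fun j => ?_) ?_
        (hlim hzw) hν A
      · rw [stepField_effectiveIsing hm hmq hθ (hz0 j), hz]
      · linarith
  exact ⟨mem_extremePoints_of_cyl_true (fun ν hν => hν.1) (hsub hmem) hdom,
    mem_extremePoints_of_cyl_true (fun ν hν => (hsub hν).1) hmem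
      (hdom.imp (fun h ν hν => h ν (hsub hν)) fun h ν hν => h ν (hsub hν))⟩

/-- The least and the greatest fixed points differ, and each gives an extreme measure. -/
theorem two_le_encard_extreme (hT : G.IsTree) (hreg : G.IsRegularOfDegree (k + 1)) (hm : 1 ≤ m)
    (hmq : m < q) (hθ : 1 < θ) {μ : ℝ → Measure (V → Fin q)}
    (hμ : ∀ z, 0 < z → fm k q m θ z = z → IsPottsTISGM G x₀ q m θ z (μ z)) {Z : Set ℝ}
    (hZ : {z : ℝ | 0 < z ∧ fm k q m θ z = z} = Z) (hfin : Z.Finite) (hnt : Z.Nontrivial) :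
    2 ≤ Set.encard {ν : Measure (V → Bool) | ν ∈ (fun z => fuzzyMap q m (μ z)) '' Z ∧
      ν ∈ Set.extremePoints NNReal (gibbsMeasures G (effectiveIsing k q m θ)) ∧
      ν ∈ Set.extremePoints NNReal (splittingGibbsMeasures G (effectiveIsing k q m θ) x₀)} := by
  have hmem : ∀ z, z ∈ Z ↔ 0 < z ∧ fm k q m θ z = z := fun z => by rw [← hZ, Set.mem_ofPred_eq]
  obtain ⟨a, ha, hamin⟩ := Set.exists_min_image Z id hfin hnt.nonempty
  obtain ⟨b, hb, hbmax⟩ := Set.exists_max_image Z id hfin hnt.nonempty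
  have hab : a ≠ b := by
    rintro rfl
    obtain ⟨x, hx, y, hy, hxy⟩ := hnt
    exact hxy ((le_antisymm (hbmax x hx) (hamin x hx)).trans
      (le_antisymm (hbmax y hy) (hamin y hy)).symm)
  obtain ⟨ha0, hfa⟩ := (hmem a).mp ha
  obtain ⟨hb0, hfb⟩ := (hmem b).mp hb
  have hμa := hμ a ha0 hfa
  have hμb := hμ b hb0 hfb
  rw [← Set.encard_pair (hμa.fuzzyMap_ne hT hreg hm hmq hθ hμb ha0 hb0 hab)]
  refine Set.encard_le_encard (Set.insert_subset ?_ (Set.singleton_subset_iff.mpr ?_))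
  · exact ⟨⟨a, ha, rfl⟩, hμa.fuzzyMap_mem_extremePoints hT hreg hm hmq hθ ha0 hfa
      (Or.inr fun z hz hfz => hamin z ((hmem z).mpr ⟨hz, hfz⟩))⟩
  · exact ⟨⟨b, hb, rfl⟩, hμb.fuzzyMap_mem_extremePoints hT hreg hm hmq hθ hb0 hfb
      (Or.inl fun z hz hfz => hbmax z ((hmem z).mpr ⟨hz, hfz⟩))⟩

end Main

end CayleyGibbs
theorem mainTheorem7 {V : Type*} (G : SimpleGraph V) [G.LocallyFinite]
    (k : ℕ) (hk : 2 ≤ k) (hT : G.IsTree) (hreg : G.IsRegularOfDegree (k + 1)) (x₀ : V)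
    (q m : ℕ) (hm : 1 ≤ m) (hmq : m < q) (θ : ℝ) (hθ : 1 < θ) :
    (θ < CayleyGibbs.thetaM k q m →
      {z : ℝ | 0 < z ∧ CayleyGibbs.fm k q m θ z = z} = {1} ∧
      ∃ μ₀ : MeasureTheory.Measure (V → Fin q),
        CayleyGibbs.IsPottsTISGM G x₀ q m θ 1 μ₀ ∧
        CayleyGibbs.tisgms G (CayleyGibbs.effectiveIsing k q m θ) x₀ =
          {CayleyGibbs.fuzzyMap q m μ₀}) ∧
    (CayleyGibbs.thetaM k q m ≠ CayleyGibbs.thetaC k q →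
      (θ = CayleyGibbs.thetaM k q m ∨ θ = CayleyGibbs.thetaC k q) →
      ∃ z₁ : ℝ, z₁ ≠ 1 ∧
        {z : ℝ | 0 < z ∧ CayleyGibbs.fm k q m θ z = z} = {1, z₁} ∧
        ∃ μ₀ μ₁ : MeasureTheory.Measure (V → Fin q),
          CayleyGibbs.IsPottsTISGM G x₀ q m θ 1 μ₀ ∧
          CayleyGibbs.IsPottsTISGM G x₀ q m θ z₁ μ₁ ∧
          CayleyGibbs.fuzzyMap q m μ₀ ≠ CayleyGibbs.fuzzyMap q m μ₁ ∧
          CayleyGibbs.tisgms G (CayleyGibbs.effectiveIsing k q m θ) x₀ =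
            {CayleyGibbs.fuzzyMap q m μ₀, CayleyGibbs.fuzzyMap q m μ₁}) ∧
    (CayleyGibbs.thetaM k q m < θ → θ ≠ CayleyGibbs.thetaC k q →
      ∃ z₁ z₂ : ℝ, z₁ ≠ 1 ∧ z₂ ≠ 1 ∧ z₁ < z₂ ∧
        {z : ℝ | 0 < z ∧ CayleyGibbs.fm k q m θ z = z} = {1, z₁, z₂} ∧
        ∃ μ₀ μ₁ μ₂ : MeasureTheory.Measure (V → Fin q),
          CayleyGibbs.IsPottsTISGM G x₀ q m θ 1 μ₀ ∧
          CayleyGibbs.IsPottsTISGM G x₀ q m θ z₁ μ₁ ∧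
          CayleyGibbs.IsPottsTISGM G x₀ q m θ z₂ μ₂ ∧
          CayleyGibbs.fuzzyMap q m μ₀ ≠ CayleyGibbs.fuzzyMap q m μ₁ ∧
          CayleyGibbs.fuzzyMap q m μ₀ ≠ CayleyGibbs.fuzzyMap q m μ₂ ∧
          CayleyGibbs.fuzzyMap q m μ₁ ≠ CayleyGibbs.fuzzyMap q m μ₂ ∧
          CayleyGibbs.tisgms G (CayleyGibbs.effectiveIsing k q m θ) x₀ =
            {CayleyGibbs.fuzzyMap q m μ₀, CayleyGibbs.fuzzyMap q m μ₁,
              CayleyGibbs.fuzzyMap q m μ₂} ∧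
          2 ≤ Set.encard {ν : MeasureTheory.Measure (V → Bool) |
            ν ∈ ({CayleyGibbs.fuzzyMap q m μ₀, CayleyGibbs.fuzzyMap q m μ₁,
              CayleyGibbs.fuzzyMap q m μ₂} : Set (MeasureTheory.Measure (V → Bool))) ∧
            ν ∈ Set.extremePoints NNReal
              (CayleyGibbs.gibbsMeasures G (CayleyGibbs.effectiveIsing k q m θ)) ∧
            ν ∈ Set.extremePoints NNReal
              (CayleyGibbs.splittingGibbsMeasures G
                (CayleyGibbs.effectiveIsing k q m θ) x₀)}) := by
  open CayleyGibbs in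
  -- A measure is chosen for every real z, the zero measure away from the positive fixed points, so
  -- that one function indexes all TISGMs.
  have hex : ∀ z, ∃ μ, 0 < z → fm k q m θ z = z → IsPottsTISGM G x₀ q m θ z μ := fun z => by
    by_cases h : 0 < z ∧ fm k q m θ z = z
    · obtain ⟨μ, hμ⟩ := exists_isPottsTISGM (x₀ := x₀) hT hreg hm hmq hθ h.1 h.2
      exact ⟨μ, fun _ _ => hμ⟩
    · exact ⟨0, fun h1 h2 => absurd ⟨h1, h2⟩ h⟩
  choose μ hμ using hex
  have himg := CayleyGibbs.tisgms_effectiveIsing hT hreg hm hmq hθ hμ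
  obtain ⟨h1, h2, h3⟩ := CayleyGibbs.fm_solutions hk hm hmq hθ
  refine ⟨fun h => ?_, fun hne h => ?_, fun h hne => ?_⟩
  · have hZ := h1 h
    obtain ⟨p0, f0⟩ := hZ.symm.subset (Set.mem_singleton 1)
    refine ⟨hZ, μ 1, hμ 1 p0 f0, ?_⟩
    rw [himg, hZ, Set.image_singleton]
  · obtain ⟨z₁, hz₁, hZ⟩ := h2 hne h
    obtain ⟨p0, f0⟩ := hZ.symm.subset (Or.inl rfl : (1 : ℝ) ∈ ({1, z₁} : Set ℝ))
    obtain ⟨p1, f1⟩ := hZ.symm.subset (Or.inr rfl : z₁ ∈ ({1, z₁} : Set ℝ))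
    refine ⟨z₁, hz₁, hZ, μ 1, μ z₁, hμ 1 p0 f0, hμ z₁ p1 f1,
      (hμ 1 p0 f0).fuzzyMap_ne hT hreg hm hmq hθ (hμ z₁ p1 f1) p0 p1 hz₁.symm, ?_⟩
    rw [himg, hZ, Set.image_pair]
  · obtain ⟨z₁, z₂, hz₁, hz₂, hlt, hZ⟩ := h3 h hne
    obtain ⟨p0, f0⟩ := hZ.symm.subset (Or.inl rfl : (1 : ℝ) ∈ ({1, z₁, z₂} : Set ℝ))
    obtain ⟨p1, f1⟩ := hZ.symm.subset (Or.inr (Or.inl rfl) : z₁ ∈ ({1, z₁, z₂} : Set ℝ))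
    obtain ⟨p2, f2⟩ := hZ.symm.subset (Or.inr (Or.inr rfl) : z₂ ∈ ({1, z₁, z₂} : Set ℝ))
    have himg3 : (fun z => CayleyGibbs.fuzzyMap q m (μ z)) '' {1, z₁, z₂} =
        {CayleyGibbs.fuzzyMap q m (μ 1), CayleyGibbs.fuzzyMap q m (μ z₁),
          CayleyGibbs.fuzzyMap q m (μ z₂)} := by
      rw [Set.image_insert_eq, Set.image_pair]
    refine ⟨z₁, z₂, hz₁, hz₂, hlt, hZ, μ 1, μ z₁, μ z₂, hμ 1 p0 f0, hμ z₁ p1 f1, hμ z₂ p2 f2,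
      (hμ 1 p0 f0).fuzzyMap_ne hT hreg hm hmq hθ (hμ z₁ p1 f1) p0 p1 hz₁.symm,
      (hμ 1 p0 f0).fuzzyMap_ne hT hreg hm hmq hθ (hμ z₂ p2 f2) p0 p2 hz₂.symm,
      (hμ z₁ p1 f1).fuzzyMap_ne hT hreg hm hmq hθ (hμ z₂ p2 f2) p1 p2 hlt.ne,
      by rw [himg, hZ, himg3], ?_⟩
    rw [← himg3]
    exact CayleyGibbs.two_le_encard_extreme hT hreg hm hmq hθ hμ hZ (Set.toFinite _)
      ⟨z₁, Or.inr (Or.inl rfl), z₂, Or.inr (Or.inr rfl), hlt.ne⟩
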